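/- **Setting.** A *base set* is an infinite set $S$ of atoms (elements that are not sets). Its superstructure is $\hat S=\bigcup_{n\ge 0}S_n$, where $S_0=S$ and $S_{n}=S_{n-1}\cup\mathcal P(S_{n-1})$. Ordered pairs are $\langle a,b\rangle=\{a,\{a,b\}\}$ and triples are $\langle\langle a,b\rangle,c\rangle$. For $f,x\in\hat S$, $f(x)$ denotes the unique $y$ with $\langle x,y\rangle\in f$ if there is exactly one such $y$, and $\emptyset$ otherwise. Terms are built from constants (elements of $\hat S$) and variables by $\langle\cdot,\cdot\rangle$ and $\cdot(\cdot)$; formulas are built from $s=t$ and $s\in t$ by $\neg$, $\wedge$ and bounded quantification $(\forall X\in t)$. An *enlargement* is a map $*:\hat S\to\hat W$ between superstructures over base sets $S\subseteq W$ such that (i) ${}^*S=W$; (ii) ${}^*s=s$ for $s\in S$; (iii) (transfer) a statement $\varphi$ in $\hat S$ is true iff the statement ${}^*\varphi$, obtained by replacing every constant $\tau$ by ${}^*\tau$, is true; (iv) (saturation) if $I\neq\emptyset$ is a set of cardinality at most that of $\hat S$ and $(U_i)_{i\in I}$ is a family of internal sets (i.e. each $U_i\in{}^*X$ for some set $X\in\hat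 S$) all of whose finite subfamilies have nonempty intersection, then $\bigcap_{i\in I}U_i\ne\emptyset$. An *$\hat S$-small category* is a quadruple $\mathcal C=\langle M,s,t,c\rangle$ of elements of $\hat S$, where $M$ is the set of morphisms, objects are identified with their identity morphisms, $s,t:M\to M$ are source and target, and $c\subseteq M^3$ is the graph $\{\langle f,g,h\rangle: f\circ g=h\}$ of composition. A functor between $\hat S$-small categories is a map on the sets of morphisms (an element of $\hat S$) respecting $s,t,c$. An $\hat S$-small category is abelian if, together with a set $P\subseteq M^3$ that restricts on each $\mathrm{Mor}(X,Y)^3$ to the graph of the addition, it is an abelian category. For an $\hat S$-small category put ${}^*\mathcal C=\langle {}^*M,{}^*s,{}^*t,{}^*c\rangle$ (with ${}^*P$ in the abelian case); this is a $\hat W$-small category, $*$ defines a functor $\mathcal C\to{}^*\mathcal C$, and a functor $F:\mathcal C\to\mathcal D$ gives a functor ${}^*F:{}^*\mathcal C\to{}^*\mathcal D$. **Theorem.** Let $*:\hat S\to\hat W$ be an enlargement and let $F:\mathcal A\to\mathcal B$ be an additive functor between $\hat S$-small abelian categories. Then ${}^*\mathcal A$ and ${}^*\mathcal B$ are abelian,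 and: (i) If $\mathcal A$ has enough injectives and $F$ is left exact, then ${}^*\mathcal A$ has enough injectives, ${}^*F$ is additive and left exact, and for every $i\ge 0$ the right derived functors $R^iF:\mathcal A\to\mathcal B$ and $R^i({}^*F):{}^*\mathcal A\to{}^*\mathcal B$ exist (as an $\hat S$-small and a $\hat W$-small functor), and the diagram $$\begin{array}{ccccc}\mathcal A&\xrightarrow{\;*\;}&{}^*\mathcal A&=&{}^*\mathcal A\\ {\scriptstyle R^iF}\downarrow&&\downarrow{\scriptstyle {}^*(R^iF)}&&\downarrow{\scriptstyle R^i({}^*F)}\\ \mathcal B&\xrightarrow{\;*\;}&{}^*\mathcal B&=&{}^*\mathcal B\end{array}$$ commutes: for all choices of the derived functors (which are defined only up to natural isomorphism), the left square commutes strictly and ${}^*(R^iF)\cong R^i({}^*F)$ naturally. (ii) If $\mathcal A$ has enough projectives and $F$ is right exact, then ${}^*\mathcal A$ has enough projectives, ${}^*F$ is additive and right exact, and for every $i\ge 0$ the left derived functors $L^iF:\mathcal A\to\mathcal B$ and $L^i({}^*F):{}^*\mathcal A\to{}^*\mathcal B$ exist, and the analogous diagram with $L^iF$, ${}^*(L^iF)$,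 $L^i({}^*F)$ commutes in the same sense. -/

import Mathlib

open CategoryTheory CategoryTheory.Limits

universe u v

/-! ## Superstructures -/

/-- The `n`-th stage `S_n` of the superstructure over the set of atoms `S`: `S_0 = S` and
`S_{n+1} = S ∪ 𝒫(S_n)` (which equals `S_n ∪ 𝒫(S_n)`, where `S_n` is regarded as a part of
`S_{n+1}` by `Level.up`). The disjoint sum says that atoms are not sets. -/
def Level (S : Type u) : ℕ → Type u
  | 0 => S
  | n + 1 => S ⊕ Set (Level S n)

/-- A subset of `S_n`, as an element of `S_{n+1}`. -/
def Level.set {S : Type u} {n : ℕ} (A : Set (Level S n)) : Level S (n + 1) := Sum.inr A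

/-- A base element, as an element of `S_n`. -/
def Level.atom {S : Type u} : ∀ n : ℕ, S → Level S n
  | 0, s => s
  | _ + 1, s => Sum.inl s

/-- The inclusion `S_n ⊆ S_{n+1}`: an atom goes to itself, a set to the set with the same
elements. -/
def Level.up {S : Type u} : ∀ {n : ℕ}, Level S n → Level S (n + 1)
  | 0, s => Sum.inl s
  | _ + 1, Sum.inl s => Sum.inl s
  | _ + 1, Sum.inr A => Sum.inr (Level.up '' A)

theorem Level.up_injective {S : Type u} : ∀ n : ℕ,
    Function.Injective (Level.up : Level S n → Level S (n + 1))
  | 0 => fun _ _ h => Sum.inl_injective h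
  | n + 1 => by
    rintro (a | A) (b | B) h
    · exact congrArg Sum.inl (Sum.inl_injective h)
    · cases h
    · cases h
    · exact congrArg Sum.inr
        (Set.image_injective.2 (Level.up_injective n) (Sum.inr_injective h))

/-- The inclusion `S_n ⊆ S_m` for `n ≤ m`. -/
def Level.lift {S : Type u} {n m : ℕ} (h : n ≤ m) (x : Level S n) : Level S m :=
  Nat.leRecOn h (fun {_} => Level.up) x

theorem Level.lift_injective {S : Type u} {n m : ℕ} (h : n ≤ m) :
    Function.Injective (Level.lift h : Level S n → Level S m) :=
  Nat.leRecOn_injective h _ Level.up_injective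

theorem Level.lift_lift {S : Type u} {n m k : ℕ} (h : n ≤ m) (h' : m ≤ k) (x : Level S n) :
    Level.lift h' (Level.lift h x) = Level.lift (h.trans h') x :=
  (Nat.leRecOn_trans h h' x).symm

theorem Level.lift_self {S : Type u} {n : ℕ} (x : Level S n) :
    Level.lift le_rfl x = x := Nat.leRecOn_self x

theorem Level.lift_succ {S : Type u} {n m : ℕ} (h : n ≤ m) (x : Level S n) :
    Level.lift (h.trans (Nat.le_succ m)) x = Level.up (Level.lift h x) := Nat.leRecOn_succ h x

theorem Level.lift_set {S : Type u} {n m : ℕ} (h : n ≤ m) (A : Set (Level S n)) :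
    Level.lift (Nat.succ_le_succ h) (Level.set A) = Level.set (Level.lift h '' A) := by
  induction m, h using Nat.le_induction with
  | base =>
    have : (Level.lift (le_refl n) : Level S n → Level S n) = id := funext Level.lift_self
    rw [Level.lift_self, this, Set.image_id]
  | succ m h ih =>
    rw [Level.lift_succ (Nat.succ_le_succ h), ih]
    have : (Level.lift (h.trans (Nat.le_succ m)) : Level S n → Level S (m + 1)) =
        Level.up ∘ Level.lift h := funext (Level.lift_succ h)
    rw [this, Set.image_comp]
    rfl

theorem Level.lift_atom {S : Type u} {n m : ℕ} (h : n ≤ m) (s : S) :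
    Level.lift h (Level.atom n s) = Level.atom m s := by
  induction m, h using Nat.le_induction with
  | base => exact Level.lift_self _
  | succ m h ih =>
    rw [Level.lift_succ h, ih]
    cases m <;> rfl

theorem Level.set_injective {S : Type u} {n : ℕ} :
    Function.Injective (Level.set : Set (Level S n) → Level S (n + 1)) :=
  Sum.inr_injective

theorem Level.set_ne_atom {S : Type u} {n : ℕ} (A : Set (Level S n)) (s : S) :
    Level.set A ≠ Level.atom (n + 1) s := fun h => nomatch h

/-- Two elements of stages are identified if they become equal in a common later stage. -/
def superstructureSetoid (S : Type u) : Setoid (Σ n, Level S n) where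
  r a b := ∃ (N : ℕ) (h : a.1 ≤ N) (h' : b.1 ≤ N), Level.lift h a.2 = Level.lift h' b.2
  iseqv :=
    { refl := fun a => ⟨a.1, le_rfl, le_rfl, rfl⟩
      symm := fun ⟨N, h, h', e⟩ => ⟨N, h', h, e.symm⟩
      trans := by
        rintro a b c ⟨N, h, h', e⟩ ⟨M, k, k', e'⟩
        refine ⟨max N M, h.trans (le_max_left _ _), k'.trans (le_max_right _ _), ?_⟩
        rw [← Level.lift_lift h (le_max_left N M), e,
          ← Level.lift_lift k' (le_max_right N M), ← e', Level.lift_lift, Level.lift_lift] }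

/-- The superstructure `Ŝ = ⋃ₙ S_n` over the set of atoms `S`. -/
def Superstructure (S : Type u) : Type u := Quotient (superstructureSetoid S)

namespace Superstructure

variable {S : Type u}

/-- The element of the superstructure given by an element of the `n`-th stage. -/
def mk (n : ℕ) (x : Level S n) : Superstructure S :=
  Quotient.mk (superstructureSetoid S) ⟨n, x⟩

/-- The set of elements of the `n`-th stage given by `A`, as an element of the superstructure. -/
def ofSet (n : ℕ) (A : Set (Level S n)) : Superstructure S := mk (n + 1) (Level.set A)

/-- A base element, as an element of the superstructure. -/
def atom (s : S) : Superstructure S := mk 0 (Level.atom 0 s)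

/-- The base set `S`, as an element of its superstructure. -/
def base (S : Type u) : Superstructure S := ofSet 0 Set.univ

/-- The empty set. -/
def empty (S : Type u) : Superstructure S := ofSet 0 ∅

/-- `a` is a set (and not a base element). -/
def IsSet (a : Superstructure S) : Prop := ∃ (n : ℕ) (A : Set (Level S n)), a = ofSet n A

/-- `Mem b a` means `a ∈ b`. -/
def Mem (b a : Superstructure S) : Prop :=
  ∃ (n : ℕ) (A : Set (Level S n)), b = ofSet n A ∧ ∃ x ∈ A, a = mk n x

instance : Membership (Superstructure S) (Superstructure S) := ⟨Mem⟩

theorem mk_lift {n m : ℕ} (h : n ≤ m) (x : Level S n) : mk m (Level.lift h x) = mk n x :=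
  Quotient.sound ⟨m, le_rfl, h, Level.lift_self _⟩

theorem mk_injective (n : ℕ) : Function.Injective (mk n : Level S n → Superstructure S) := by
  intro x y h
  obtain ⟨N, h1, h2, e⟩ := Quotient.exact h
  exact Level.lift_injective h1 e

theorem exists_mk (a : Superstructure S) : ∃ (n : ℕ) (x : Level S n), a = mk n x := by
  induction a using Quotient.inductionOn with
  | h a => exact ⟨a.1, a.2, rfl⟩

theorem ofSet_lift {n m : ℕ} (h : n ≤ m) (A : Set (Level S n)) :
    ofSet m (Level.lift h '' A) = ofSet n A := by
  unfold ofSet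
  rw [← Level.lift_set h, mk_lift]

theorem mk_atom (n : ℕ) (s : S) : mk n (Level.atom n s) = atom s := by
  rw [← Level.lift_atom (Nat.zero_le n), mk_lift]
  rfl

theorem mem_ofSet {n : ℕ} {A : Set (Level S n)} {a : Superstructure S} :
    a ∈ ofSet n A ↔ ∃ x ∈ A, a = mk n x := by
  refine ⟨?_, fun h => ⟨n, A, rfl, h⟩⟩
  rintro ⟨m, B, e, x, hx, rfl⟩
  have h1 := ofSet_lift (le_max_left n m) A
  have h2 := ofSet_lift (le_max_right n m) B
  rw [← h1, ← h2] at e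
  have e' := Level.set_injective (mk_injective _ e)
  have hx' : Level.lift (le_max_right n m) x ∈ Level.lift (le_max_left n m) '' A := by
    rw [e']; exact ⟨x, hx, rfl⟩
  obtain ⟨y, hy, e3⟩ := hx'
  refine ⟨y, hy, ?_⟩
  rw [← mk_lift (le_max_right n m) x, ← e3, mk_lift]

theorem isSet_ofSet (n : ℕ) (A : Set (Level S n)) : IsSet (ofSet n A) := ⟨n, A, rfl⟩

theorem IsSet.of_mem {a b : Superstructure S} (h : a ∈ b) : IsSet b :=
  ⟨h.choose, h.choose_spec.choose, h.choose_spec.choose_spec.1⟩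

theorem ext_of_isSet {a b : Superstructure S} (ha : IsSet a) (hb : IsSet b)
    (h : ∀ x, x ∈ a ↔ x ∈ b) : a = b := by
  obtain ⟨n, A, rfl⟩ := ha
  obtain ⟨m, B, rfl⟩ := hb
  rw [← ofSet_lift (le_max_left n m) A, ← ofSet_lift (le_max_right n m) B] at h ⊢
  congr 1
  ext x
  have := h (mk _ x)
  simp only [mem_ofSet] at this
  constructor
  · intro hx
    obtain ⟨y, hy, e⟩ := this.1 ⟨x, hx, rfl⟩
    rwa [mk_injective _ e]
  · intro hx
    obtain ⟨y, hy, e⟩ := this.2 ⟨x, hx, rfl⟩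
    rwa [mk_injective _ e]

theorem not_isSet_atom (s : S) : ¬ IsSet (atom s) := by
  rintro ⟨n, A, e⟩
  rw [← mk_atom (n + 1)] at e
  exact Level.set_ne_atom A s (mk_injective _ e).symm

theorem isSet_or_eq_atom (a : Superstructure S) : IsSet a ∨ ∃ s, a = atom s := by
  obtain ⟨n, x, rfl⟩ := exists_mk a
  cases n with
  | zero => exact Or.inr ⟨x, rfl⟩
  | succ n =>
    rcases x with s | A
    · exact Or.inr ⟨s, mk_atom (n + 1) s⟩
    · exact Or.inl ⟨n, A, rfl⟩

theorem mem_base {a : Superstructure S} : a ∈ base S ↔ ¬ IsSet a := by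
  unfold base
  rw [mem_ofSet]
  constructor
  · rintro ⟨s, -, rfl⟩
    exact not_isSet_atom s
  · intro h
    obtain ⟨s, rfl⟩ := (isSet_or_eq_atom a).resolve_left h
    exact ⟨s, trivial, rfl⟩

theorem exists_upair (a b : Superstructure S) :
    ∃ c : Superstructure S, IsSet c ∧ ∀ x, x ∈ c ↔ x = a ∨ x = b := by
  obtain ⟨n, x, rfl⟩ := exists_mk a
  obtain ⟨m, y, rfl⟩ := exists_mk b
  refine ⟨ofSet (max n m) {Level.lift (le_max_left n m) x, Level.lift (le_max_right n m) y},
    isSet_ofSet _ _, fun z => ?_⟩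
  rw [mem_ofSet]
  simp [mk_lift]

/-- The set `{a, b}`. -/
noncomputable def upair (a b : Superstructure S) : Superstructure S := (exists_upair a b).choose

theorem isSet_upair (a b : Superstructure S) : IsSet (upair a b) :=
  (exists_upair a b).choose_spec.1

theorem mem_upair {a b x : Superstructure S} : x ∈ upair a b ↔ x = a ∨ x = b :=
  (exists_upair a b).choose_spec.2 x

/-- The ordered pair `⟨a, b⟩ = {a, {a, b}}`. -/
noncomputable def opair (a b : Superstructure S) : Superstructure S := upair a (upair a b)

/-- The triple `⟨a, b, c⟩ = ⟨⟨a, b⟩, c⟩`. -/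
noncomputable def triple (a b c : Superstructure S) : Superstructure S := opair (opair a b) c

theorem mem_descend {a : Superstructure S} {n : ℕ} {x : Level S n} (h : a ∈ mk n x) :
    ∃ k < n, ∃ y : Level S k, a = mk k y := by
  cases n with
  | zero => exact absurd (IsSet.of_mem h) (not_isSet_atom x)
  | succ n =>
    rcases x with s | A
    · exact absurd (IsSet.of_mem (b := mk (n + 1) (Level.atom (n + 1) s)) h)
        (mk_atom (n + 1) s ▸ not_isSet_atom s)
    · obtain ⟨y, -, e⟩ := mem_ofSet.1 (show a ∈ ofSet n A from h)
      exact ⟨n, n.lt_succ_self, y, e⟩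

theorem mem_asymm {a b : Superstructure S} (h : a ∈ b) : ¬ b ∈ a := by
  obtain ⟨n, x, rfl⟩ := exists_mk b
  induction n using Nat.strong_induction_on generalizing a with
  | _ n ih =>
    intro h'
    obtain ⟨k, hk, y, rfl⟩ := mem_descend h
    exact ih k hk y h' h

theorem opair_injective {a b c d : Superstructure S} (h : opair a b = opair c d) :
    a = c ∧ b = d := by
  have h1 : a = c := by
    have ha : a ∈ opair c d := h ▸ mem_upair.2 (Or.inl rfl)
    have hc : c ∈ opair a b := h ▸ mem_upair.2 (Or.inl rfl)
    rcases mem_upair.1 ha with e | e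
    · exact e
    rcases mem_upair.1 hc with e' | e'
    · exact e'.symm
    have m1 : c ∈ a := e ▸ mem_upair.2 (Or.inl rfl)
    have m2 : a ∈ c := e' ▸ mem_upair.2 (Or.inl rfl)
    exact absurd m1 (mem_asymm m2)
  subst h1
  refine ⟨rfl, ?_⟩
  have key : ∀ {x y : Superstructure S}, upair a x ∈ upair a (upair a y) →
      upair a x = upair a y := by
    intro x y hm
    rcases mem_upair.1 hm with e | e
    · have : a ∈ a := by
        have : a ∈ upair a x := mem_upair.2 (Or.inl rfl)
        rwa [e] at this
      exact absurd this (mem_asymm this)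
    · exact e
  have e : upair a b = upair a d := key (by
    have : upair a b ∈ opair a b := mem_upair.2 (Or.inr rfl)
    rwa [h] at this)
  have hb : b ∈ upair a d := e ▸ mem_upair.2 (Or.inr rfl)
  have hd : d ∈ upair a b := e.symm ▸ mem_upair.2 (Or.inr rfl)
  rcases mem_upair.1 hb with e1 | e1
  · rcases mem_upair.1 hd with e2 | e2
    · rw [e1, e2]
    · exact e2.symm
  · exact e1

open Classical in
/-- `app f x` is the unique `y` with `⟨x, y⟩ ∈ f` if there is exactly one such `y`, and `∅`
otherwise. -/
noncomputable def app (f x : Superstructure S) : Superstructure S :=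
  if h : ∃! y, opair x y ∈ f then h.choose else empty S

theorem app_eq {f x y : Superstructure S} (h : opair x y ∈ f)
    (hu : ∀ z, opair x z ∈ f → z = y) : app f x = y := by
  have h' : ∃! y, opair x y ∈ f := ⟨y, h, hu⟩
  rw [app, dif_pos h']
  exact hu _ h'.choose_spec.1

/-- `f` is (the graph of) a map from the set `M` to the set `N`. -/
structure IsMap (f M N : Superstructure S) : Prop where
  isSet : IsSet f
  exists_of_mem : ∀ p ∈ f, ∃ x ∈ M, ∃ y ∈ N, p = opair x y
  existsUnique : ∀ x ∈ M, ∃ y ∈ N, opair x y ∈ f ∧ ∀ z ∈ N, opair x z ∈ f → z = y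

theorem IsMap.app_mem {f M N x : Superstructure S} (h : IsMap f M N) (hx : x ∈ M) :
    app f x ∈ N := by
  obtain ⟨y, hy, hxy, hu⟩ := h.existsUnique x hx
  rw [app_eq hxy]
  · exact hy
  · intro z hz
    obtain ⟨x', -, y', hy', e⟩ := h.exists_of_mem _ hz
    obtain ⟨-, rfl⟩ := opair_injective e
    exact hu _ hy' hz

end Superstructure

open Superstructure

/-! ## Formulas, truth, enlargements -/

/-- Terms in the superstructure over `S` with free variables indexed by `Fin n`. -/
inductive STerm (S : Type u) (n : ℕ) : Type u
  | const (a : Superstructure S) : STerm S n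
  | var (i : Fin n) : STerm S n
  | pair (s t : STerm S n) : STerm S n
  | app (s t : STerm S n) : STerm S n

/-- Formulas in the superstructure over `S` with free variables indexed by `Fin n`.
In `all t ψ` (that is, `(∀ X ∈ t) ψ`) the bound variable is the variable `0` of `ψ`, and the
variable `i` of `t` is the variable `i + 1` of `ψ`. -/
inductive SFormula (S : Type u) : ℕ → Type u
  | eq {n : ℕ} (s t : STerm S n) : SFormula S n
  | mem {n : ℕ} (s t : STerm S n) : SFormula S n
  | neg {n : ℕ} (ψ : SFormula S n) : SFormula S n
  | and {n : ℕ} (ψ χ : SFormula S n) : SFormula S n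
  | all {n : ℕ} (t : STerm S n) (ψ : SFormula S (n + 1)) : SFormula S n

/-- The element denoted by a term. -/
noncomputable def STerm.eval {S : Type u} {n : ℕ} (ρ : Fin n → Superstructure S) :
    STerm S n → Superstructure S
  | .const a => a
  | .var i => ρ i
  | .pair s t => opair (s.eval ρ) (t.eval ρ)
  | .app s t => Superstructure.app (s.eval ρ) (t.eval ρ)

/-- Truth of a formula under an assignment of elements to its free variables. -/
def SFormula.Holds {S : Type u} : ∀ {n : ℕ}, SFormula S n → (Fin n → Superstructure S) → Prop
  | _, .eq s t, ρ => s.eval ρ = t.eval ρ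
  | _, .mem s t, ρ => s.eval ρ ∈ t.eval ρ
  | _, .neg ψ, ρ => ¬ ψ.Holds ρ
  | _, .and ψ χ, ρ => ψ.Holds ρ ∧ χ.Holds ρ
  | _, .all t ψ, ρ => ∀ x ∈ t.eval ρ, ψ.Holds (Fin.cons x ρ)

/-- Replace every constant `a` of a term by `star a`. -/
def STerm.map {S : Type u} {W : Type v} (star : Superstructure S → Superstructure W) {n : ℕ} :
    STerm S n → STerm W n
  | .const a => .const (star a)
  | .var i => .var i
  | .pair s t => .pair (s.map star) (t.map star)
  | .app s t => .app (s.map star) (t.map star)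

/-- The formula `*φ`: every constant `a` of `φ` is replaced by `star a`. -/
def SFormula.map {S : Type u} {W : Type v} (star : Superstructure S → Superstructure W) :
    ∀ {n : ℕ}, SFormula S n → SFormula W n
  | _, .eq s t => .eq (s.map star) (t.map star)
  | _, .mem s t => .mem (s.map star) (t.map star)
  | _, .neg ψ => .neg (ψ.map star)
  | _, .and ψ χ => .and (ψ.map star) (χ.map star)
  | _, .all t ψ => .all (t.map star) (ψ.map star)

/-- `ψ ⇒ χ` -/
def SFormula.imp {S : Type u} {n : ℕ} (ψ χ : SFormula S n) : SFormula S n :=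
  .neg (.and ψ (.neg χ))

/-- `(∃ X ∈ t) ψ` -/
def SFormula.ex {S : Type u} {n : ℕ} (t : STerm S n) (ψ : SFormula S (n + 1)) : SFormula S n :=
  .neg (.all t (.neg ψ))

theorem SFormula.holds_imp {S : Type u} {n : ℕ} (ψ χ : SFormula S n)
    (ρ : Fin n → Superstructure S) : (ψ.imp χ).Holds ρ ↔ (ψ.Holds ρ → χ.Holds ρ) := by
  simp only [SFormula.imp, SFormula.Holds, not_and, not_not]

theorem SFormula.holds_ex {S : Type u} {n : ℕ} (t : STerm S n) (ψ : SFormula S (n + 1))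
    (ρ : Fin n → Superstructure S) :
    (SFormula.ex t ψ).Holds ρ ↔ ∃ x ∈ t.eval ρ, ψ.Holds (Fin.cons x ρ) := by
  simp only [SFormula.ex, SFormula.Holds, not_forall, not_not, exists_prop]

theorem SFormula.map_imp {S : Type u} {W : Type v} (star : Superstructure S → Superstructure W)
    {n : ℕ} (ψ χ : SFormula S n) : (ψ.imp χ).map star = (ψ.map star).imp (χ.map star) := rfl

theorem SFormula.map_ex {S : Type u} {W : Type v} (star : Superstructure S → Superstructure W)
    {n : ℕ} (t : STerm S n) (ψ : SFormula S (n + 1)) :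
    (SFormula.ex t ψ).map star = SFormula.ex (t.map star) (ψ.map star) := rfl

/-- An enlargement `* : Ŝ → Ŵ`. The requirement `*s = s` for `s ∈ S` is expressed through an
inclusion `ι` of `S` into `W`. An element of `Ŵ` is internal if it is an element of `*A` for some
set `A ∈ Ŝ`. -/
structure Enlargement (S : Type u) (W : Type v) where
  /-- the map `*` -/
  star : Superstructure S → Superstructure W
  /-- the inclusion of `S` into `W` -/
  ι : S ↪ W
  star_base : star (base S) = base W
  star_atom : ∀ s : S, star (atom s) = atom (ι s)
  transfer : ∀ φ : SFormula S 0, φ.Holds Fin.elim0 ↔ (φ.map star).Holds Fin.elim0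
  saturation : ∀ (I : Type u) (U : I → Superstructure W), Nonempty I →
    Cardinal.mk I ≤ Cardinal.mk (Superstructure S) →
    (∀ i, ∃ A : Superstructure S, IsSet A ∧ U i ∈ star A) →
    (∀ J : Finset I, ∃ x, ∀ j ∈ J, x ∈ U j) →
    ∃ x, ∀ i, x ∈ U i

/-! ## `Ŝ`-small categories and functors -/

/-- An `Ŝ`-small category `⟨M, s, t, c⟩`, where `M ∈ Ŝ` is the set of morphisms, an object is
identified with its identity morphism, `s` and `t` send a morphism to (the identity of) its source
and target, and `⟨f, g, h⟩ ∈ c` means that `f ∘ g = h`. -/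
structure SmallCat (S : Type u) where
  M : Superstructure S
  s : Superstructure S
  t : Superstructure S
  c : Superstructure S
  isSet_M : IsSet M
  isMap_s : IsMap s M M
  isMap_t : IsMap t M M
  s_s : ∀ f ∈ M, app s (app s f) = app s f
  t_s : ∀ f ∈ M, app t (app s f) = app s f
  s_t : ∀ f ∈ M, app s (app t f) = app t f
  t_t : ∀ f ∈ M, app t (app t f) = app t f
  isSet_c : IsSet c
  exists_of_mem_c : ∀ p ∈ c, ∃ f ∈ M, ∃ g ∈ M, ∃ h ∈ M, p = triple f g h
  of_comp : ∀ f ∈ M, ∀ g ∈ M, ∀ h ∈ M, triple f g h ∈ c →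
    app s f = app t g ∧ app t f = app t h ∧ app s g = app s h
  exists_comp : ∀ f ∈ M, ∀ g ∈ M, app s f = app t g →
    ∃ h ∈ M, triple f g h ∈ c ∧ ∀ h' ∈ M, triple f g h' ∈ c → h' = h
  comp_s : ∀ f ∈ M, triple f (app s f) f ∈ c
  t_comp : ∀ f ∈ M, triple (app t f) f f ∈ c
  assoc : ∀ f₁ ∈ M, ∀ f₂ ∈ M, ∀ f₃ ∈ M, ∀ f₁₂ ∈ M, ∀ f₂₃ ∈ M, ∀ f₁₂₃ ∈ M,
    triple f₁ f₂ f₁₂ ∈ c → triple f₁₂ f₃ f₁₂₃ ∈ c → triple f₂ f₃ f₂₃ ∈ c →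
      triple f₁ f₂₃ f₁₂₃ ∈ c

namespace SmallCat

variable {S : Type u} (C : SmallCat S)

/-- The type of objects: the elements of `s(M)`. -/
def Ob : Type u := {X : Superstructure S // ∃ f ∈ C.M, app C.s f = X}

variable {C}

theorem Ob.mem (X : C.Ob) : X.1 ∈ C.M := by
  obtain ⟨f, hf, e⟩ := X.2
  exact e ▸ C.isMap_s.app_mem hf

theorem Ob.s_eq (X : C.Ob) : app C.s X.1 = X.1 := by
  obtain ⟨f, hf, e⟩ := X.2
  rw [← e, C.s_s f hf]

theorem Ob.t_eq (X : C.Ob) : app C.t X.1 = X.1 := by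
  obtain ⟨f, hf, e⟩ := X.2
  rw [← e, C.t_s f hf]

/-- The type of morphisms from `X` to `Y`. -/
def Hom (X Y : C.Ob) : Type u :=
  {f : Superstructure S // f ∈ C.M ∧ app C.s f = X.1 ∧ app C.t f = Y.1}

theorem exists_hom_comp {X Y Z : C.Ob} (f : Hom Y Z) (g : Hom X Y) :
    ∃ h : Hom X Z, triple f.1 g.1 h.1 ∈ C.c := by
  obtain ⟨h, hh, hc, -⟩ := C.exists_comp f.1 f.2.1 g.1 g.2.1 (f.2.2.1.trans g.2.2.2.symm)
  obtain ⟨-, h2, h3⟩ := C.of_comp _ f.2.1 _ g.2.1 _ hh hc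
  exact ⟨⟨h, hh, h3.symm.trans g.2.2.1, h2.symm.trans f.2.2.2⟩, hc⟩

theorem comp_unique {f g h h' : Superstructure S} (hc : triple f g h ∈ C.c)
    (hc' : triple f g h' ∈ C.c) : h = h' := by
  obtain ⟨f₁, hf, g₁, hg, h₁, hh, e⟩ := C.exists_of_mem_c _ hc
  obtain ⟨e1, rfl⟩ := opair_injective e
  obtain ⟨rfl, rfl⟩ := opair_injective e1
  obtain ⟨f₂, -, g₂, -, h₂, hh', e'⟩ := C.exists_of_mem_c _ hc'
  obtain ⟨-, rfl⟩ := opair_injective e'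
  obtain ⟨k, -, -, hk⟩ := C.exists_comp f hf g hg (C.of_comp _ hf _ hg _ hh hc).1
  rw [hk _ hh hc, hk _ hh' hc']

/-- The composition `f ∘ g`: the unique `h` with `⟨f, g, h⟩ ∈ c`. -/
noncomputable def comp {X Y Z : C.Ob} (f : Hom Y Z) (g : Hom X Y) : Hom X Z :=
  (exists_hom_comp f g).choose

theorem comp_spec {X Y Z : C.Ob} (f : Hom Y Z) (g : Hom X Y) :
    triple f.1 g.1 (comp f g).1 ∈ C.c := (exists_hom_comp f g).choose_spec

theorem comp_eq {X Y Z : C.Ob} {f : Hom Y Z} {g : Hom X Y} {h : Hom X Z}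
    (hc : triple f.1 g.1 h.1 ∈ C.c) : comp f g = h :=
  Subtype.ext (comp_unique (comp_spec f g) hc)

/-- An `Ŝ`-small category as a category, with `id_X = X`. -/
noncomputable instance : Category.{u} C.Ob where
  Hom X Y := Hom X Y
  id X := ⟨X.1, X.mem, X.s_eq, X.t_eq⟩
  comp g f := comp f g
  id_comp {X Y} f := comp_eq (by
    have := C.comp_s f.1 f.2.1
    rwa [f.2.2.1] at this)
  comp_id {X Y} f := comp_eq (by
    have := C.t_comp f.1 f.2.1
    rwa [f.2.2.2] at this)
  assoc {X Y Z T} f₃ f₂ f₁ := comp_eq (C.assoc _ f₁.2.1 _ f₂.2.1 _ f₃.2.1 _ (comp f₁ f₂).2.1 _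
    (comp f₂ f₃).2.1 _ (comp (comp f₁ f₂) f₃).2.1 (comp_spec _ _) (comp_spec _ _)
    (comp_spec _ _))

end SmallCat

/-- A functor of `Ŝ`-small categories: a map on the sets of morphisms (an element of `Ŝ`) that is
compatible with source, target and composition. -/
structure SmallFunctor {S : Type u} (C D : SmallCat S) where
  graph : Superstructure S
  isMap : IsMap graph C.M D.M
  map_s : ∀ f ∈ C.M, app graph (app C.s f) = app D.s (app graph f)
  map_t : ∀ f ∈ C.M, app graph (app C.t f) = app D.t (app graph f)
  map_c : ∀ f ∈ C.M, ∀ g ∈ C.M, ∀ h ∈ C.M, triple f g h ∈ C.c →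
    triple (app graph f) (app graph g) (app graph h) ∈ D.c

/-- A functor of `Ŝ`-small categories as a functor. -/
noncomputable def SmallFunctor.toFunctor {S : Type u} {C D : SmallCat S} (F : SmallFunctor C D) :
    C.Ob ⥤ D.Ob where
  obj X := ⟨app F.graph X.1, app F.graph X.1, F.isMap.app_mem X.mem, by
    rw [← F.map_s _ X.mem, X.s_eq]⟩
  map {X Y} f := ⟨app F.graph f.1, F.isMap.app_mem f.2.1, by
    rw [← F.map_s _ f.2.1, f.2.2.1], by rw [← F.map_t _ f.2.1, f.2.2.2]⟩
  map_id X := rfl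
  map_comp {X Y Z} g f := (SmallCat.comp_eq
    (F.map_c _ f.2.1 _ g.2.1 _ (SmallCat.comp f g).2.1 (SmallCat.comp_spec f g))).symm

/-! ## Enlargements of categories and functors -/

namespace Enlargement

variable {S : Type u} {W : Type v} (E : Enlargement S W)

open SFormula STerm

theorem star_mem {a b : Superstructure S} (h : a ∈ b) : E.star a ∈ E.star b :=
  (E.transfer (.mem (.const a) (.const b))).1 h

theorem star_app (f x : Superstructure S) : E.star (app f x) = app (E.star f) (E.star x) :=
  ((E.transfer (.eq (.app (.const f) (.const x)) (.const (app f x)))).1 rfl).symm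

theorem star_opair (a b : Superstructure S) :
    E.star (opair a b) = opair (E.star a) (E.star b) :=
  ((E.transfer (.eq (.pair (.const a) (.const b)) (.const (opair a b)))).1 rfl).symm

theorem star_triple (a b c : Superstructure S) :
    E.star (triple a b c) = triple (E.star a) (E.star b) (E.star c) := by
  unfold triple
  rw [star_opair, star_opair]

theorem star_isSet {a : Superstructure S} (h : IsSet a) : IsSet (E.star a) := by
  have h1 : ¬ a ∈ base S := fun h' => mem_base.1 h' h
  have h2 : ¬ E.star a ∈ E.star (base S) :=
    (E.transfer (.neg (.mem (.const a) (.const (base S))))).1 h1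
  rw [E.star_base, mem_base, not_not] at h2
  exact h2

theorem star_isMap {f M N : Superstructure S} (h : IsMap f M N) :
    IsMap (E.star f) (E.star M) (E.star N) where
  isSet := E.star_isSet h.isSet
  exists_of_mem := by
    have := (E.transfer (.all (.const f) (.ex (.const M) (.ex (.const N)
      (.eq (.var 2) (.pair (.var 1) (.var 0))))))).1 (by
        simp only [Holds, holds_ex]; exact h.exists_of_mem)
    simp only [SFormula.map, map_ex, Holds, holds_ex] at this
    exact this
  existsUnique := by
    have := (E.transfer (.all (.const M) (.ex (.const N)
      (.and (.mem (.pair (.var 1) (.var 0)) (.const f))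
        (.all (.const N) (.imp (.mem (.pair (.var 2) (.var 0)) (.const f))
          (.eq (.var 0) (.var 1)))))))).1 (by
        simp only [Holds, holds_ex, holds_imp]; exact h.existsUnique)
    simp only [SFormula.map, map_ex, map_imp, Holds, holds_ex, holds_imp] at this
    exact this

/-- The enlargement `*C = ⟨*M, *s, *t, *c⟩` of an `Ŝ`-small category `C = ⟨M, s, t, c⟩`. -/
def starCat (C : SmallCat S) : SmallCat W where
  M := E.star C.M
  s := E.star C.s
  t := E.star C.t
  c := E.star C.c
  isSet_M := E.star_isSet C.isSet_M
  isMap_s := E.star_isMap C.isMap_s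
  isMap_t := E.star_isMap C.isMap_t
  s_s := (E.transfer (.all (.const C.M) (.eq (.app (.const C.s) (.app (.const C.s) (.var 0)))
    (.app (.const C.s) (.var 0))))).1 C.s_s
  t_s := (E.transfer (.all (.const C.M) (.eq (.app (.const C.t) (.app (.const C.s) (.var 0)))
    (.app (.const C.s) (.var 0))))).1 C.t_s
  s_t := (E.transfer (.all (.const C.M) (.eq (.app (.const C.s) (.app (.const C.t) (.var 0)))
    (.app (.const C.t) (.var 0))))).1 C.s_t
  t_t := (E.transfer (.all (.const C.M) (.eq (.app (.const C.t) (.app (.const C.t) (.var 0)))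
    (.app (.const C.t) (.var 0))))).1 C.t_t
  isSet_c := E.star_isSet C.isSet_c
  exists_of_mem_c := by
    have := (E.transfer (.all (.const C.c) (.ex (.const C.M) (.ex (.const C.M) (.ex (.const C.M)
      (.eq (.var 3) (.pair (.pair (.var 2) (.var 1)) (.var 0)))))))).1 (by
        simp only [Holds, holds_ex]; exact C.exists_of_mem_c)
    simp only [SFormula.map, map_ex, Holds, holds_ex] at this
    exact this
  of_comp := by
    have := (E.transfer (.all (.const C.M) (.all (.const C.M) (.all (.const C.M)
      (.imp (.mem (.pair (.pair (.var 2) (.var 1)) (.var 0)) (.const C.c))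
        (.and (.eq (.app (.const C.s) (.var 2)) (.app (.const C.t) (.var 1)))
        (.and (.eq (.app (.const C.t) (.var 2)) (.app (.const C.t) (.var 0)))
        (.eq (.app (.const C.s) (.var 1)) (.app (.const C.s) (.var 0)))))))))).1 (by
        simp only [Holds, holds_imp]; exact C.of_comp)
    simp only [SFormula.map, map_imp, Holds, holds_imp] at this
    exact this
  exists_comp := by
    have := (E.transfer (.all (.const C.M) (.all (.const C.M)
      (.imp (.eq (.app (.const C.s) (.var 1)) (.app (.const C.t) (.var 0)))
        (.ex (.const C.M)
          (.and (.mem (.pair (.pair (.var 2) (.var 1)) (.var 0)) (.const C.c))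
            (.all (.const C.M)
              (.imp (.mem (.pair (.pair (.var 3) (.var 2)) (.var 0)) (.const C.c))
                (.eq (.var 0) (.var 1)))))))))).1 (by
        simp only [Holds, holds_imp, holds_ex]; exact C.exists_comp)
    simp only [SFormula.map, map_imp, map_ex, Holds, holds_imp, holds_ex] at this
    exact this
  comp_s := (E.transfer (.all (.const C.M) (.mem (.pair (.pair (.var 0)
    (.app (.const C.s) (.var 0))) (.var 0)) (.const C.c)))).1 C.comp_s
  t_comp := (E.transfer (.all (.const C.M) (.mem (.pair (.pair (.app (.const C.t) (.var 0))
    (.var 0)) (.var 0)) (.const C.c)))).1 C.t_comp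
  assoc := by
    have := (E.transfer (.all (.const C.M) (.all (.const C.M) (.all (.const C.M)
      (.all (.const C.M) (.all (.const C.M) (.all (.const C.M)
        (.imp (.mem (.pair (.pair (.var 5) (.var 4)) (.var 2)) (.const C.c))
        (.imp (.mem (.pair (.pair (.var 2) (.var 3)) (.var 0)) (.const C.c))
        (.imp (.mem (.pair (.pair (.var 4) (.var 3)) (.var 1)) (.const C.c))
          (.mem (.pair (.pair (.var 5) (.var 1)) (.var 0)) (.const C.c))))))))))) ).1 (by
        simp only [Holds, holds_imp]; exact C.assoc)
    simp only [SFormula.map, map_imp, Holds, holds_imp] at this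
    exact this

/-- The enlargement `*F : *C ⥤ *D` of a functor `F` of `Ŝ`-small categories. -/
def starFunctor {C D : SmallCat S} (F : SmallFunctor C D) :
    SmallFunctor (E.starCat C) (E.starCat D) where
  graph := E.star F.graph
  isMap := E.star_isMap F.isMap
  map_s := (E.transfer (.all (.const C.M)
    (.eq (.app (.const F.graph) (.app (.const C.s) (.var 0)))
      (.app (.const D.s) (.app (.const F.graph) (.var 0)))))).1 F.map_s
  map_t := (E.transfer (.all (.const C.M)
    (.eq (.app (.const F.graph) (.app (.const C.t) (.var 0)))
      (.app (.const D.t) (.app (.const F.graph) (.var 0)))))).1 F.map_t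
  map_c := by
    have := (E.transfer (.all (.const C.M) (.all (.const C.M) (.all (.const C.M)
      (.imp (.mem (.pair (.pair (.var 2) (.var 1)) (.var 0)) (.const C.c))
        (.mem (.pair (.pair (.app (.const F.graph) (.var 2)) (.app (.const F.graph) (.var 1)))
          (.app (.const F.graph) (.var 0))) (.const D.c))))))).1 (by
        simp only [Holds, holds_imp]; exact F.map_c)
    simp only [SFormula.map, map_imp, Holds, holds_imp] at this
    exact this

/-- The functor `* : C ⥤ *C`. -/
noncomputable def toStar (C : SmallCat S) : C.Ob ⥤ (E.starCat C).Ob where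
  obj X := ⟨E.star X.1, E.star X.1, E.star_mem X.mem, by
    change app (E.star C.s) (E.star X.1) = E.star X.1
    rw [← star_app, X.s_eq]⟩
  map {X Y} f := ⟨E.star f.1, E.star_mem f.2.1, by
    change app (E.star C.s) (E.star f.1) = E.star X.1
    rw [← star_app, f.2.2.1], by
    change app (E.star C.t) (E.star f.1) = E.star Y.1
    rw [← star_app, f.2.2.2]⟩
  map_id X := rfl
  map_comp {X Y Z} g f := (SmallCat.comp_eq (C := E.starCat C) (by
    have := E.star_mem (SmallCat.comp_spec f g)
    rwa [star_triple] at this)).symm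

end Enlargement

/-! ## `Ŝ`-small abelian categories and derived functors -/

/-- `⟨C, P⟩` is an abelian `Ŝ`-small category: `P ⊆ M × M × M` is, on all sets of morphisms, the
graph of the addition of a preadditive structure for which `C` is abelian. -/
structure SmallCat.IsAbelian {S : Type u} (C : SmallCat S) (P : Superstructure S) : Prop where
  isSet : IsSet P
  exists_of_mem : ∀ p ∈ P, ∃ f ∈ C.M, ∃ g ∈ C.M, ∃ h ∈ C.M, p = triple f g h
  abelian : ∃ _ : Abelian C.Ob,
    ∀ (X Y : C.Ob) (f g h : X ⟶ Y), triple f.1 g.1 h.1 ∈ P ↔ f + g = h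

/-- An abelian `Ŝ`-small category `⟨A, P⟩`. -/
structure SmallAbelianCat (S : Type u) extends SmallCat S where
  P : Superstructure S
  isAbelian : toSmallCat.IsAbelian P

noncomputable instance {S : Type u} (A : SmallAbelianCat S) : Abelian A.toSmallCat.Ob :=
  A.isAbelian.abelian.choose

/-- `R` is an `i`-th right derived functor of the left exact additive functor `F : A ⥤ B`: every
object of `A` has an injective resolution, and `R` is naturally isomorphic to the functor that
sends `X` to the `i`-th cohomology of `F` applied to an injective resolution of `X`. -/
def IsRightDerived {S : Type u} (A B : SmallAbelianCat S)
    (F : SmallFunctor A.toSmallCat B.toSmallCat) (i : ℕ)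
    (R : SmallFunctor A.toSmallCat B.toSmallCat) : Prop :=
  ∃ (_ : F.toFunctor.Additive) (_ : PreservesFiniteLimits F.toFunctor)
    (_ : HasInjectiveResolutions A.toSmallCat.Ob),
    Nonempty (R.toFunctor ≅ F.toFunctor.rightDerived i)

/-- `L` is an `i`-th left derived functor of the right exact additive functor `F : A ⥤ B`: every
object of `A` has a projective resolution, and `L` is naturally isomorphic to the functor that
sends `X` to the `i`-th homology of `F` applied to a projective resolution of `X`. -/
def IsLeftDerived {S : Type u} (A B : SmallAbelianCat S)
    (F : SmallFunctor A.toSmallCat B.toSmallCat) (i : ℕ)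
    (L : SmallFunctor A.toSmallCat B.toSmallCat) : Prop :=
  ∃ (_ : F.toFunctor.Additive) (_ : PreservesFiniteColimits F.toFunctor)
    (_ : HasProjectiveResolutions A.toSmallCat.Ob),
    Nonempty (L.toFunctor ≅ F.toFunctor.leftDerived i)

/-- The enlargement `⟨*A, *P⟩` of an abelian `Ŝ`-small category `⟨A, P⟩`. -/
def Enlargement.starAbelian {S : Type u} {W : Type v} (E : Enlargement S W)
    (A : SmallAbelianCat S) (hA : (E.starCat A.toSmallCat).IsAbelian (E.star A.P)) :
    SmallAbelianCat W where
  toSmallCat := E.starCat A.toSmallCat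
  P := E.star A.P
  isAbelian := hA

/-!
The proof rests on a characterisation of derived functors that can be expressed in the language of
the superstructure. Injective resolutions are infinite objects, and an injective resolution in `*A`
need not be internal, so resolutions themselves are of no use for transfer. Instead, `Rⁱ⁺¹F` is
determined by `RⁱF` alone, as its *right satellite* (`IsRightSatellite`): for a short exact sequence
`0 ⟶ X ⟶ I ⟶ Z ⟶ 0` with `I` injective there is a connecting morphism `RⁱF Z ⟶ Rⁱ⁺¹F X`, natural in
the sequence, which is a cokernel of `RⁱF I ⟶ RⁱF Z`. This follows by splicing the sequence with an
injective resolution of `Z` (`exists_isRightSatellite_zero`, `exists_isRightSatellite_succ`). If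
there are enough injectives, the satellite of a functor is unique up to natural isomorphism
(`IsRightSatellite.nonempty_iso`).

All the notions involved (abelian categories, enough injectives, exactness of a functor, natural
isomorphisms, satellites) are bounded first-order statements about elements of the superstructure:
functors, natural transformations and families of connecting morphisms are graphs, and every
relation between the elements of one member of `Ŝ` and those of another is itself a member of `Ŝ`
(`Superstructure.exists_relation`). They transfer to the enlargement by means of a calculus that builds a formula along with the categorical
statement it expresses (`Enlargement.Transfers`); composition is available in terms because
`f ∘ g = c(⟨f, g⟩)`. Hence `*A` is abelian, `*F` is left exact, and `*(Rⁱ⁺¹F)` is the right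
satellite of `*(RⁱF)`. As `*(R⁰F) ≅ *F ≅ R⁰(*F)`, uniqueness of satellites gives
`*(RⁱF) ≅ Rⁱ(*F)` by induction on `i` (`Enlargement.nonempty_iso_rightDerived`). The strict
commutativity of the left square is the identity `*(f(x)) = (*f)(*x)`. Left derived functors are
treated dually.
-/

/-! ### Satellites -/

section Satellite

universe v₁ u₁ v₂ u₂

variable {A : Type u₁} [Category.{v₁} A] {B : Type u₂} [Category.{v₂} B]

/-- `k` is a kernel of `f`. No choice of limit data is part of the notion. -/
def IsKer [HasZeroMorphisms A] {K X Y : A} (k : K ⟶ X) (f : X ⟶ Y) : Prop :=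
  ∃ w : k ≫ f = 0, Nonempty (IsLimit (KernelFork.ofι k w))

/-- `c` is a cokernel of `f`. No choice of colimit data is part of the notion. -/
def IsCoker [HasZeroMorphisms A] {X Y K : A} (f : X ⟶ Y) (c : Y ⟶ K) : Prop :=
  ∃ w : f ≫ c = 0, Nonempty (IsColimit (CokernelCofork.ofπ c w))

section

variable [HasZeroMorphisms A]

theorem IsKer.mono {K X Y : A} {k : K ⟶ X} {f : X ⟶ Y} (h : IsKer k f) : Mono k := by
  obtain ⟨_, ⟨h⟩⟩ := h
  exact mono_of_isLimit_fork h

theorem IsKer.exists_lift {K X Y : A} {k : K ⟶ X} {f : X ⟶ Y} (h : IsKer k f) {T : A} (g : T ⟶ X)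
    (hg : g ≫ f = 0) : ∃ l, l ≫ k = g := by
  obtain ⟨_, ⟨h⟩⟩ := h
  exact ⟨_, (KernelFork.IsLimit.lift' h g hg).2⟩

theorem IsKer.of_exists_lift {K X Y : A} {k : K ⟶ X} {f : X ⟶ Y} [Mono k] (w : k ≫ f = 0)
    (h : ∀ (T : A) (g : T ⟶ X), g ≫ f = 0 → ∃ l, l ≫ k = g) : IsKer k f := by
  choose l hl using h
  exact ⟨w, ⟨KernelFork.IsLimit.ofι k w (fun g hg => l _ g hg) (fun g hg => hl _ g hg)
    fun g hg m hm => (cancel_mono k).1 (hm.trans (hl _ g hg).symm)⟩⟩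

theorem IsCoker.epi {X Y K : A} {f : X ⟶ Y} {c : Y ⟶ K} (h : IsCoker f c) : Epi c := by
  obtain ⟨_, ⟨h⟩⟩ := h
  exact epi_of_isColimit_cofork h

theorem IsCoker.exists_desc {X Y K : A} {f : X ⟶ Y} {c : Y ⟶ K} (h : IsCoker f c) {T : A}
    (g : Y ⟶ T) (hg : f ≫ g = 0) : ∃ l, c ≫ l = g := by
  obtain ⟨_, ⟨h⟩⟩ := h
  exact ⟨_, (CokernelCofork.IsColimit.desc' h g hg).2⟩

theorem IsCoker.of_exists_desc {X Y K : A} {f : X ⟶ Y} {c : Y ⟶ K} [Epi c] (w : f ≫ c = 0)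
    (h : ∀ (T : A) (g : Y ⟶ T), f ≫ g = 0 → ∃ l, c ≫ l = g) : IsCoker f c := by
  choose l hl using h
  exact ⟨w, ⟨CokernelCofork.IsColimit.ofπ c w (fun g hg => l _ g hg) (fun g hg => hl _ g hg)
    fun g hg m hm => (cancel_epi c).1 (hm.trans (hl _ g hg).symm)⟩⟩

theorem IsKer.isIso_comp {K K' X Y : A} {k : K ⟶ X} {f : X ⟶ Y} (h : IsKer k f)
    (i : K' ⟶ K) [IsIso i] : IsKer (i ≫ k) f := by
  have := h.mono
  refine IsKer.of_exists_lift (by rw [Category.assoc, h.1, comp_zero]) fun T g hg => ?_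
  obtain ⟨l, hl⟩ := h.exists_lift g hg
  exact ⟨l ≫ inv i, by simp [hl]⟩

theorem IsKer.comp_isIso {K X X' Y : A} {k : K ⟶ X} {f : X ⟶ Y} (h : IsKer k f)
    (i : X ⟶ X') [IsIso i] {f' : X' ⟶ Y} (hf : i ≫ f' = f) : IsKer (k ≫ i) f' := by
  have := h.mono
  refine IsKer.of_exists_lift (by rw [Category.assoc, hf, h.1]) fun T g hg => ?_
  obtain ⟨l, hl⟩ := h.exists_lift (g ≫ inv i) (by
    rw [← hf, Category.assoc, IsIso.inv_hom_id_assoc, hg])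
  exact ⟨l, by rw [reassoc_of% hl, IsIso.inv_hom_id, Category.comp_id]⟩

theorem IsKer.of_isZero {X X' Y : A} (i : X ⟶ X') [IsIso i] (f : X' ⟶ Y) (hY : IsZero Y) :
    IsKer i f :=
  IsKer.of_exists_lift (hY.eq_of_tgt _ _) fun _ g _ => ⟨g ≫ inv i, by simp⟩

theorem IsCoker.comp_isIso {X Y K K' : A} {f : X ⟶ Y} {c : Y ⟶ K} (h : IsCoker f c)
    (i : K ⟶ K') [IsIso i] : IsCoker f (c ≫ i) := by
  have := h.epi
  refine IsCoker.of_exists_desc (by rw [reassoc_of% h.1, zero_comp]) fun T g hg => ?_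
  obtain ⟨l, hl⟩ := h.exists_desc g hg
  exact ⟨inv i ≫ l, by simp [hl]⟩

theorem IsCoker.isIso_comp {X Y Y' K : A} {f : X ⟶ Y} {c : Y ⟶ K} (h : IsCoker f c)
    (i : Y' ⟶ Y) [IsIso i] {f' : X ⟶ Y'} (hf : f' ≫ i = f) : IsCoker f' (i ≫ c) := by
  have := h.epi
  refine IsCoker.of_exists_desc (by rw [reassoc_of% hf, h.1]) fun T g hg => ?_
  obtain ⟨l, hl⟩ := h.exists_desc (inv i ≫ g) (by rw [← hf, Category.assoc,
    IsIso.hom_inv_id_assoc, hg])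
  exact ⟨l, by rw [Category.assoc, hl, IsIso.hom_inv_id_assoc]⟩

theorem IsCoker.of_isZero {X Y Y' : A} (f : X ⟶ Y) (hX : IsZero X) (i : Y ⟶ Y') [IsIso i] :
    IsCoker f i :=
  IsCoker.of_exists_desc (hX.eq_of_src _ _) fun _ g _ => ⟨inv i ≫ g, by simp⟩

end

variable [HasZeroMorphisms A] [HasZeroMorphisms B]

/-- `H` is the right satellite of `G`, with connecting morphisms `G Z ⟶ H X` given by the
relation `Δ`: for each short exact sequence `0 ⟶ X ⟶ I ⟶ Z ⟶ 0` with `I` injective there is a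
connecting morphism, it is a cokernel of `G I ⟶ G Z`, and it is natural in the sequence. -/
structure IsRightSatellite (G H : A ⥤ B)
    (Δ : ∀ ⦃X I Z : A⦄, (X ⟶ I) → (I ⟶ Z) → (G.obj Z ⟶ H.obj X) → Prop) : Prop where
  exists_connecting : ∀ (X I Z : A) (m : X ⟶ I) (p : I ⟶ Z), IsKer m p → IsCoker m p →
    Injective I → ∃ d, Δ m p d
  isCoker : ∀ (X I Z : A) (m : X ⟶ I) (p : I ⟶ Z) (d : G.obj Z ⟶ H.obj X), Δ m p d →
    IsCoker (G.map p) d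
  natural : ∀ (X I Z X' I' Z' : A) (m : X ⟶ I) (p : I ⟶ Z) (m' : X' ⟶ I') (p' : I' ⟶ Z')
    (a : X ⟶ X') (b : I ⟶ I') (c : Z ⟶ Z') (d : G.obj Z ⟶ H.obj X) (d' : G.obj Z' ⟶ H.obj X'),
    Δ m p d → Δ m' p' d' → m ≫ b = a ≫ m' → p ≫ c = b ≫ p' → G.map c ≫ d' = d ≫ H.map a

/-- `H` is the left satellite of `G`, with connecting morphisms `H X ⟶ G Z` given by the
relation `Δ`: for each short exact sequence `0 ⟶ Z ⟶ P ⟶ X ⟶ 0` with `P` projective there is a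
connecting morphism, it is a kernel of `G Z ⟶ G P`, and it is natural in the sequence. -/
structure IsLeftSatellite (G H : A ⥤ B)
    (Δ : ∀ ⦃Z P X : A⦄, (Z ⟶ P) → (P ⟶ X) → (H.obj X ⟶ G.obj Z) → Prop) : Prop where
  exists_connecting : ∀ (Z P X : A) (m : Z ⟶ P) (p : P ⟶ X), IsKer m p → IsCoker m p →
    Projective P → ∃ d, Δ m p d
  isKer : ∀ (Z P X : A) (m : Z ⟶ P) (p : P ⟶ X) (d : H.obj X ⟶ G.obj Z), Δ m p d →
    IsKer d (G.map m)
  natural : ∀ (Z P X Z' P' X' : A) (m : Z ⟶ P) (p : P ⟶ X) (m' : Z' ⟶ P') (p' : P' ⟶ X')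
    (a : Z ⟶ Z') (b : P ⟶ P') (c : X ⟶ X') (d : H.obj X ⟶ G.obj Z) (d' : H.obj X' ⟶ G.obj Z'),
    Δ m p d → Δ m' p' d' → m ≫ b = a ≫ m' → p ≫ c = b ≫ p' → d ≫ G.map a = H.map c ≫ d'

/-- Being a satellite is invariant under isomorphisms of both functors. -/
theorem IsRightSatellite.of_iso {G G' H H' : A ⥤ B} {Δ} (h : IsRightSatellite G H Δ)
    (e : G' ≅ G) (e' : H' ≅ H) : IsRightSatellite G' H' fun _ _ _ m p d =>
      ∃ d', Δ m p d' ∧ d = e.hom.app _ ≫ d' ≫ e'.inv.app _ where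
  exists_connecting X I Z m p hm hp hI := by
    obtain ⟨d, hd⟩ := h.exists_connecting X I Z m p hm hp hI
    exact ⟨_, d, hd, rfl⟩
  isCoker := by
    rintro X I Z m p _ ⟨d, hd, rfl⟩
    have h0 := (h.isCoker X I Z m p d hd).comp_isIso (e'.inv.app X)
    have := h0.epi
    refine IsCoker.of_exists_desc (by rw [e.hom.naturality_assoc, h0.1, comp_zero]) fun T g hg => ?_
    obtain ⟨l, hl⟩ := h0.exists_desc (e.inv.app Z ≫ g) (by
      rw [e.inv.naturality_assoc, hg, comp_zero])
    exact ⟨l, by rw [Category.assoc, hl, e.hom_inv_id_app_assoc]⟩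
  natural := by
    rintro X I Z X' I' Z' m p m' p' a b c _ _ ⟨d, hd, rfl⟩ ⟨d', hd', rfl⟩ h1 h2
    have n := h.natural X I Z X' I' Z' m p m' p' a b c d d' hd hd' h1 h2
    rw [e.hom.naturality_assoc, reassoc_of% n, Category.assoc, Category.assoc, e'.inv.naturality]

/-- Being a satellite is invariant under isomorphisms of both functors. -/
theorem IsLeftSatellite.of_iso {G G' H H' : A ⥤ B} {Δ} (h : IsLeftSatellite G H Δ)
    (e : G' ≅ G) (e' : H' ≅ H) : IsLeftSatellite G' H' fun _ _ _ m p d =>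
      ∃ d', Δ m p d' ∧ d = e'.hom.app _ ≫ d' ≫ e.inv.app _ where
  exists_connecting Z I X m p hm hp hI := by
    obtain ⟨d, hd⟩ := h.exists_connecting Z I X m p hm hp hI
    exact ⟨_, d, hd, rfl⟩
  isKer := by
    rintro Z I X m p _ ⟨d, hd, rfl⟩
    have h0 := (h.isKer Z I X m p d hd).isIso_comp (e'.hom.app X)
    have := h0.mono
    rw [← Category.assoc]
    refine IsKer.of_exists_lift (by
      rw [Category.assoc, ← e.inv.naturality, ← Category.assoc, h0.1, zero_comp]) fun T g hg => ?_
    obtain ⟨l, hl⟩ := h0.exists_lift (g ≫ e.hom.app Z) (by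
      rw [Category.assoc, ← e.hom.naturality, reassoc_of% hg, zero_comp])
    exact ⟨l, by
      rw [← Category.assoc, hl, Category.assoc, e.hom_inv_id_app, Category.comp_id]⟩
  natural := by
    rintro Z I X Z' I' X' m p m' p' a b c _ _ ⟨d, hd, rfl⟩ ⟨d', hd', rfl⟩ h1 h2
    have n := h.natural Z I X Z' I' X' m p m' p' a b c d d' hd hd' h1 h2
    rw [e'.hom.naturality_assoc, ← reassoc_of% n, Category.assoc, Category.assoc,
      e.inv.naturality]

end Satellite

section

universe v₁ u₁ v₂ u₂

variable {A : Type u₁} [Category.{v₁} A] [Abelian A] {B : Type u₂} [Category.{v₂} B]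
  [HasZeroMorphisms B]

theorem isKer_cokernel_π {X Y : A} (f : X ⟶ Y) [Mono f] : IsKer f (cokernel.π f) :=
  ⟨cokernel.condition f, ⟨Abelian.monoIsKernelOfCokernel
    (CokernelCofork.ofπ _ (cokernel.condition f)) (cokernelIsCokernel f)⟩⟩

theorem isCoker_cokernel_π {X Y : A} (f : X ⟶ Y) : IsCoker f (cokernel.π f) :=
  ⟨cokernel.condition f, ⟨cokernelIsCokernel f⟩⟩

theorem isKer_kernel_ι {X Y : A} (f : X ⟶ Y) : IsKer (kernel.ι f) f :=
  ⟨kernel.condition f, ⟨kernelIsKernel f⟩⟩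

theorem isCoker_kernel_ι {X Y : A} (f : X ⟶ Y) [Epi f] : IsCoker (kernel.ι f) f :=
  ⟨kernel.condition f, ⟨Abelian.epiIsCokernelOfKernel
    (KernelFork.ofι _ (kernel.condition f)) (kernelIsKernel f)⟩⟩

/-- A natural isomorphism between functors induces one between their right satellites. -/
theorem IsRightSatellite.nonempty_iso [EnoughInjectives A] {G G' H H' : A ⥤ B} {Δ Δ'}
    (h : IsRightSatellite G H Δ) (h' : IsRightSatellite G' H' Δ') (e : G ≅ G') :
    Nonempty (H ≅ H') := by
  have hex := fun X => h.exists_connecting X _ _ (Injective.ι X) (cokernel.π _)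
    (isKer_cokernel_π _) (isCoker_cokernel_π _) inferInstance
  have hex' := fun X => h'.exists_connecting X _ _ (Injective.ι X) (cokernel.π _)
    (isKer_cokernel_π _) (isCoker_cokernel_π _) inferInstance
  choose d hd using hex
  choose d' hd' using hex'
  have hdc := fun X => h.isCoker _ _ _ _ _ _ (hd X)
  have hdc' := fun X => h'.isCoker _ _ _ _ _ _ (hd' X)
  have : ∀ X, Epi (d X) := fun X => (hdc X).epi
  have : ∀ X, Epi (d' X) := fun X => (hdc' X).epi
  have h1 : ∀ X, ∃ t : H.obj X ⟶ H'.obj X, d X ≫ t = e.hom.app _ ≫ d' X := fun X =>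
    (hdc X).exists_desc _ (by rw [e.hom.naturality_assoc, (hdc' X).1, comp_zero])
  have h2 : ∀ X, ∃ t : H'.obj X ⟶ H.obj X, d' X ≫ t = e.inv.app _ ≫ d X := fun X =>
    (hdc' X).exists_desc _ (by rw [e.inv.naturality_assoc, (hdc X).1, comp_zero])
  choose t ht using h1
  choose t' ht' using h2
  refine ⟨NatIso.ofComponents (fun X => ⟨t X, t' X, ?_, ?_⟩) fun {X Y} f => ?_⟩
  · rw [← cancel_epi (d X), reassoc_of% ht, ht', e.hom_inv_id_app_assoc, Category.comp_id]
  · rw [← cancel_epi (d' X), reassoc_of% ht', ht, e.inv_hom_id_app_assoc, Category.comp_id]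
  · -- extend `f` to a morphism of the chosen short exact sequences
    let b := Injective.factorThru (f ≫ Injective.ι Y) (Injective.ι X)
    have hb : Injective.ι X ≫ b = f ≫ Injective.ι Y := Injective.comp_factorThru _ _
    obtain ⟨c, hc⟩ := (isCoker_cokernel_π (Injective.ι X)).exists_desc
      (b ≫ cokernel.π (Injective.ι Y)) (by
        rw [reassoc_of% hb, cokernel.condition, comp_zero])
    have n := h.natural _ _ _ _ _ _ _ _ _ _ f b c _ _ (hd X) (hd Y) hb hc
    have n' := h'.natural _ _ _ _ _ _ _ _ _ _ f b c _ _ (hd' X) (hd' Y) hb hc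
    dsimp only
    rw [← cancel_epi (d X), reassoc_of% ht, ← n', ← reassoc_of% n, ht, e.hom.naturality_assoc]

/-- A natural isomorphism between functors induces one between their left satellites. -/
theorem IsLeftSatellite.nonempty_iso [EnoughProjectives A] {G G' H H' : A ⥤ B} {Δ Δ'}
    (h : IsLeftSatellite G H Δ) (h' : IsLeftSatellite G' H' Δ') (e : G ≅ G') :
    Nonempty (H ≅ H') := by
  have hex := fun X => h.exists_connecting _ _ X (kernel.ι _) (Projective.π X)
    (isKer_kernel_ι _) (isCoker_kernel_ι _) inferInstance
  have hex' := fun X => h'.exists_connecting _ _ X (kernel.ι _) (Projective.π X)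
    (isKer_kernel_ι _) (isCoker_kernel_ι _) inferInstance
  choose d hd using hex
  choose d' hd' using hex'
  have hdc := fun X => h.isKer _ _ _ _ _ _ (hd X)
  have hdc' := fun X => h'.isKer _ _ _ _ _ _ (hd' X)
  have : ∀ X, Mono (d X) := fun X => (hdc X).mono
  have : ∀ X, Mono (d' X) := fun X => (hdc' X).mono
  have h1 : ∀ X, ∃ t : H.obj X ⟶ H'.obj X, t ≫ d' X = d X ≫ e.hom.app _ := fun X =>
    (hdc' X).exists_lift _ (by
      rw [Category.assoc, ← e.hom.naturality, reassoc_of% (hdc X).1, zero_comp])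
  have h2 : ∀ X, ∃ t : H'.obj X ⟶ H.obj X, t ≫ d X = d' X ≫ e.inv.app _ := fun X =>
    (hdc X).exists_lift _ (by
      rw [Category.assoc, ← e.inv.naturality, reassoc_of% (hdc' X).1, zero_comp])
  choose t ht using h1
  choose t' ht' using h2
  refine ⟨NatIso.ofComponents (fun X => ⟨t X, t' X, ?_, ?_⟩) fun {X Y} f => ?_⟩
  · rw [← cancel_mono (d X), Category.assoc, ht', reassoc_of% ht, e.hom_inv_id_app,
      Category.comp_id, Category.id_comp]
  · rw [← cancel_mono (d' X), Category.assoc, ht, reassoc_of% ht', e.inv_hom_id_app,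
      Category.comp_id, Category.id_comp]
  · -- lift `f` to a morphism of the chosen short exact sequences
    let b := Projective.factorThru (Projective.π X ≫ f) (Projective.π Y)
    have hb : b ≫ Projective.π Y = Projective.π X ≫ f := Projective.factorThru_comp _ _
    obtain ⟨c, hc⟩ := (isKer_kernel_ι (Projective.π Y)).exists_lift
      (kernel.ι (Projective.π X) ≫ b) (by
        rw [Category.assoc, hb, kernel.condition_assoc, zero_comp])
    have n := h.natural _ _ _ _ _ _ _ _ _ _ c b f _ _ (hd X) (hd Y) hc.symm hb.symm
    have n' := h'.natural _ _ _ _ _ _ _ _ _ _ c b f _ _ (hd' X) (hd' Y) hc.symm hb.symm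
    dsimp only
    rw [← cancel_mono (d' Y), Category.assoc, Category.assoc, ht, ← n', reassoc_of% ht,
      ← reassoc_of% n, e.hom.naturality]

end

/-! ### Right derived functors are iterated right satellites -/

section

universe v₁ u₁ v₂ u₂

variable {A : Type u₁} [Category.{v₁} A] [Abelian A] {B : Type u₂} [Category.{v₂} B] [Abelian B]

theorem IsKer.exact {X Y Z : A} {f : X ⟶ Y} {g : Y ⟶ Z} (h : IsKer f g) :
    (ShortComplex.mk f g h.1).Exact :=
  ShortComplex.exact_of_f_is_kernel _ h.2.some

theorem IsCoker.exact {X Y Z : A} {f : X ⟶ Y} {g : Y ⟶ Z} (h : IsCoker f g) :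
    (ShortComplex.mk f g h.1).Exact :=
  ShortComplex.exact_of_g_is_cokernel _ h.2.some

namespace CategoryTheory.InjectiveResolution

/-- The coaugmentation `X ⟶ K⁰` of an injective resolution `K` of `X`. -/
noncomputable def ι₀ {X : A} (K : InjectiveResolution X) : X ⟶ K.cocomplex.X 0 := K.ι.f 0

theorem isKer_ι₀ {X : A} (K : InjectiveResolution X) : IsKer K.ι₀ (K.cocomplex.d 0 1) :=
  ⟨K.ι_f_zero_comp_complex_d, ⟨K.isLimitKernelFork⟩⟩

/-- An exact complex of injectives `K`, where `X` is the kernel of `K⁰ ⟶ K¹`, as an injective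
resolution of `X`. -/
noncomputable def ofIsKer {X : A} (K : CochainComplex A ℕ) (hK : ∀ n, Injective (K.X n))
    (m : X ⟶ K.X 0) (hm : IsKer m (K.d 0 1))
    (hex : ∀ n, (ShortComplex.mk _ _ (K.d_comp_d n (n + 1) (n + 2))).Exact) :
    InjectiveResolution X where
  cocomplex := K
  injective := hK
  ι := (CochainComplex.fromSingle₀Equiv K X).symm ⟨m, hm.1⟩
  quasiIso := ⟨fun n => by
    cases n with
    | zero =>
      have key : ∀ (f : X ⟶ K.X 0) (hf : f ≫ K.d 0 1 = 0), f = m →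
          (ShortComplex.mk f _ hf).Exact ∧ Mono f := by
        rintro _ _ rfl
        exact ⟨hm.exact, hm.mono⟩
      rw [CochainComplex.quasiIsoAt₀_iff, ShortComplex.quasiIso_iff_of_zeros]
      · exact key _ _ (CochainComplex.fromSingle₀Equiv_symm_apply_f_zero m hm.1)
      · rfl
      · rfl
      · exact K.shape 0 0 (by simp)
    | succ n =>
      rw [quasiIsoAt_iff_exactAt]
      · rw [HomologicalComplex.exactAt_iff' _ n (n + 1) (n + 1 + 1) (by simp) (by simp)]
        exact hex n
      · apply CochainComplex.exactAt_succ_single_obj⟩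

theorem ofIsKer_ι₀ {X : A} (K : CochainComplex A ℕ) (hK : ∀ n, Injective (K.X n))
    (m : X ⟶ K.X 0) (hm : IsKer m (K.d 0 1))
    (hex : ∀ n, (ShortComplex.mk _ _ (K.d_comp_d n (n + 1) (n + 2))).Exact) :
    (ofIsKer K hK m hm hex).ι₀ = m :=
  CochainComplex.fromSingle₀Equiv_symm_apply_f_zero m hm.1

/-- The isomorphism `RⁿF X ≅ Hⁿ(F K)` for an injective resolution `K` of `X`. -/
noncomputable def rightDerivedIso [HasInjectiveResolutions A] {X : A} (K : InjectiveResolution X)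
    (F : A ⥤ B) [F.Additive] (n : ℕ) : (F.rightDerived n).obj X ≅
      ((F.mapHomologicalComplex (ComplexShape.up ℕ)).obj K.cocomplex).homology n :=
  K.isoRightDerivedObj F n

theorem rightDerivedIso_hom_naturality [HasInjectiveResolutions A] {X Y : A} (f : X ⟶ Y)
    (K : InjectiveResolution X) (L : InjectiveResolution Y) (φ : K.cocomplex ⟶ L.cocomplex)
    (hφ : K.ι₀ ≫ φ.f 0 = f ≫ L.ι₀) (F : A ⥤ B) [F.Additive] (n : ℕ) :
    (F.rightDerived n).map f ≫ (L.rightDerivedIso F n).hom = (K.rightDerivedIso F n).hom ≫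
      HomologicalComplex.homologyMap ((F.mapHomologicalComplex _).map φ) n :=
  isoRightDerivedObj_hom_naturality f K L φ hφ F n

theorem rightDerivedIso_inv_naturality [HasInjectiveResolutions A] {X Y : A} (f : X ⟶ Y)
    (K : InjectiveResolution X) (L : InjectiveResolution Y) (φ : K.cocomplex ⟶ L.cocomplex)
    (hφ : K.ι₀ ≫ φ.f 0 = f ≫ L.ι₀) (F : A ⥤ B) [F.Additive] (n : ℕ) :
    (K.rightDerivedIso F n).inv ≫ (F.rightDerived n).map f =
      HomologicalComplex.homologyMap ((F.mapHomologicalComplex _).map φ) n ≫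
        (L.rightDerivedIso F n).inv :=
  isoRightDerivedObj_inv_naturality f K L φ hφ F n

/-- Splicing `0 ⟶ X ⟶ I ⟶ Z ⟶ 0`, with `I` injective, and an injective resolution `J` of `Z`
gives the injective resolution `I ⟶ J⁰ ⟶ J¹ ⟶ ⋯` of `X`. -/
noncomputable def splice {X I Z : A} {m : X ⟶ I} {p : I ⟶ Z}
    (hm : IsKer m p) (hp : IsCoker m p) (hI : Injective I) (J : InjectiveResolution Z) :
    InjectiveResolution X :=
  ofIsKer (J.cocomplex.augment (p ≫ J.ι₀) (by rw [Category.assoc, J.isKer_ι₀.1, comp_zero]))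
    (fun n => by
      cases n
      · exact hI
      · exact J.injective _)
    m (by
      have : Mono J.ι₀ := J.isKer_ι₀.mono
      exact ⟨by change m ≫ p ≫ J.ι₀ = 0; rw [reassoc_of% hm.1, zero_comp],
        ⟨isKernelCompMono hm.2.some J.ι₀ rfl⟩⟩)
    (fun n => by
      have : Epi p := hp.epi
      cases n with
      | zero =>
        exact (ShortComplex.exact_iff_of_epi_of_isIso_of_mono
          (S₁ := ShortComplex.mk (p ≫ J.ι₀) (J.cocomplex.d 0 1)
            (by rw [Category.assoc, J.isKer_ι₀.1, comp_zero]))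
          (S₂ := ShortComplex.mk _ _ J.isKer_ι₀.1)
          { τ₁ := p, τ₂ := 𝟙 _, τ₃ := 𝟙 _ }).2 J.isKer_ι₀.exact
      | succ n => exact J.exact_succ n)

section Splice

variable {X I Z X' I' Z' : A} {m : X ⟶ I} {p : I ⟶ Z} (hm : IsKer m p) (hp : IsCoker m p)
  (hI : Injective I) (J : InjectiveResolution Z) {m' : X' ⟶ I'} {p' : I' ⟶ Z'}
  (hm' : IsKer m' p') (hp' : IsCoker m' p') (hI' : Injective I') (J' : InjectiveResolution Z')

theorem splice_ι₀ : (splice hm hp hI J).ι₀ = m :=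
  ofIsKer_ι₀ _ _ _ _ _

/-- A morphism of short exact sequences and a morphism of resolutions of the last terms give a
morphism of the spliced resolutions. -/
noncomputable def spliceMap (b : I ⟶ I') (c : Z ⟶ Z')
    (hc : p ≫ c = b ≫ p') (ψ : J.cocomplex ⟶ J'.cocomplex)
    (hψ : J.ι₀ ≫ ψ.f 0 = c ≫ J'.ι₀) :
    (splice hm hp hI J).cocomplex ⟶ (splice hm' hp' hI' J').cocomplex where
  f
    | 0 => b
    | n + 1 => ψ.f n
  comm' i j hij := by
    obtain rfl : i + 1 = j := hij
    cases i with
    | zero =>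
      change b ≫ p' ≫ J'.ι₀ = (p ≫ J.ι₀) ≫ ψ.f 0
      rw [Category.assoc, hψ, reassoc_of% hc]
    | succ i => exact ψ.comm i (i + 1)

theorem splice_ι₀_spliceMap (a : X ⟶ X') (b : I ⟶ I') (c : Z ⟶ Z') (hb : m ≫ b = a ≫ m')
    (hc : p ≫ c = b ≫ p') (ψ : J.cocomplex ⟶ J'.cocomplex) (hψ : J.ι₀ ≫ ψ.f 0 = c ≫ J'.ι₀) :
    (splice hm hp hI J).ι₀ ≫ (spliceMap hm hp hI J hm' hp' hI' J' b c hc ψ hψ).f 0 =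
      a ≫ (splice hm' hp' hI' J').ι₀ := by
  have h1 := splice_ι₀ hm hp hI J
  have h2 := splice_ι₀ hm' hp' hI' J'
  change (splice hm hp hI J).ι₀ ≫ b = _
  rw [h1, h2]
  exact hb

end Splice

end CategoryTheory.InjectiveResolution

end

section

universe v₁ u₁ v₂ u₂

variable {A : Type u₁} [Category.{v₁} A] [Abelian A] {B : Type u₂} [Category.{v₂} B] [Abelian B]

theorem IsKer.map {X Y Z : A} {f : X ⟶ Y} {g : Y ⟶ Z} (h : IsKer f g) (F : A ⥤ B) [F.Additive]
    [PreservesFiniteLimits F] : IsKer (F.map f) (F.map g) :=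
  ⟨by rw [← F.map_comp, h.1, F.map_zero], ⟨KernelFork.mapIsLimit _ h.2.some F⟩⟩

theorem IsCoker.map {X Y Z : A} {f : X ⟶ Y} {g : Y ⟶ Z} (h : IsCoker f g) (F : A ⥤ B) [F.Additive]
    [PreservesFiniteColimits F] : IsCoker (F.map f) (F.map g) :=
  ⟨by rw [← F.map_comp, h.1, F.map_zero], ⟨CokernelCofork.mapIsColimit _ h.2.some F⟩⟩

namespace CochainComplex

variable {C C' D D' : CochainComplex B ℕ}

/-- If `Z` is the kernel of `D¹ ⟶ D²`, the morphism `Z ⟶ H¹(D)`. -/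
noncomputable def toHomologyOne (D : CochainComplex B ℕ) {Z : B} (j : Z ⟶ D.X 1)
    (hj : j ≫ D.d 1 2 = 0) : Z ⟶ D.homology 1 :=
  D.liftCycles j 2 (by simp) hj ≫ D.homologyπ 1

theorem isCoker_toHomologyOne (D : CochainComplex B ℕ) {Z : B} (j : Z ⟶ D.X 1)
    (hj : IsKer j (D.d 1 2)) (p : D.X 0 ⟶ Z) (hp : p ≫ j = D.d 0 1) :
    IsCoker p (D.toHomologyOne j hj.1) := by
  have : IsIso (D.liftCycles j 2 (by simp) hj.1) := by
    obtain ⟨l, hl⟩ := hj.exists_lift (D.iCycles 1) (D.iCycles_d 1 2)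
    have := hj.mono
    refine ⟨l, ?_, ?_⟩
    · rw [← cancel_mono j, Category.assoc, hl, HomologicalComplex.liftCycles_i, Category.id_comp]
    · rw [← cancel_mono (D.iCycles 1), Category.assoc, HomologicalComplex.liftCycles_i, hl,
        Category.id_comp]
  refine IsCoker.isIso_comp (f := D.toCycles 0 1)
    ⟨D.toCycles_comp_homologyπ 0 1, ⟨D.homologyIsCokernel 0 1 (by simp)⟩⟩ _ ?_
  rw [← cancel_mono (D.iCycles 1), Category.assoc, HomologicalComplex.liftCycles_i, hp,
    HomologicalComplex.toCycles_i]

theorem toHomologyOne_naturality {Z Z' : B} (j : Z ⟶ D.X 1) (hj : j ≫ D.d 1 2 = 0)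
    (j' : Z' ⟶ D'.X 1) (hj' : j' ≫ D'.d 1 2 = 0) (φ : D ⟶ D') (c : Z ⟶ Z')
    (hc : c ≫ j' = j ≫ φ.f 1) :
    c ≫ D'.toHomologyOne j' hj' =
      D.toHomologyOne j hj ≫ HomologicalComplex.homologyMap φ 1 := by
  rw [toHomologyOne, toHomologyOne, Category.assoc, HomologicalComplex.homologyπ_naturality,
    ← Category.assoc, ← Category.assoc]
  congr 1
  rw [← cancel_mono (D'.iCycles 1)]
  simp [hc]

/-- If `C` is obtained from `D` by dropping the term of degree `0` and shifting, then
`Hᵏ⁺¹(C) ≅ Hᵏ⁺²(D)`. -/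
noncomputable def homologyShiftIso (e : ∀ n, C.X n ≅ D.X (n + 1))
    (he : ∀ n, (e n).hom ≫ D.d (n + 1) (n + 2) = C.d n (n + 1) ≫ (e (n + 1)).hom) (k : ℕ) :
    C.homology (k + 1) ≅ D.homology (k + 2) :=
  ShortComplex.homologyMapIso (C.isoSc' k (k + 1) (k + 2) (by simp) (by simp) ≪≫
    ShortComplex.isoMk (S₁ := C.sc' k (k + 1) (k + 2)) (S₂ := D.sc' (k + 1) (k + 2) (k + 3))
      (e k) (e (k + 1)) (e (k + 2)) (he k) (he (k + 1)) ≪≫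
    (D.isoSc' (k + 1) (k + 2) (k + 3) (by simp) (by simp)).symm)

theorem homologyShiftIso_naturality (e : ∀ n, C.X n ≅ D.X (n + 1))
    (he : ∀ n, (e n).hom ≫ D.d (n + 1) (n + 2) = C.d n (n + 1) ≫ (e (n + 1)).hom)
    (e' : ∀ n, C'.X n ≅ D'.X (n + 1))
    (he' : ∀ n, (e' n).hom ≫ D'.d (n + 1) (n + 2) = C'.d n (n + 1) ≫ (e' (n + 1)).hom)
    (ψ : C ⟶ C') (φ : D ⟶ D') (h : ∀ n, ψ.f n ≫ (e' n).hom = (e n).hom ≫ φ.f (n + 1)) (k : ℕ) :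
    HomologicalComplex.homologyMap ψ (k + 1) ≫ (homologyShiftIso e' he' k).hom =
      (homologyShiftIso e he k).hom ≫ HomologicalComplex.homologyMap φ (k + 2) := by
  change ShortComplex.homologyMap _ ≫ ShortComplex.homologyMap _ =
    ShortComplex.homologyMap _ ≫ ShortComplex.homologyMap _
  rw [← ShortComplex.homologyMap_comp, ← ShortComplex.homologyMap_comp]
  congr 1
  have n1 := (HomologicalComplex.natIsoSc' B (ComplexShape.up ℕ) k (k + 1) (k + 2)
    (by simp) (by simp)).hom.naturality ψ
  have n2 := (HomologicalComplex.natIsoSc' B (ComplexShape.up ℕ) (k + 1) (k + 2) (k + 3)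
    (by simp) (by simp)).inv.naturality φ
  dsimp only [Iso.trans_hom, Iso.symm_hom, Iso.app_hom, Iso.app_inv]
  rw [Category.assoc, Category.assoc]
  erw [reassoc_of% n1, ← n2]
  congr 1
  rw [← Category.assoc, ← Category.assoc]
  congr 1
  ext
  · exact h k
  · exact h (k + 1)
  · exact h (k + 2)

end CochainComplex

end

section

universe v₁ u₁ v₂ u₂

variable {A : Type u₁} [Category.{v₁} A] [Abelian A] {B : Type u₂} [Category.{v₂} B] [Abelian B]

section

variable {X I Z X' I' Z' : A} {m : X ⟶ I} {p : I ⟶ Z} (hm : IsKer m p) (hp : IsCoker m p)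
  (hI : Injective I) (J : InjectiveResolution Z) {m' : X' ⟶ I'} {p' : I' ⟶ Z'}
  (hm' : IsKer m' p') (hp' : IsCoker m' p') (hI' : Injective I') (J' : InjectiveResolution Z')
  (F : A ⥤ B) [F.Additive]

namespace RightDerived

open InjectiveResolution

/-- The morphism `F Z ⟶ F J⁰`, where `J⁰` is regarded as the term of degree `1` of the spliced
resolution. -/
noncomputable def spliceMapι₀ :
    F.obj Z ⟶ ((F.mapHomologicalComplex _).obj (splice hm hp hI J).cocomplex).X 1 :=
  F.map J.ι₀

/-- The terms of `F J`, as the terms of positive degree of `F` of the spliced resolution. -/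
noncomputable def spliceXIso (n : ℕ) :
    ((F.mapHomologicalComplex (ComplexShape.up ℕ)).obj J.cocomplex).X n ≅
      ((F.mapHomologicalComplex (ComplexShape.up ℕ)).obj (splice hm hp hI J).cocomplex).X (n + 1) :=
  Iso.refl (F.obj (J.cocomplex.X n))

theorem spliceXIso_comm (n : ℕ) :
    (spliceXIso hm hp hI J F n).hom ≫ ((F.mapHomologicalComplex (ComplexShape.up ℕ)).obj
      (splice hm hp hI J).cocomplex).d (n + 1) (n + 2) =
    ((F.mapHomologicalComplex (ComplexShape.up ℕ)).obj J.cocomplex).d n (n + 1) ≫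
      (spliceXIso hm hp hI J F (n + 1)).hom :=
  (Category.id_comp (F.map (J.cocomplex.d n (n + 1)))).trans
    (Category.comp_id (F.map (J.cocomplex.d n (n + 1)))).symm

theorem spliceMapι₀_comp_d : spliceMapι₀ hm hp hI J F ≫
    ((F.mapHomologicalComplex _).obj (splice hm hp hI J).cocomplex).d 1 2 = 0 := by
  change F.map J.ι₀ ≫ F.map (J.cocomplex.d 0 1) = 0
  rw [← F.map_comp, J.isKer_ι₀.1, F.map_zero]

variable [HasInjectiveResolutions A]

/-- The connecting morphism `F Z ⟶ R¹F X` of a left exact functor `F`. -/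
noncomputable def connectingZero : F.obj Z ⟶ (F.rightDerived 1).obj X :=
  CochainComplex.toHomologyOne _ (spliceMapι₀ hm hp hI J F) (spliceMapι₀_comp_d hm hp hI J F) ≫
    ((splice hm hp hI J).rightDerivedIso F 1).inv

/-- The connecting isomorphism `Rⁿ⁺¹F Z ≅ Rⁿ⁺²F X`. -/
noncomputable def connectingSucc (n : ℕ) :
    (F.rightDerived (n + 1)).obj Z ≅ (F.rightDerived (n + 2)).obj X :=
  J.rightDerivedIso F (n + 1) ≪≫
    CochainComplex.homologyShiftIso (spliceXIso hm hp hI J F) (spliceXIso_comm hm hp hI J F) n ≪≫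
    ((splice hm hp hI J).rightDerivedIso F (n + 2)).symm

theorem isCoker_connectingZero [PreservesFiniteLimits F] :
    IsCoker (F.map p) (connectingZero hm hp hI J F) :=
  (CochainComplex.isCoker_toHomologyOne _ (spliceMapι₀ hm hp hI J F) (J.isKer_ι₀.map F) (F.map p)
    (F.map_comp p J.ι₀).symm).comp_isIso _

section

variable (a : X ⟶ X') (b : I ⟶ I') (c : Z ⟶ Z') (hb : m ≫ b = a ≫ m') (hc : p ≫ c = b ≫ p')

include hb hc

theorem connectingZero_naturality :
    F.map c ≫ connectingZero hm' hp' hI' J' F =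
      connectingZero hm hp hI J F ≫ (F.rightDerived 1).map a := by
  have hψ : J.ι₀ ≫ (desc c J' J).f 0 = c ≫ J'.ι₀ := desc_commutes_zero c J' J
  have h1 := rightDerivedIso_inv_naturality a _ _ _
    (splice_ι₀_spliceMap hm hp hI J hm' hp' hI' J' a b c hb hc (desc c J' J) hψ) F 1
  have h2 := CochainComplex.toHomologyOne_naturality _ (spliceMapι₀_comp_d hm hp hI J F) _
    (spliceMapι₀_comp_d hm' hp' hI' J' F) ((F.mapHomologicalComplex _).map
      (spliceMap hm hp hI J hm' hp' hI' J' b c hc (desc c J' J) hψ)) (F.map c) (by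
    change F.map c ≫ F.map J'.ι₀ = F.map J.ι₀ ≫ F.map ((desc c J' J).f 0)
    rw [← F.map_comp, ← F.map_comp, hψ])
  rw [connectingZero, connectingZero, Category.assoc, h1, reassoc_of% h2]

theorem connectingSucc_naturality (n : ℕ) :
    (F.rightDerived (n + 1)).map c ≫ (connectingSucc hm' hp' hI' J' F n).hom =
      (connectingSucc hm hp hI J F n).hom ≫ (F.rightDerived (n + 2)).map a := by
  have hψ : J.ι₀ ≫ (desc c J' J).f 0 = c ≫ J'.ι₀ := desc_commutes_zero c J' J
  have h1 := rightDerivedIso_hom_naturality c J J' (desc c J' J) hψ F (n + 1)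
  have h2 := rightDerivedIso_inv_naturality a _ _ _
    (splice_ι₀_spliceMap hm hp hI J hm' hp' hI' J' a b c hb hc (desc c J' J) hψ) F (n + 2)
  have h3 := CochainComplex.homologyShiftIso_naturality (spliceXIso hm hp hI J F)
    (spliceXIso_comm hm hp hI J F) (spliceXIso hm' hp' hI' J' F) (spliceXIso_comm hm' hp' hI' J' F)
    ((F.mapHomologicalComplex _).map (desc c J' J))
    ((F.mapHomologicalComplex _).map
      (spliceMap hm hp hI J hm' hp' hI' J' b c hc (desc c J' J) hψ))
    (fun n => (Category.comp_id (F.map ((desc c J' J).f n))).trans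
      (Category.id_comp (F.map ((desc c J' J).f n))).symm) n
  simp only [connectingSucc, Iso.trans_hom, Iso.symm_hom, Category.assoc]
  rw [reassoc_of% h1, h2, reassoc_of% h3]

end

end RightDerived

end

variable (F : A ⥤ B) [F.Additive] [HasInjectiveResolutions A]

open RightDerived

/-- The first right derived functor of a left exact functor is its right satellite. -/
theorem exists_isRightSatellite_zero [PreservesFiniteLimits F] :
    ∃ Δ, IsRightSatellite F (F.rightDerived 1) Δ := by
  refine ⟨fun X I Z m p d => ∃ (hm : IsKer m p) (hp : IsCoker m p) (hI : Injective I),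
    d = connectingZero hm hp hI (injectiveResolution Z) F, ?_, ?_, ?_⟩
  · exact fun X I Z m p hm hp hI => ⟨_, hm, hp, hI, rfl⟩
  · rintro X I Z m p _ ⟨hm, hp, hI, rfl⟩
    exact isCoker_connectingZero hm hp hI _ F
  · rintro X I Z X' I' Z' m p m' p' a b c _ _ ⟨hm, hp, hI, rfl⟩ ⟨hm', hp', hI', rfl⟩ hb hc
    exact connectingZero_naturality hm hp hI _ hm' hp' hI' _ F a b c hb hc

/-- The higher right derived functors are successive right satellites. -/
theorem exists_isRightSatellite_succ (n : ℕ) :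
    ∃ Δ, IsRightSatellite (F.rightDerived (n + 1)) (F.rightDerived (n + 2)) Δ := by
  refine ⟨fun X I Z m p d => ∃ (hm : IsKer m p) (hp : IsCoker m p) (hI : Injective I),
    d = (connectingSucc hm hp hI (injectiveResolution Z) F n).hom, ?_, ?_, ?_⟩
  · exact fun X I Z m p hm hp hI => ⟨_, hm, hp, hI, rfl⟩
  · rintro X I Z m p _ ⟨hm, hp, hI, rfl⟩
    exact IsCoker.of_isZero _ (F.isZero_rightDerived_obj_injective_succ n I) _
  · rintro X I Z X' I' Z' m p m' p' a b c _ _ ⟨hm, hp, hI, rfl⟩ ⟨hm', hp', hI', rfl⟩ hb hc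
    exact connectingSucc_naturality hm hp hI _ hm' hp' hI' _ F a b c hb hc n

end

/-! ### Left derived functors are iterated left satellites -/

section

universe v₁ u₁ v₂ u₂

variable {A : Type u₁} [Category.{v₁} A] [Abelian A] {B : Type u₂} [Category.{v₂} B] [Abelian B]

namespace CategoryTheory.ProjectiveResolution

/-- The augmentation `K₀ ⟶ X` of a projective resolution `K` of `X`. -/
noncomputable def π₀ {X : A} (K : ProjectiveResolution X) : K.complex.X 0 ⟶ X := K.π.f 0

theorem isCoker_π₀ {X : A} (K : ProjectiveResolution X) : IsCoker (K.complex.d 1 0) K.π₀ :=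
  ⟨K.complex_d_comp_π_f_zero, ⟨K.isColimitCokernelCofork⟩⟩

/-- An exact complex of projectives `K`, where `X` is the cokernel of `K₁ ⟶ K₀`, as a projective
resolution of `X`. -/
noncomputable def ofIsCoker {X : A} (K : ChainComplex A ℕ) (hK : ∀ n, Projective (K.X n))
    (p : K.X 0 ⟶ X) (hp : IsCoker (K.d 1 0) p)
    (hex : ∀ n, (ShortComplex.mk _ _ (K.d_comp_d (n + 2) (n + 1) n)).Exact) :
    ProjectiveResolution X where
  complex := K
  projective := hK
  π := (ChainComplex.toSingle₀Equiv K X).symm ⟨p, hp.1⟩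
  quasiIso := ⟨fun n => by
    cases n with
    | zero =>
      have key : ∀ (f : K.X 0 ⟶ X) (hf : K.d 1 0 ≫ f = 0), f = p →
          (ShortComplex.mk _ f hf).Exact ∧ Epi f := by
        rintro _ _ rfl
        exact ⟨hp.exact, hp.epi⟩
      rw [ChainComplex.quasiIsoAt₀_iff, ShortComplex.quasiIso_iff_of_zeros']
      · exact key _ _ (ChainComplex.toSingle₀Equiv_symm_apply_f_zero p hp.1)
      · exact K.shape 0 0 (by simp)
      · rfl
      · rfl
    | succ n =>
      rw [quasiIsoAt_iff_exactAt']
      · rw [HomologicalComplex.exactAt_iff' _ (n + 1 + 1) (n + 1) n (by simp) (by simp)]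
        exact hex n
      · apply ChainComplex.exactAt_succ_single_obj⟩

theorem ofIsCoker_π₀ {X : A} (K : ChainComplex A ℕ) (hK : ∀ n, Projective (K.X n))
    (p : K.X 0 ⟶ X) (hp : IsCoker (K.d 1 0) p)
    (hex : ∀ n, (ShortComplex.mk _ _ (K.d_comp_d (n + 2) (n + 1) n)).Exact) :
    (ofIsCoker K hK p hp hex).π₀ = p :=
  ChainComplex.toSingle₀Equiv_symm_apply_f_zero p hp.1

/-- The isomorphism `LₙF X ≅ Hₙ(F K)` for a projective resolution `K` of `X`. -/
noncomputable def leftDerivedIso [HasProjectiveResolutions A] {X : A} (K : ProjectiveResolution X)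
    (F : A ⥤ B) [F.Additive] (n : ℕ) : (F.leftDerived n).obj X ≅
      ((F.mapHomologicalComplex (ComplexShape.down ℕ)).obj K.complex).homology n :=
  K.isoLeftDerivedObj F n

theorem leftDerivedIso_hom_naturality [HasProjectiveResolutions A] {X Y : A} (f : X ⟶ Y)
    (K : ProjectiveResolution X) (L : ProjectiveResolution Y) (φ : K.complex ⟶ L.complex)
    (hφ : φ.f 0 ≫ L.π₀ = K.π₀ ≫ f) (F : A ⥤ B) [F.Additive] (n : ℕ) :
    (F.leftDerived n).map f ≫ (L.leftDerivedIso F n).hom = (K.leftDerivedIso F n).hom ≫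
      HomologicalComplex.homologyMap ((F.mapHomologicalComplex _).map φ) n :=
  isoLeftDerivedObj_hom_naturality f K L φ hφ F n

theorem leftDerivedIso_inv_naturality [HasProjectiveResolutions A] {X Y : A} (f : X ⟶ Y)
    (K : ProjectiveResolution X) (L : ProjectiveResolution Y) (φ : K.complex ⟶ L.complex)
    (hφ : φ.f 0 ≫ L.π₀ = K.π₀ ≫ f) (F : A ⥤ B) [F.Additive] (n : ℕ) :
    (K.leftDerivedIso F n).inv ≫ (F.leftDerived n).map f =
      HomologicalComplex.homologyMap ((F.mapHomologicalComplex _).map φ) n ≫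
        (L.leftDerivedIso F n).inv :=
  isoLeftDerivedObj_inv_naturality f K L φ hφ F n

/-- Splicing `0 ⟶ Z ⟶ P ⟶ X ⟶ 0`, with `P` projective, and a projective resolution `J` of `Z`
gives the projective resolution `⋯ ⟶ J₁ ⟶ J₀ ⟶ P` of `X`. -/
noncomputable def splice {Z P X : A} {m : Z ⟶ P} {p : P ⟶ X}
    (hm : IsKer m p) (hp : IsCoker m p) (hP : Projective P) (J : ProjectiveResolution Z) :
    ProjectiveResolution X :=
  ofIsCoker (J.complex.augment (J.π₀ ≫ m) (by rw [reassoc_of% J.isCoker_π₀.1, zero_comp]))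
    (fun n => by
      cases n
      · exact hP
      · exact J.projective _)
    p (by
      have : Epi J.π₀ := J.isCoker_π₀.epi
      exact ⟨by change (J.π₀ ≫ m) ≫ p = 0; rw [Category.assoc, hm.1, comp_zero],
        ⟨isCokernelEpiComp hp.2.some J.π₀ rfl⟩⟩)
    (fun n => by
      have : Mono m := hm.mono
      cases n with
      | zero =>
        exact (ShortComplex.exact_iff_of_epi_of_isIso_of_mono
          (S₁ := ShortComplex.mk _ _ J.isCoker_π₀.1)
          (S₂ := ShortComplex.mk (J.complex.d 1 0) (J.π₀ ≫ m)
            (by rw [reassoc_of% J.isCoker_π₀.1, zero_comp]))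
          { τ₁ := 𝟙 _, τ₂ := 𝟙 _, τ₃ := m }).1 J.isCoker_π₀.exact
      | succ n => exact J.exact_succ n)

section Splice

variable {Z P X Z' P' X' : A} {m : Z ⟶ P} {p : P ⟶ X} (hm : IsKer m p) (hp : IsCoker m p)
  (hP : Projective P) (J : ProjectiveResolution Z) {m' : Z' ⟶ P'} {p' : P' ⟶ X'}
  (hm' : IsKer m' p') (hp' : IsCoker m' p') (hP' : Projective P') (J' : ProjectiveResolution Z')

theorem splice_π₀ : (splice hm hp hP J).π₀ = p :=
  ofIsCoker_π₀ _ _ _ _ _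

/-- A morphism of short exact sequences and a morphism of resolutions of the first terms give a
morphism of the spliced resolutions. -/
noncomputable def spliceMap (a : Z ⟶ Z') (b : P ⟶ P')
    (hb : m ≫ b = a ≫ m') (ψ : J.complex ⟶ J'.complex)
    (hψ : ψ.f 0 ≫ J'.π₀ = J.π₀ ≫ a) :
    (splice hm hp hP J).complex ⟶ (splice hm' hp' hP' J').complex where
  f
    | 0 => b
    | n + 1 => ψ.f n
  comm' i j hij := by
    obtain rfl : j + 1 = i := hij
    cases j with
    | zero =>
      change ψ.f 0 ≫ J'.π₀ ≫ m' = (J.π₀ ≫ m) ≫ b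
      rw [Category.assoc, hb, reassoc_of% hψ]
    | succ j => exact ψ.comm (j + 1) j

theorem spliceMap_splice_π₀ (a : Z ⟶ Z') (b : P ⟶ P') (c : X ⟶ X') (hb : m ≫ b = a ≫ m')
    (hc : p ≫ c = b ≫ p') (ψ : J.complex ⟶ J'.complex) (hψ : ψ.f 0 ≫ J'.π₀ = J.π₀ ≫ a) :
    (spliceMap hm hp hP J hm' hp' hP' J' a b hb ψ hψ).f 0 ≫ (splice hm' hp' hP' J').π₀ =
      (splice hm hp hP J).π₀ ≫ c := by
  have h1 := splice_π₀ hm hp hP J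
  have h2 := splice_π₀ hm' hp' hP' J'
  change b ≫ (splice hm' hp' hP' J').π₀ = _
  rw [h1, h2]
  exact hc.symm

end Splice

end CategoryTheory.ProjectiveResolution

namespace ChainComplex

variable {C C' D D' : ChainComplex B ℕ}

/-- If `Z` is the cokernel of `D₂ ⟶ D₁`, the morphism `H₁(D) ⟶ Z`. -/
noncomputable def fromHomologyOne (D : ChainComplex B ℕ) {Z : B} (q : D.X 1 ⟶ Z)
    (hq : D.d 2 1 ≫ q = 0) : D.homology 1 ⟶ Z :=
  D.homologyι 1 ≫ D.descOpcycles q 2 (by simp) hq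

theorem isKer_fromHomologyOne (D : ChainComplex B ℕ) {Z : B} (q : D.X 1 ⟶ Z)
    (hq : IsCoker (D.d 2 1) q) (m : Z ⟶ D.X 0) (hm : q ≫ m = D.d 1 0) :
    IsKer (D.fromHomologyOne q hq.1) m := by
  have : IsIso (D.descOpcycles q 2 (by simp) hq.1) := by
    obtain ⟨l, hl⟩ := hq.exists_desc (D.pOpcycles 1) (D.d_pOpcycles 2 1)
    have := hq.epi
    refine ⟨l, ?_, ?_⟩
    · rw [← cancel_epi (D.pOpcycles 1), HomologicalComplex.p_descOpcycles_assoc, hl,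
        Category.comp_id]
    · rw [← cancel_epi q, reassoc_of% hl, HomologicalComplex.p_descOpcycles, Category.comp_id]
  refine IsKer.comp_isIso (f := D.fromOpcycles 1 0)
    ⟨D.homologyι_comp_fromOpcycles 1 0, ⟨D.homologyIsKernel 1 0 (by simp)⟩⟩ _ ?_
  rw [← cancel_epi (D.pOpcycles 1), HomologicalComplex.p_descOpcycles_assoc, hm,
    HomologicalComplex.p_fromOpcycles]

theorem fromHomologyOne_naturality {Z Z' : B} (q : D.X 1 ⟶ Z) (hq : D.d 2 1 ≫ q = 0)
    (q' : D'.X 1 ⟶ Z') (hq' : D'.d 2 1 ≫ q' = 0) (φ : D ⟶ D') (c : Z ⟶ Z')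
    (hc : q ≫ c = φ.f 1 ≫ q') :
    D.fromHomologyOne q hq ≫ c =
      HomologicalComplex.homologyMap φ 1 ≫ D'.fromHomologyOne q' hq' := by
  rw [fromHomologyOne, fromHomologyOne, Category.assoc,
    HomologicalComplex.homologyι_naturality_assoc]
  congr 1
  rw [← cancel_epi (D.pOpcycles 1)]
  simp [hc]

/-- If `C` is obtained from `D` by dropping the term of degree `0` and shifting, then
`Hₖ₊₁(C) ≅ Hₖ₊₂(D)`. -/
noncomputable def homologyShiftIso (e : ∀ n, C.X n ≅ D.X (n + 1))
    (he : ∀ n, (e (n + 1)).hom ≫ D.d (n + 2) (n + 1) = C.d (n + 1) n ≫ (e n).hom) (k : ℕ) :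
    C.homology (k + 1) ≅ D.homology (k + 2) :=
  ShortComplex.homologyMapIso (C.isoSc' (k + 2) (k + 1) k (by simp) (by simp) ≪≫
    ShortComplex.isoMk (S₁ := C.sc' (k + 2) (k + 1) k) (S₂ := D.sc' (k + 3) (k + 2) (k + 1))
      (e (k + 2)) (e (k + 1)) (e k) (he (k + 1)) (he k) ≪≫
    (D.isoSc' (k + 3) (k + 2) (k + 1) (by simp) (by simp)).symm)

theorem homologyShiftIso_naturality (e : ∀ n, C.X n ≅ D.X (n + 1))
    (he : ∀ n, (e (n + 1)).hom ≫ D.d (n + 2) (n + 1) = C.d (n + 1) n ≫ (e n).hom)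
    (e' : ∀ n, C'.X n ≅ D'.X (n + 1))
    (he' : ∀ n, (e' (n + 1)).hom ≫ D'.d (n + 2) (n + 1) = C'.d (n + 1) n ≫ (e' n).hom)
    (ψ : C ⟶ C') (φ : D ⟶ D') (h : ∀ n, ψ.f n ≫ (e' n).hom = (e n).hom ≫ φ.f (n + 1)) (k : ℕ) :
    HomologicalComplex.homologyMap ψ (k + 1) ≫ (homologyShiftIso e' he' k).hom =
      (homologyShiftIso e he k).hom ≫ HomologicalComplex.homologyMap φ (k + 2) := by
  change ShortComplex.homologyMap _ ≫ ShortComplex.homologyMap _ =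
    ShortComplex.homologyMap _ ≫ ShortComplex.homologyMap _
  rw [← ShortComplex.homologyMap_comp, ← ShortComplex.homologyMap_comp]
  congr 1
  have n1 := (HomologicalComplex.natIsoSc' B (ComplexShape.down ℕ) (k + 2) (k + 1) k
    (by simp) (by simp)).hom.naturality ψ
  have n2 := (HomologicalComplex.natIsoSc' B (ComplexShape.down ℕ) (k + 3) (k + 2) (k + 1)
    (by simp) (by simp)).inv.naturality φ
  dsimp only [Iso.trans_hom, Iso.symm_hom, Iso.app_hom, Iso.app_inv]
  rw [Category.assoc, Category.assoc]
  erw [reassoc_of% n1, ← n2]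
  congr 1
  rw [← Category.assoc, ← Category.assoc]
  congr 1
  ext
  · exact h (k + 2)
  · exact h (k + 1)
  · exact h k

end ChainComplex

section

variable {Z P X Z' P' X' : A} {m : Z ⟶ P} {p : P ⟶ X} (hm : IsKer m p) (hp : IsCoker m p)
  (hP : Projective P) (J : ProjectiveResolution Z) {m' : Z' ⟶ P'} {p' : P' ⟶ X'}
  (hm' : IsKer m' p') (hp' : IsCoker m' p') (hP' : Projective P') (J' : ProjectiveResolution Z')
  (F : A ⥤ B) [F.Additive]

namespace LeftDerived

open ProjectiveResolution

/-- The morphism `F J₀ ⟶ F Z`, where `J₀` is regarded as the term of degree `1` of the spliced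
resolution. -/
noncomputable def spliceMapπ₀ :
    ((F.mapHomologicalComplex _).obj (splice hm hp hP J).complex).X 1 ⟶ F.obj Z :=
  F.map J.π₀

/-- The terms of `F J`, as the terms of positive degree of `F` of the spliced resolution. -/
noncomputable def spliceXIso (n : ℕ) :
    ((F.mapHomologicalComplex (ComplexShape.down ℕ)).obj J.complex).X n ≅
      ((F.mapHomologicalComplex (ComplexShape.down ℕ)).obj (splice hm hp hP J).complex).X (n + 1) :=
  Iso.refl (F.obj (J.complex.X n))

theorem spliceXIso_comm (n : ℕ) :
    (spliceXIso hm hp hP J F (n + 1)).hom ≫ ((F.mapHomologicalComplex (ComplexShape.down ℕ)).obj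
      (splice hm hp hP J).complex).d (n + 2) (n + 1) =
    ((F.mapHomologicalComplex (ComplexShape.down ℕ)).obj J.complex).d (n + 1) n ≫
      (spliceXIso hm hp hP J F n).hom :=
  (Category.id_comp (F.map (J.complex.d (n + 1) n))).trans
    (Category.comp_id (F.map (J.complex.d (n + 1) n))).symm

theorem d_comp_spliceMapπ₀ : ((F.mapHomologicalComplex _).obj (splice hm hp hP J).complex).d 2 1 ≫
    spliceMapπ₀ hm hp hP J F = 0 := by
  change F.map (J.complex.d 1 0) ≫ F.map J.π₀ = 0
  rw [← F.map_comp, J.isCoker_π₀.1, F.map_zero]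

variable [HasProjectiveResolutions A]

/-- The connecting morphism `L₁F X ⟶ F Z` of a right exact functor `F`. -/
noncomputable def connectingZero : (F.leftDerived 1).obj X ⟶ F.obj Z :=
  ((splice hm hp hP J).leftDerivedIso F 1).hom ≫
    ChainComplex.fromHomologyOne _ (spliceMapπ₀ hm hp hP J F) (d_comp_spliceMapπ₀ hm hp hP J F)

/-- The connecting isomorphism `Lₙ₊₂F X ≅ Lₙ₊₁F Z`, in the inverse direction. -/
noncomputable def connectingSucc (n : ℕ) :
    (F.leftDerived (n + 1)).obj Z ≅ (F.leftDerived (n + 2)).obj X :=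
  J.leftDerivedIso F (n + 1) ≪≫
    ChainComplex.homologyShiftIso (spliceXIso hm hp hP J F) (spliceXIso_comm hm hp hP J F) n ≪≫
    ((splice hm hp hP J).leftDerivedIso F (n + 2)).symm

theorem isKer_connectingZero [PreservesFiniteColimits F] :
    IsKer (connectingZero hm hp hP J F) (F.map m) :=
  (ChainComplex.isKer_fromHomologyOne _ (spliceMapπ₀ hm hp hP J F) (J.isCoker_π₀.map F) (F.map m)
    (F.map_comp J.π₀ m).symm).isIso_comp _

section

variable (a : Z ⟶ Z') (b : P ⟶ P') (c : X ⟶ X') (hb : m ≫ b = a ≫ m') (hc : p ≫ c = b ≫ p')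

include hb hc

theorem connectingZero_naturality :
    connectingZero hm hp hP J F ≫ F.map a =
      (F.leftDerived 1).map c ≫ connectingZero hm' hp' hP' J' F := by
  have hψ : (lift a J J').f 0 ≫ J'.π₀ = J.π₀ ≫ a := lift_commutes_zero a J J'
  have h1 := leftDerivedIso_hom_naturality c _ _ _
    (spliceMap_splice_π₀ hm hp hP J hm' hp' hP' J' a b c hb hc (lift a J J') hψ) F 1
  have h2 := ChainComplex.fromHomologyOne_naturality _ (d_comp_spliceMapπ₀ hm hp hP J F) _
    (d_comp_spliceMapπ₀ hm' hp' hP' J' F) ((F.mapHomologicalComplex _).map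
      (spliceMap hm hp hP J hm' hp' hP' J' a b hb (lift a J J') hψ)) (F.map a) (by
    change F.map J.π₀ ≫ F.map a = F.map ((lift a J J').f 0) ≫ F.map J'.π₀
    rw [← F.map_comp, ← F.map_comp, hψ])
  rw [connectingZero, connectingZero, Category.assoc, h2, reassoc_of% h1]

theorem connectingSucc_naturality (n : ℕ) :
    (F.leftDerived (n + 1)).map a ≫ (connectingSucc hm' hp' hP' J' F n).hom =
      (connectingSucc hm hp hP J F n).hom ≫ (F.leftDerived (n + 2)).map c := by
  have hψ : (lift a J J').f 0 ≫ J'.π₀ = J.π₀ ≫ a := lift_commutes_zero a J J'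
  have h1 := leftDerivedIso_hom_naturality a J J' (lift a J J') hψ F (n + 1)
  have h2 := leftDerivedIso_inv_naturality c _ _ _
    (spliceMap_splice_π₀ hm hp hP J hm' hp' hP' J' a b c hb hc (lift a J J') hψ) F (n + 2)
  have h3 := ChainComplex.homologyShiftIso_naturality (spliceXIso hm hp hP J F)
    (spliceXIso_comm hm hp hP J F) (spliceXIso hm' hp' hP' J' F) (spliceXIso_comm hm' hp' hP' J' F)
    ((F.mapHomologicalComplex _).map (lift a J J'))
    ((F.mapHomologicalComplex _).map
      (spliceMap hm hp hP J hm' hp' hP' J' a b hb (lift a J J') hψ))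
    (fun n => (Category.comp_id (F.map ((lift a J J').f n))).trans
      (Category.id_comp (F.map ((lift a J J').f n))).symm) n
  simp only [connectingSucc, Iso.trans_hom, Iso.symm_hom, Category.assoc]
  rw [reassoc_of% h1, h2, reassoc_of% h3]

end

end LeftDerived

end

variable (F : A ⥤ B) [F.Additive] [HasProjectiveResolutions A]

open LeftDerived

/-- The first left derived functor of a right exact functor is its left satellite. -/
theorem exists_isLeftSatellite_zero [PreservesFiniteColimits F] :
    ∃ Δ, IsLeftSatellite F (F.leftDerived 1) Δ := by
  refine ⟨fun Z P X m p d => ∃ (hm : IsKer m p) (hp : IsCoker m p) (hP : Projective P),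
    d = connectingZero hm hp hP (projectiveResolution Z) F, ?_, ?_, ?_⟩
  · exact fun Z P X m p hm hp hP => ⟨_, hm, hp, hP, rfl⟩
  · rintro Z P X m p _ ⟨hm, hp, hP, rfl⟩
    exact isKer_connectingZero hm hp hP _ F
  · rintro Z P X Z' P' X' m p m' p' a b c _ _ ⟨hm, hp, hP, rfl⟩ ⟨hm', hp', hP', rfl⟩ hb hc
    exact connectingZero_naturality hm hp hP _ hm' hp' hP' _ F a b c hb hc

/-- The higher left derived functors are successive left satellites. -/
theorem exists_isLeftSatellite_succ (n : ℕ) :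
    ∃ Δ, IsLeftSatellite (F.leftDerived (n + 1)) (F.leftDerived (n + 2)) Δ := by
  refine ⟨fun Z P X m p d => ∃ (hm : IsKer m p) (hp : IsCoker m p) (hP : Projective P),
    d = (connectingSucc hm hp hP (projectiveResolution Z) F n).inv, ?_, ?_, ?_⟩
  · exact fun Z P X m p hm hp hP => ⟨_, hm, hp, hP, rfl⟩
  · rintro Z P X m p _ ⟨hm, hp, hP, rfl⟩
    exact IsKer.of_isZero _ _ (F.isZero_leftDerived_obj_projective_succ n P)
  · rintro Z P X Z' P' X' m p m' p' a b c _ _ ⟨hm, hp, hP, rfl⟩ ⟨hm', hp', hP', rfl⟩ hb hc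
    rw [Iso.inv_comp_eq, ← Category.assoc, Iso.eq_comp_inv]
    exact connectingSucc_naturality hm hp hP _ hm' hp' hP' _ F a b c hb hc n

end

/-! ### Comprehension in a superstructure -/

namespace Superstructure

variable {S : Type u}

/-- `a` occurs in the `n`-th stage. -/
def InLevel (n : ℕ) (a : Superstructure S) : Prop := ∃ x : Level S n, a = mk n x

theorem InLevel.mono {n m : ℕ} (h : n ≤ m) {a : Superstructure S} (ha : InLevel n a) :
    InLevel m a := by
  obtain ⟨x, rfl⟩ := ha
  exact ⟨Level.lift h x, (mk_lift h x).symm⟩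

theorem exists_inLevel_of_mem (A : Superstructure S) : ∃ n, ∀ a ∈ A, InLevel n a := by
  obtain ⟨n, x, rfl⟩ := exists_mk A
  refine ⟨n, fun a ha => ?_⟩
  obtain ⟨k, hk, y, rfl⟩ := mem_descend ha
  exact InLevel.mono hk.le ⟨y, rfl⟩

theorem InLevel.upair {n : ℕ} {a b : Superstructure S} (ha : InLevel n a) (hb : InLevel n b) :
    InLevel (n + 1) (upair a b) := by
  obtain ⟨x, rfl⟩ := ha
  obtain ⟨y, rfl⟩ := hb
  refine ⟨Level.set {x, y}, ext_of_isSet (isSet_upair _ _) (isSet_ofSet n {x, y}) fun z => ?_⟩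
  change _ ↔ z ∈ ofSet n {x, y}
  rw [mem_upair, mem_ofSet]
  simp

theorem InLevel.opair {n : ℕ} {a b : Superstructure S} (ha : InLevel n a) (hb : InLevel n b) :
    InLevel (n + 2) (opair a b) :=
  (ha.mono (Nat.le_succ n)).upair (ha.upair hb)

theorem exists_set_of_inLevel (n : ℕ) (p : Superstructure S → Prop) (hp : ∀ a, p a → InLevel n a) :
    ∃ A : Superstructure S, IsSet A ∧ ∀ a, a ∈ A ↔ p a := by
  refine ⟨ofSet n {x | p (mk n x)}, isSet_ofSet _ _, fun a => ?_⟩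
  rw [mem_ofSet]
  constructor
  · rintro ⟨x, hx, rfl⟩
    exact hx
  · intro h
    obtain ⟨x, rfl⟩ := hp a h
    exact ⟨x, h, rfl⟩

/-- A binary relation between the elements of two members of the superstructure is a member of
the superstructure. -/
theorem exists_relation (A B : Superstructure S) (r : Superstructure S → Superstructure S → Prop) :
    ∃ R : Superstructure S, IsSet R ∧ ∀ p, p ∈ R ↔ ∃ a ∈ A, ∃ b ∈ B, p = opair a b ∧ r a b := by
  obtain ⟨n, hn⟩ := exists_inLevel_of_mem A
  obtain ⟨m, hm⟩ := exists_inLevel_of_mem B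
  refine exists_set_of_inLevel (max n m + 2) _ ?_
  rintro _ ⟨a, ha, b, hb, rfl, -⟩
  exact ((hn a ha).mono (le_max_left _ _)).opair ((hm b hb).mono (le_max_right _ _))

/-- A ternary relation between the elements of three members of the superstructure is a member
of the superstructure. -/
theorem exists_relation₃ (A B C : Superstructure S)
    (r : Superstructure S → Superstructure S → Superstructure S → Prop) :
    ∃ R : Superstructure S, ∀ a ∈ A, ∀ b ∈ B, ∀ c ∈ C, triple a b c ∈ R ↔ r a b c := by
  obtain ⟨AB, -, hAB⟩ := exists_relation A B fun _ _ => True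
  obtain ⟨R, -, hR⟩ := exists_relation AB C fun p c => ∀ a b, p = opair a b → r a b c
  refine ⟨R, fun a ha b hb c hc => ?_⟩
  rw [triple, hR]
  constructor
  · rintro ⟨p, -, c', -, e, h⟩
    obtain ⟨rfl, rfl⟩ := opair_injective e
    exact h a b rfl
  · intro h
    refine ⟨_, (hAB _).2 ⟨a, ha, b, hb, rfl, trivial⟩, c, hc, rfl, ?_⟩
    intro a' b' e
    obtain ⟨rfl, rfl⟩ := opair_injective e
    exact h

end Superstructure

/-! ### Functors and relations on `Ŝ`-small categories -/

namespace SmallCat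

variable {S : Type u} {C D : SmallCat S}

theorem comp_val {X Y Z : C.Ob} (g : X ⟶ Y) (f : Y ⟶ Z) :
    (g ≫ f).1 = app C.c (opair f.1 g.1) :=
  (app_eq (comp_spec f g) fun _ hz => comp_unique hz (comp_spec f g)).symm

/-- The source of a morphism, as an object. -/
noncomputable def src (f : Superstructure S) (hf : f ∈ C.M) : C.Ob := ⟨app C.s f, f, hf, rfl⟩

/-- The target of a morphism, as an object. -/
noncomputable def tgt (f : Superstructure S) (hf : f ∈ C.M) : C.Ob :=
  ⟨app C.t f, app C.t f, C.isMap_t.app_mem hf, C.s_t f hf⟩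

/-- An element of the set of morphisms, as a morphism. -/
def homMk (f : Superstructure S) (hf : f ∈ C.M) : src f hf ⟶ tgt f hf := ⟨f, hf, rfl, rfl⟩

theorem obj_ext {X Y : C.Ob} (h : X.1 = Y.1) : X = Y := Subtype.ext h

theorem hom_ext {X Y : C.Ob} {f g : X ⟶ Y} (h : f.1 = g.1) : f = g := Subtype.ext h

theorem eqToHom_comp_comp_eqToHom_val {X X' Y Y' : C.Ob} (e : X = X') (e' : Y' = Y)
    (k : X' ⟶ Y') : (eqToHom e ≫ k ≫ eqToHom e').1 = k.1 := by
  subst e e'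
  simp

/-- Every functor between `Ŝ`-small categories is isomorphic to one whose graph is an element
of `Ŝ`: any set of pairs of morphisms is an element of `Ŝ`. -/
theorem exists_smallFunctor (G : C.Ob ⥤ D.Ob) :
    ∃ F : SmallFunctor C D, Nonempty (F.toFunctor ≅ G) := by
  obtain ⟨R, hR, hmem⟩ := exists_relation C.M D.M
    fun a b => ∃ ha : a ∈ C.M, b = (G.map (homMk a ha)).1
  have hpair : ∀ {X Y : C.Ob} (f : X ⟶ Y), opair f.1 (G.map f).1 ∈ R := by
    rintro ⟨X, hX⟩ ⟨Y, hY⟩ ⟨f, hf, e1, e2⟩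
    dsimp only at e1 e2
    subst e1 e2
    exact (hmem _).2 ⟨f, hf, _, (G.map _).2.1, rfl, hf, rfl⟩
  have happ : ∀ {X Y : C.Ob} (f : X ⟶ Y), app R f.1 = (G.map f).1 := by
    intro X Y f
    refine app_eq (hpair f) fun z hz => ?_
    obtain ⟨a, ha, b, hb, e, ha', hb'⟩ := (hmem _).1 hz
    obtain ⟨rfl, rfl⟩ := opair_injective e
    obtain ⟨a, b, h, -, e', ha', hb''⟩ := (hmem _).1 (hpair f)
    obtain ⟨rfl, h2⟩ := opair_injective e'
    rw [hb', h2, hb'']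
  have happ' : ∀ X : C.Ob, app R X.1 = (G.obj X).1 := fun X => by
    have := happ (𝟙 X)
    rwa [G.map_id] at this
  let F : SmallFunctor C D :=
    { graph := R
      isMap :=
        { isSet := hR
          exists_of_mem := fun p hp => by
            obtain ⟨a, ha, b, hb, e, -⟩ := (hmem p).1 hp
            exact ⟨a, ha, b, hb, e⟩
          existsUnique := fun x hx => by
            refine ⟨_, (G.map (homMk x hx)).2.1, hpair (homMk x hx), fun z _ hz => ?_⟩
            obtain ⟨a, ha, b, hb, e, ha', hb'⟩ := (hmem _).1 hz
            obtain ⟨rfl, rfl⟩ := opair_injective e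
            exact hb' }
      map_s := fun f hf => by
        have h1 := happ (homMk f hf)
        have h2 := happ' (src f hf)
        change app R f = _ at h1
        change app R (app C.s f) = _ at h2
        rw [h1, h2]
        exact ((G.map (homMk f hf)).2.2.1).symm
      map_t := fun f hf => by
        have h1 := happ (homMk f hf)
        have h2 := happ' (tgt f hf)
        change app R f = _ at h1
        change app R (app C.t f) = _ at h2
        rw [h1, h2]
        exact ((G.map (homMk f hf)).2.2.2).symm
      map_c := fun f hf g hg h hh hc => by
        obtain ⟨e1, e2, e3⟩ := C.of_comp f hf g hg h hh hc
        let g' : src g hg ⟶ src f hf := ⟨g, hg, rfl, e1.symm⟩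
        let f' := homMk f hf
        have e : h = (g' ≫ f').1 := comp_unique hc (comp_spec f' g')
        have h1 := happ f'
        have h2 := happ g'
        have h3 := happ (g' ≫ f')
        rw [← e] at h3
        change app R f = _ at h1
        change app R g = _ at h2
        rw [h1, h2, h3, G.map_comp]
        exact comp_spec _ _ }
  have hF : ∀ X, F.toFunctor.obj X = G.obj X := fun X => obj_ext (happ' X)
  refine ⟨F, ⟨eqToIso (CategoryTheory.Functor.ext hF fun X Y f => hom_ext ?_)⟩⟩
  rw [eqToHom_comp_comp_eqToHom_val]
  exact happ f

end SmallCat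

/-! ### Transferable predicates -/

/-- A term, regarded in a context with one more variable in front. -/
def STerm.shift {S : Type u} {n : ℕ} : STerm S n → STerm S (n + 1)
  | .const a => .const a
  | .var i => .var i.succ
  | .pair s t => .pair s.shift t.shift
  | .app s t => .app s.shift t.shift

theorem STerm.eval_shift {S : Type u} {n : ℕ} (t : STerm S n) (x : Superstructure S)
    (ρ : Fin n → Superstructure S) : t.shift.eval (Fin.cons x ρ) = t.eval ρ := by
  induction t with
  | const a => rfl
  | var i => rfl
  | pair s t hs ht => exact congrArg₂ _ hs ht
  | app s t hs ht => exact congrArg₂ _ hs ht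

theorem STerm.map_shift {S : Type u} {W : Type v} (star : Superstructure S → Superstructure W)
    {n : ℕ} (t : STerm S n) : t.shift.map star = (t.map star).shift := by
  induction t with
  | const a => rfl
  | var i => rfl
  | pair s t hs ht => exact congrArg₂ STerm.pair hs ht
  | app s t hs ht => exact congrArg₂ STerm.app hs ht

namespace Enlargement

variable {S : Type u} {W : Type v} (E : Enlargement S W)

/-- The families `τ` of elements of `Ŝ` and `τ'` of elements of `Ŵ`, over the contexts `e` and
`e'`, are the values of one term and of its enlargement. -/
def TransferTerm {n : ℕ} {Γ : Type u} {Γ' : Type v} (e : Γ → Fin n → Superstructure S)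
    (e' : Γ' → Fin n → Superstructure W) (τ : Γ → Superstructure S)
    (τ' : Γ' → Superstructure W) : Prop :=
  ∃ t : STerm S n, (∀ γ, t.eval (e γ) = τ γ) ∧ ∀ γ, (t.map E.star).eval (e' γ) = τ' γ

/-- The predicates `p` and `q`, over the contexts `e` and `e'`, are the interpretations of one
formula in `Ŝ` and of its enlargement in `Ŵ`. A context consists of a type of typed parameters
(objects, morphisms) and of the list of elements of the superstructure that underlie them. -/
def Transfers {n : ℕ} {Γ : Type u} {Γ' : Type v} (e : Γ → Fin n → Superstructure S)
    (e' : Γ' → Fin n → Superstructure W) (p : Γ → Prop) (q : Γ' → Prop) : Prop :=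
  ∃ φ : SFormula S n, (∀ γ, φ.Holds (e γ) ↔ p γ) ∧ ∀ γ, (φ.map E.star).Holds (e' γ) ↔ q γ

variable {E}

/-- The transfer principle for closed predicates. -/
theorem Transfers.iff {p q : Prop}
    (h : E.Transfers (fun _ : PUnit => Fin.elim0) (fun _ : PUnit => Fin.elim0)
      (fun _ => p) (fun _ => q)) : p ↔ q := by
  obtain ⟨φ, h1, h2⟩ := h
  exact (h1 ⟨⟩).symm.trans ((E.transfer φ).trans (h2 ⟨⟩))

/-- The context `e` extended by an object of `C`. -/
def consOb {n : ℕ} {Γ : Type u} (C : SmallCat S) (e : Γ → Fin n → Superstructure S) :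
    (Γ × C.Ob) → Fin (n + 1) → Superstructure S := fun x => Fin.cons x.2.1 (e x.1)

/-- The context `e` extended by a morphism. -/
def consHom {n : ℕ} {Γ : Type u} {C : SmallCat S} (e : Γ → Fin n → Superstructure S)
    (X Y : Γ → C.Ob) : (Σ γ : Γ, X γ ⟶ Y γ) → Fin (n + 1) → Superstructure S :=
  fun x => Fin.cons x.2.1 (e x.1)

section

variable {n : ℕ} {Γ : Type u} {Γ' : Type v} {e : Γ → Fin n → Superstructure S}
  {e' : Γ' → Fin n → Superstructure W}

theorem TransferTerm.var (i : Fin n) {τ : Γ → Superstructure S} {τ' : Γ' → Superstructure W}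
    (h : ∀ γ, e γ i = τ γ := by exact fun _ => rfl)
    (h' : ∀ γ, e' γ i = τ' γ := by exact fun _ => rfl) : E.TransferTerm e e' τ τ' :=
  ⟨.var i, h, h'⟩

theorem TransferTerm.const (a : Superstructure S) :
    E.TransferTerm e e' (fun _ => a) (fun _ => E.star a) :=
  ⟨.const a, fun _ => rfl, fun _ => rfl⟩

theorem TransferTerm.opair {σ τ : Γ → Superstructure S} {σ' τ' : Γ' → Superstructure W}
    (h₁ : E.TransferTerm e e' σ σ') (h₂ : E.TransferTerm e e' τ τ') :
    E.TransferTerm e e' (fun γ => opair (σ γ) (τ γ)) (fun γ => opair (σ' γ) (τ' γ)) := by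
  obtain ⟨s, hs, hs'⟩ := h₁
  obtain ⟨t, ht, ht'⟩ := h₂
  exact ⟨.pair s t, fun γ => congrArg₂ _ (hs γ) (ht γ), fun γ => congrArg₂ _ (hs' γ) (ht' γ)⟩

theorem TransferTerm.triple {ρ σ τ : Γ → Superstructure S} {ρ' σ' τ' : Γ' → Superstructure W}
    (h₀ : E.TransferTerm e e' ρ ρ') (h₁ : E.TransferTerm e e' σ σ')
    (h₂ : E.TransferTerm e e' τ τ') :
    E.TransferTerm e e' (fun γ => triple (ρ γ) (σ γ) (τ γ))
      (fun γ => triple (ρ' γ) (σ' γ) (τ' γ)) :=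
  (h₀.opair h₁).opair h₂

theorem TransferTerm.app {σ τ : Γ → Superstructure S} {σ' τ' : Γ' → Superstructure W}
    (h₁ : E.TransferTerm e e' σ σ') (h₂ : E.TransferTerm e e' τ τ') :
    E.TransferTerm e e' (fun γ => app (σ γ) (τ γ)) (fun γ => app (σ' γ) (τ' γ)) := by
  obtain ⟨s, hs, hs'⟩ := h₁
  obtain ⟨t, ht, ht'⟩ := h₂
  exact ⟨.app s t, fun γ => congrArg₂ _ (hs γ) (ht γ), fun γ => congrArg₂ _ (hs' γ) (ht' γ)⟩

theorem TransferTerm.id {C : SmallCat S} {X : Γ → C.Ob} {X' : Γ' → (E.starCat C).Ob}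
    (h : E.TransferTerm e e' (fun γ => (X γ).1) (fun γ => (X' γ).1)) :
    E.TransferTerm e e' (fun γ => (𝟙 (X γ) : X γ ⟶ X γ).1)
      (fun γ => (𝟙 (X' γ) : X' γ ⟶ X' γ).1) := h

/-- Composition is a term of the language: `f ∘ g = c(⟨f, g⟩)`. -/
theorem TransferTerm.comp {C : SmallCat S} {X Y Z : Γ → C.Ob} {f : ∀ γ, X γ ⟶ Y γ}
    {g : ∀ γ, Y γ ⟶ Z γ} {X' Y' Z' : Γ' → (E.starCat C).Ob} {f' : ∀ γ, X' γ ⟶ Y' γ}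
    {g' : ∀ γ, Y' γ ⟶ Z' γ}
    (h₁ : E.TransferTerm e e' (fun γ => (f γ).1) (fun γ => (f' γ).1))
    (h₂ : E.TransferTerm e e' (fun γ => (g γ).1) (fun γ => (g' γ).1)) :
    E.TransferTerm e e' (fun γ => (f γ ≫ g γ).1) (fun γ => (f' γ ≫ g' γ).1) := by
  simp only [SmallCat.comp_val]
  exact (TransferTerm.const C.c).app (h₂.opair h₁)

theorem TransferTerm.obj {C D : SmallCat S} (F : SmallFunctor C D) {X : Γ → C.Ob}
    {X' : Γ' → (E.starCat C).Ob}
    (h : E.TransferTerm e e' (fun γ => (X γ).1) (fun γ => (X' γ).1)) :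
    E.TransferTerm e e' (fun γ => (F.toFunctor.obj (X γ)).1)
      (fun γ => ((E.starFunctor F).toFunctor.obj (X' γ)).1) :=
  (TransferTerm.const F.graph).app h

theorem TransferTerm.map {C D : SmallCat S} (F : SmallFunctor C D) {X Y : Γ → C.Ob}
    {f : ∀ γ, X γ ⟶ Y γ} {X' Y' : Γ' → (E.starCat C).Ob} {f' : ∀ γ, X' γ ⟶ Y' γ}
    (h : E.TransferTerm e e' (fun γ => (f γ).1) (fun γ => (f' γ).1)) :
    E.TransferTerm e e' (fun γ => (F.toFunctor.map (f γ)).1)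
      (fun γ => ((E.starFunctor F).toFunctor.map (f' γ)).1) :=
  (TransferTerm.const F.graph).app h

variable {p q : Γ → Prop} {p' q' : Γ' → Prop}

theorem Transfers.mem {σ τ : Γ → Superstructure S} {σ' τ' : Γ' → Superstructure W}
    (h₁ : E.TransferTerm e e' σ σ') (h₂ : E.TransferTerm e e' τ τ') :
    E.Transfers e e' (fun γ => σ γ ∈ τ γ) (fun γ => σ' γ ∈ τ' γ) := by
  obtain ⟨s, hs, hs'⟩ := h₁
  obtain ⟨t, ht, ht'⟩ := h₂
  exact ⟨.mem s t, fun γ => by simp only [SFormula.Holds, hs, ht],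
    fun γ => by simp only [SFormula.map, SFormula.Holds, hs', ht']⟩

theorem Transfers.eq {σ τ : Γ → Superstructure S} {σ' τ' : Γ' → Superstructure W}
    (h₁ : E.TransferTerm e e' σ σ') (h₂ : E.TransferTerm e e' τ τ') :
    E.Transfers e e' (fun γ => σ γ = τ γ) (fun γ => σ' γ = τ' γ) := by
  obtain ⟨s, hs, hs'⟩ := h₁
  obtain ⟨t, ht, ht'⟩ := h₂
  exact ⟨.eq s t, fun γ => by simp only [SFormula.Holds, hs, ht],
    fun γ => by simp only [SFormula.map, SFormula.Holds, hs', ht']⟩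

theorem Transfers.eqHom {C : SmallCat S} {X Y : Γ → C.Ob} {f g : ∀ γ, X γ ⟶ Y γ}
    {X' Y' : Γ' → (E.starCat C).Ob} {f' g' : ∀ γ, X' γ ⟶ Y' γ}
    (h₁ : E.TransferTerm e e' (fun γ => (f γ).1) (fun γ => (f' γ).1))
    (h₂ : E.TransferTerm e e' (fun γ => (g γ).1) (fun γ => (g' γ).1)) :
    E.Transfers e e' (fun γ => f γ = g γ) (fun γ => f' γ = g' γ) := by
  obtain ⟨φ, h, h'⟩ := Transfers.eq h₁ h₂
  exact ⟨φ, fun γ => (h γ).trans Subtype.ext_iff.symm, fun γ => (h' γ).trans Subtype.ext_iff.symm⟩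

theorem Transfers.not (h : E.Transfers e e' p p') :
    E.Transfers e e' (fun γ => ¬ p γ) (fun γ => ¬ p' γ) := by
  obtain ⟨φ, h, h'⟩ := h
  exact ⟨.neg φ, fun γ => not_congr (h γ), fun γ => not_congr (h' γ)⟩

theorem Transfers.and (h₁ : E.Transfers e e' p p') (h₂ : E.Transfers e e' q q') :
    E.Transfers e e' (fun γ => p γ ∧ q γ) (fun γ => p' γ ∧ q' γ) := by
  obtain ⟨φ, h, h'⟩ := h₁
  obtain ⟨ψ, k, k'⟩ := h₂
  exact ⟨.and φ ψ, fun γ => and_congr (h γ) (k γ), fun γ => and_congr (h' γ) (k' γ)⟩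

theorem Transfers.congr {r : Γ → Prop} {r' : Γ' → Prop} (h : E.Transfers e e' p p')
    (h₁ : ∀ γ, p γ ↔ r γ) (h₂ : ∀ γ, p' γ ↔ r' γ) : E.Transfers e e' r r' := by
  obtain ⟨φ, h, h'⟩ := h
  exact ⟨φ, fun γ => (h γ).trans (h₁ γ), fun γ => (h' γ).trans (h₂ γ)⟩

theorem Transfers.imp (h₁ : E.Transfers e e' p p') (h₂ : E.Transfers e e' q q') :
    E.Transfers e e' (fun γ => p γ → q γ) (fun γ => p' γ → q' γ) :=
  (h₁.and h₂.not).not.congr (fun _ => by tauto) (fun _ => by tauto)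

theorem Transfers.allOb {C : SmallCat S} {p : Γ → C.Ob → Prop} {p' : Γ' → (E.starCat C).Ob → Prop}
    (h : E.Transfers (consOb C e) (consOb (E.starCat C) e') (fun x => p x.1 x.2)
      (fun x => p' x.1 x.2)) :
    E.Transfers e e' (fun γ => ∀ X : C.Ob, p γ X) (fun γ => ∀ X : (E.starCat C).Ob, p' γ X) := by
  obtain ⟨φ, h, h'⟩ := h
  refine ⟨.all (.const C.M) (.imp (.eq (.app (.const C.s) (.var 0)) (.var 0)) φ),
    fun γ => ?_, fun γ => ?_⟩
  · simp only [SFormula.Holds, SFormula.holds_imp]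
    exact ⟨fun H X => (h (γ, X)).1 (H X.1 X.mem X.s_eq),
      fun H x hx hs => (h (γ, ⟨x, x, hx, hs⟩)).2 (H _)⟩
  · simp only [SFormula.map, SFormula.map_imp, SFormula.Holds, SFormula.holds_imp]
    exact ⟨fun H X => (h' (γ, X)).1 (H X.1 X.mem X.s_eq),
      fun H x hx hs => (h' (γ, ⟨x, x, hx, hs⟩)).2 (H _)⟩

theorem Transfers.exOb {C : SmallCat S} {p : Γ → C.Ob → Prop} {p' : Γ' → (E.starCat C).Ob → Prop}
    (h : E.Transfers (consOb C e) (consOb (E.starCat C) e') (fun x => p x.1 x.2)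
      (fun x => p' x.1 x.2)) :
    E.Transfers e e' (fun γ => ∃ X : C.Ob, p γ X) (fun γ => ∃ X : (E.starCat C).Ob, p' γ X) :=
  (Transfers.allOb (p := fun γ X => ¬ p γ X) (p' := fun γ X => ¬ p' γ X) h.not).not.congr
    (fun _ => by simp) (fun _ => by simp)

theorem Transfers.allHom {C : SmallCat S} {X Y : Γ → C.Ob} {X' Y' : Γ' → (E.starCat C).Ob}
    {p : ∀ γ, (X γ ⟶ Y γ) → Prop} {p' : ∀ γ, (X' γ ⟶ Y' γ) → Prop}
    (hX : E.TransferTerm e e' (fun γ => (X γ).1) (fun γ => (X' γ).1))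
    (hY : E.TransferTerm e e' (fun γ => (Y γ).1) (fun γ => (Y' γ).1))
    (h : E.Transfers (consHom e X Y) (consHom e' X' Y') (fun x => p x.1 x.2)
      (fun x => p' x.1 x.2)) :
    E.Transfers e e' (fun γ => ∀ f : X γ ⟶ Y γ, p γ f) (fun γ => ∀ f : X' γ ⟶ Y' γ, p' γ f) := by
  obtain ⟨φ, h, h'⟩ := h
  obtain ⟨x, hx, hx'⟩ := hX
  obtain ⟨y, hy, hy'⟩ := hY
  refine ⟨.all (.const C.M) (.imp (.eq (.app (.const C.s) (.var 0)) x.shift)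
    (.imp (.eq (.app (.const C.t) (.var 0)) y.shift) φ)), fun γ => ?_, fun γ => ?_⟩
  · simp only [SFormula.Holds, SFormula.holds_imp, STerm.eval, STerm.eval_shift, hx, hy]
    exact ⟨fun H f => (h ⟨γ, f⟩).1 (H f.1 f.2.1 f.2.2.1 f.2.2.2),
      fun H f hf hs ht => (h ⟨γ, f, hf, hs, ht⟩).2 (H _)⟩
  · simp only [SFormula.map, SFormula.map_imp, SFormula.Holds, SFormula.holds_imp, STerm.eval,
      STerm.map_shift, STerm.eval_shift, hx', hy', STerm.map]
    exact ⟨fun H f => (h' ⟨γ, f⟩).1 (H f.1 f.2.1 f.2.2.1 f.2.2.2),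
      fun H f hf hs ht => (h' ⟨γ, f, hf, hs, ht⟩).2 (H _)⟩

theorem Transfers.exHom {C : SmallCat S} {X Y : Γ → C.Ob} {X' Y' : Γ' → (E.starCat C).Ob}
    {p : ∀ γ, (X γ ⟶ Y γ) → Prop} {p' : ∀ γ, (X' γ ⟶ Y' γ) → Prop}
    (hX : E.TransferTerm e e' (fun γ => (X γ).1) (fun γ => (X' γ).1))
    (hY : E.TransferTerm e e' (fun γ => (Y γ).1) (fun γ => (Y' γ).1))
    (h : E.Transfers (consHom e X Y) (consHom e' X' Y') (fun x => p x.1 x.2)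
      (fun x => p' x.1 x.2)) :
    E.Transfers e e' (fun γ => ∃ f : X γ ⟶ Y γ, p γ f) (fun γ => ∃ f : X' γ ⟶ Y' γ, p' γ f) :=
  (Transfers.allHom (p := fun γ f => ¬ p γ f) (p' := fun γ f => ¬ p' γ f) hX hY h.not).not.congr
    (fun _ => by simp) (fun _ => by simp)

end

end Enlargement

/-! ### Abelian categories in relational form -/

section

variable {S : Type u} (C : SmallCat S) (P : Superstructure S)

/-- `f` is a zero morphism for the addition with graph `P`: it satisfies `f + f = f`. -/
abbrev SmallCat.IsZero {C : SmallCat S} (P : Superstructure S) {X Y : C.Ob} (f : X ⟶ Y) : Prop :=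
  triple f.1 f.1 f.1 ∈ P

/-- `k` is a kernel of `f`, in the language of the superstructure. -/
abbrev SmallCat.IsKernel {C : SmallCat S} (P : Superstructure S) {K X Y : C.Ob} (k : K ⟶ X)
    (f : X ⟶ Y) : Prop :=
  SmallCat.IsZero P (k ≫ f) ∧ ∀ (T : C.Ob) (g : T ⟶ X), SmallCat.IsZero P (g ≫ f) →
    ∃ l : T ⟶ K, l ≫ k = g ∧ ∀ l' : T ⟶ K, l' ≫ k = g → l' = l

/-- `c` is a cokernel of `f`, in the language of the superstructure. -/
abbrev SmallCat.IsCokernel {C : SmallCat S} (P : Superstructure S) {X Y K : C.Ob} (f : X ⟶ Y)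
    (c : Y ⟶ K) : Prop :=
  SmallCat.IsZero P (f ≫ c) ∧ ∀ (T : C.Ob) (g : Y ⟶ T), SmallCat.IsZero P (f ≫ g) →
    ∃ l : K ⟶ T, c ≫ l = g ∧ ∀ l' : K ⟶ T, c ≫ l' = g → l' = l

/-- `f` is a monomorphism. -/
abbrev SmallCat.IsMono {C : SmallCat S} {X Y : C.Ob} (f : X ⟶ Y) : Prop :=
  ∀ (T : C.Ob) (g h : T ⟶ X), g ≫ f = h ≫ f → g = h

/-- `f` is an epimorphism. -/
abbrev SmallCat.IsEpi {C : SmallCat S} {X Y : C.Ob} (f : X ⟶ Y) : Prop :=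
  ∀ (T : C.Ob) (g h : Y ⟶ T), f ≫ g = f ≫ h → g = h

/-- The axioms of an abelian category, where the addition is given by its graph. -/
structure SmallCat.AbelianAxioms : Prop where
  add_exists : ∀ (X Y : C.Ob) (f g : X ⟶ Y), ∃ h : X ⟶ Y, triple f.1 g.1 h.1 ∈ P
  add_unique : ∀ (X Y : C.Ob) (f g h h' : X ⟶ Y), triple f.1 g.1 h.1 ∈ P →
    triple f.1 g.1 h'.1 ∈ P → h = h'
  add_comm : ∀ (X Y : C.Ob) (f g h : X ⟶ Y), triple f.1 g.1 h.1 ∈ P → triple g.1 f.1 h.1 ∈ P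
  add_assoc : ∀ (X Y : C.Ob) (f g h a b c : X ⟶ Y), triple f.1 g.1 a.1 ∈ P →
    triple a.1 h.1 b.1 ∈ P → triple g.1 h.1 c.1 ∈ P → triple f.1 c.1 b.1 ∈ P
  zero_neg : ∀ X Y : C.Ob, ∃ z : X ⟶ Y, (∀ f : X ⟶ Y, triple z.1 f.1 f.1 ∈ P) ∧
    ∀ f : X ⟶ Y, ∃ g : X ⟶ Y, triple g.1 f.1 z.1 ∈ P
  comp_add : ∀ (X Y Z : C.Ob) (k : X ⟶ Y) (f g h : Y ⟶ Z), triple f.1 g.1 h.1 ∈ P →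
    triple (k ≫ f).1 (k ≫ g).1 (k ≫ h).1 ∈ P
  add_comp : ∀ (X Y Z : C.Ob) (f g h : X ⟶ Y) (k : Y ⟶ Z), triple f.1 g.1 h.1 ∈ P →
    triple (f ≫ k).1 (g ≫ k).1 (h ≫ k).1 ∈ P
  terminal : ∃ Z : C.Ob, ∀ X : C.Ob, ∃ f : X ⟶ Z, ∀ g : X ⟶ Z, g = f
  prod : ∀ X Y : C.Ob, ∃ (B : C.Ob) (p : B ⟶ X) (q : B ⟶ Y), ∀ (T : C.Ob) (f : T ⟶ X)
    (g : T ⟶ Y), ∃ l : T ⟶ B, (l ≫ p = f ∧ l ≫ q = g) ∧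
      ∀ l' : T ⟶ B, l' ≫ p = f → l' ≫ q = g → l' = l
  kernel : ∀ (X Y : C.Ob) (f : X ⟶ Y), ∃ (K : C.Ob) (k : K ⟶ X), SmallCat.IsKernel P k f
  cokernel : ∀ (X Y : C.Ob) (f : X ⟶ Y), ∃ (K : C.Ob) (c : Y ⟶ K), SmallCat.IsCokernel P f c
  normalMono : ∀ (X Y : C.Ob) (f : X ⟶ Y), SmallCat.IsMono f →
    ∃ (Z : C.Ob) (g : Y ⟶ Z), SmallCat.IsKernel P f g
  normalEpi : ∀ (X Y : C.Ob) (f : X ⟶ Y), SmallCat.IsEpi f →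
    ∃ (Z : C.Ob) (g : Z ⟶ X), SmallCat.IsCokernel P g f

end

/-- Transfer of the axioms of an abelian category. As in the other transfer statements below, the
formula expressing a predicate is found by following its syntax; a variable is looked up in the
context by its de Bruijn index. -/
theorem Enlargement.starCat_abelianAxioms {S : Type u} {W : Type v} (E : Enlargement S W)
    {C : SmallCat S} {P : Superstructure S} (h : C.AbelianAxioms P) :
    (E.starCat C).AbelianAxioms (E.star P) := by
  obtain ⟨h1, h2, h3, h4, h5, h6, h7, h8, h9, h10, h11, h12, h13⟩ := h
  refine ⟨(Transfers.iff (E := E) ?_).1 h1, (Transfers.iff (E := E) ?_).1 h2,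
    (Transfers.iff (E := E) ?_).1 h3, (Transfers.iff (E := E) ?_).1 h4,
    (Transfers.iff (E := E) ?_).1 h5, (Transfers.iff (E := E) ?_).1 h6,
    (Transfers.iff (E := E) ?_).1 h7, (Transfers.iff (E := E) ?_).1 h8,
    (Transfers.iff (E := E) ?_).1 h9, (Transfers.iff (E := E) ?_).1 h10,
    (Transfers.iff (E := E) ?_).1 h11, (Transfers.iff (E := E) ?_).1 h12,
    (Transfers.iff (E := E) ?_).1 h13⟩ <;>
    repeat' first
      | with_reducible first
        | apply Transfers.mem | apply Transfers.eqHom | apply Transfers.allOb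
        | apply Transfers.exOb | apply Transfers.allHom | apply Transfers.exHom
        | apply Transfers.imp | apply Transfers.and | apply TransferTerm.triple
        | apply TransferTerm.opair | apply TransferTerm.comp | apply TransferTerm.id
        | apply TransferTerm.map | apply TransferTerm.obj | exact TransferTerm.const _
      | exact TransferTerm.var 0 | exact TransferTerm.var 1 | exact TransferTerm.var 2
      | exact TransferTerm.var 3 | exact TransferTerm.var 4 | exact TransferTerm.var 5
      | exact TransferTerm.var 6 | exact TransferTerm.var 7

/-! ### The enlargement of an abelian category is abelian -/

namespace SmallCat

variable {S : Type u} {C : SmallCat S} {P : Superstructure S}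

theorem isMono_iff {X Y : C.Ob} (f : X ⟶ Y) : IsMono f ↔ Mono f :=
  ⟨fun h => ⟨fun g k e => h _ g k e⟩, fun _ _ _ _ e => (cancel_mono f).1 e⟩

theorem isEpi_iff {X Y : C.Ob} (f : X ⟶ Y) : IsEpi f ↔ Epi f :=
  ⟨fun h => ⟨fun g k e => h _ g k e⟩, fun _ _ _ _ e => (cancel_epi f).1 e⟩

section

variable [Preadditive C.Ob]
  (hP : ∀ (X Y : C.Ob) (f g h : X ⟶ Y), triple f.1 g.1 h.1 ∈ P ↔ f + g = h)

include hP

theorem isZero_iff {X Y : C.Ob} (f : X ⟶ Y) : IsZero P f ↔ f = 0 := by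
  rw [IsZero, hP, add_eq_left]

theorem isKernel_iff {K X Y : C.Ob} (k : K ⟶ X) (f : X ⟶ Y) :
    IsKernel P k f ↔ IsKer k f := by
  constructor
  · rintro ⟨w, h⟩
    rw [isZero_iff hP] at w
    simp only [isZero_iff hP] at h
    choose l hl hu using h
    exact ⟨w, ⟨KernelFork.IsLimit.ofι k w (fun g hg => l _ g hg) (fun g hg => hl _ g hg)
      fun g hg m hm => hu _ g hg m hm⟩⟩
  · rintro ⟨w, ⟨h⟩⟩
    refine ⟨(isZero_iff hP _).2 w, fun T g hg => ?_⟩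
    obtain ⟨l, hl⟩ := KernelFork.IsLimit.lift' h g ((isZero_iff hP _).1 hg)
    exact ⟨l, hl, fun l' hl' => Fork.IsLimit.hom_ext h (hl'.trans hl.symm)⟩

theorem isCokernel_iff {X Y K : C.Ob} (f : X ⟶ Y) (c : Y ⟶ K) :
    IsCokernel P f c ↔ IsCoker f c := by
  constructor
  · rintro ⟨w, h⟩
    rw [isZero_iff hP] at w
    simp only [isZero_iff hP] at h
    choose l hl hu using h
    exact ⟨w, ⟨CokernelCofork.IsColimit.ofπ c w (fun g hg => l _ g hg) (fun g hg => hl _ g hg)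
      fun g hg m hm => hu _ g hg m hm⟩⟩
  · rintro ⟨w, ⟨h⟩⟩
    refine ⟨(isZero_iff hP _).2 w, fun T g hg => ?_⟩
    obtain ⟨l, hl⟩ := CokernelCofork.IsColimit.desc' h g ((isZero_iff hP _).1 hg)
    exact ⟨l, hl, fun l' hl' => Cofork.IsColimit.hom_ext h (hl'.trans hl.symm)⟩

end

/-- The preadditive structure whose addition has the graph `P`. -/
@[reducible]
noncomputable def AbelianAxioms.preadditive (h : C.AbelianAxioms P) : Preadditive C.Ob where
  homGroup X Y :=
    letI : Zero (X ⟶ Y) := ⟨(h.zero_neg X Y).choose⟩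
    letI : Neg (X ⟶ Y) := ⟨fun f => ((h.zero_neg X Y).choose_spec.2 f).choose⟩
    letI : Add (X ⟶ Y) := ⟨fun f g => (h.add_exists X Y f g).choose⟩
    have hadd : ∀ f g k : X ⟶ Y, triple f.1 g.1 k.1 ∈ P ↔ f + g = k := fun f g _ =>
      ⟨fun e => h.add_unique X Y f g _ _ (h.add_exists X Y f g).choose_spec e,
        fun e => e ▸ (h.add_exists X Y f g).choose_spec⟩
    { AddGroup.ofLeftAxioms
        (fun f g k => ((hadd _ _ _).1 (h.add_assoc X Y f g k _ _ _ ((hadd _ _ _).2 rfl)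
          ((hadd _ _ _).2 rfl) ((hadd _ _ _).2 rfl))).symm)
        (fun f => (hadd _ _ _).1 ((h.zero_neg X Y).choose_spec.1 f))
        (fun f => (hadd _ _ _).1 ((h.zero_neg X Y).choose_spec.2 f).choose_spec) with
      add_comm := fun f g => ((hadd _ _ _).1 (h.add_comm X Y f g _ ((hadd _ _ _).2 rfl))).symm }
  add_comp X Y Z f g k :=
    (h.add_unique X Z _ _ _ _ (h.add_exists X Z (f ≫ k) (g ≫ k)).choose_spec
      (h.add_comp X Y Z f g _ k (h.add_exists X Y f g).choose_spec)).symm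
  comp_add X Y Z k f g :=
    (h.add_unique X Z _ _ _ _ (h.add_exists X Z (k ≫ f) (k ≫ g)).choose_spec
      (h.comp_add X Y Z k f g _ (h.add_exists Y Z f g).choose_spec)).symm

theorem AbelianAxioms.add_iff (h : C.AbelianAxioms P) (X Y : C.Ob) (f g k : X ⟶ Y) :
    triple f.1 g.1 k.1 ∈ P ↔ letI := h.preadditive; f + g = k :=
  ⟨fun e => h.add_unique X Y f g _ _ (h.add_exists X Y f g).choose_spec e,
    fun e => e ▸ (h.add_exists X Y f g).choose_spec⟩

/-- A category satisfying the axioms is abelian, for an addition with the graph `P`. -/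
theorem AbelianAxioms.exists_abelian (h : C.AbelianAxioms P) : ∃ _ : Abelian C.Ob,
    ∀ (X Y : C.Ob) (f g k : X ⟶ Y), triple f.1 g.1 k.1 ∈ P ↔ f + g = k := by
  let _ := h.preadditive
  have hP := h.add_iff
  have : HasTerminal C.Ob := by
    obtain ⟨Z, hZ⟩ := h.terminal
    choose f hf using hZ
    exact (IsTerminal.ofUniqueHom (Y := Z) f hf).hasTerminal
  have : HasBinaryProducts C.Ob := by
    have : ∀ X Y : C.Ob, HasLimit (pair X Y) := fun X Y => by
      obtain ⟨B, p, q, hB⟩ := h.prod X Y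
      choose l hl hu using hB
      exact ⟨⟨⟨BinaryFan.mk p q, BinaryFan.isLimitMk (fun s => l _ s.fst s.snd)
        (fun s => (hl _ _ _).1) (fun s => (hl _ _ _).2) fun s m h1 h2 => hu _ _ _ m h1 h2⟩⟩⟩
    exact hasBinaryProducts_of_hasLimit_pair _
  have : HasFiniteProducts C.Ob := hasFiniteProducts_of_has_binary_and_terminal
  have : HasKernels C.Ob := ⟨fun {X Y} f => by
    obtain ⟨K, k, hk⟩ := h.kernel X Y f
    obtain ⟨w, ⟨hk⟩⟩ := (isKernel_iff hP k f).1 hk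
    exact ⟨⟨⟨_, hk⟩⟩⟩⟩
  have : HasCokernels C.Ob := ⟨fun {X Y} f => by
    obtain ⟨K, k, hk⟩ := h.cokernel X Y f
    obtain ⟨w, ⟨hk⟩⟩ := (isCokernel_iff hP f k).1 hk
    exact ⟨⟨⟨_, hk⟩⟩⟩⟩
  have : IsNormalMonoCategory C.Ob := ⟨fun {X Y} f hf => by
    obtain ⟨Z, g, hg⟩ := h.normalMono X Y f ((isMono_iff f).2 hf)
    obtain ⟨w, ⟨hk⟩⟩ := (isKernel_iff hP f g).1 hg
    exact ⟨⟨Z, g, w, hk⟩⟩⟩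
  have : IsNormalEpiCategory C.Ob := ⟨fun {X Y} f hf => by
    obtain ⟨Z, g, hg⟩ := h.normalEpi X Y f ((isEpi_iff f).2 hf)
    obtain ⟨w, ⟨hk⟩⟩ := (isCokernel_iff hP g f).1 hg
    exact ⟨⟨Z, g, w, hk⟩⟩⟩
  exact ⟨{}, hP⟩

/-- An abelian category whose addition has the graph `P` satisfies the axioms. -/
theorem AbelianAxioms.of_abelian [Abelian C.Ob]
    (hP : ∀ (X Y : C.Ob) (f g h : X ⟶ Y), triple f.1 g.1 h.1 ∈ P ↔ f + g = h) :
    C.AbelianAxioms P where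
  add_exists X Y f g := ⟨f + g, (hP _ _ _ _ _).2 rfl⟩
  add_unique X Y f g h h' e e' := ((hP _ _ _ _ _).1 e).symm.trans ((hP _ _ _ _ _).1 e')
  add_comm X Y f g h e := by
    rw [hP] at e ⊢
    rw [_root_.add_comm, e]
  add_assoc X Y f g h a b c e1 e2 e3 := by
    rw [hP] at e1 e2 e3 ⊢
    rw [← e3, ← _root_.add_assoc, e1, e2]
  zero_neg X Y := ⟨0, fun f => (hP _ _ _ _ _).2 (zero_add f),
    fun f => ⟨-f, (hP _ _ _ _ _).2 (neg_add_cancel f)⟩⟩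
  comp_add X Y Z k f g h e := by
    rw [hP] at e ⊢
    rw [← Preadditive.comp_add, e]
  add_comp X Y Z f g h k e := by
    rw [hP] at e ⊢
    rw [← Preadditive.add_comp, e]
  terminal := ⟨⊤_ C.Ob, fun X => ⟨terminal.from X, fun g => Subsingleton.elim _ _⟩⟩
  prod X Y := ⟨X ⨯ Y, prod.fst, prod.snd, fun T f g => ⟨prod.lift f g,
    ⟨prod.lift_fst f g, prod.lift_snd f g⟩, fun l h1 h2 => by
      ext
      · rw [h1, prod.lift_fst]
      · rw [h2, prod.lift_snd]⟩⟩
  kernel X Y f := ⟨Limits.kernel f, kernel.ι f,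
    (isKernel_iff hP _ _).2 ⟨kernel.condition f, ⟨kernelIsKernel f⟩⟩⟩
  cokernel X Y f := ⟨Limits.cokernel f, cokernel.π f,
    (isCokernel_iff hP _ _).2 ⟨cokernel.condition f, ⟨cokernelIsCokernel f⟩⟩⟩
  normalMono X Y f hf := by
    have := (isMono_iff f).1 hf
    let n := normalMonoOfMono f
    exact ⟨n.Z, n.g, (isKernel_iff hP _ _).2 ⟨n.w, ⟨n.isLimit⟩⟩⟩
  normalEpi X Y f hf := by
    have := (isEpi_iff f).1 hf
    let n := normalEpiOfEpi f
    exact ⟨n.W, n.g, (isCokernel_iff hP _ _).2 ⟨n.w, ⟨n.isColimit⟩⟩⟩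

end SmallCat

theorem SmallAbelianCat.add_iff {S : Type u} (A : SmallAbelianCat S) (X Y : A.toSmallCat.Ob)
    (f g h : X ⟶ Y) : triple f.1 g.1 h.1 ∈ A.P ↔ f + g = h :=
  A.isAbelian.abelian.choose_spec X Y f g h

/-- The enlargement of an abelian `Ŝ`-small category is abelian. -/
theorem Enlargement.starCat_isAbelian {S : Type u} {W : Type v} (E : Enlargement S W)
    (A : SmallAbelianCat S) : (E.starCat A.toSmallCat).IsAbelian (E.star A.P) where
  isSet := E.star_isSet A.isAbelian.isSet
  exists_of_mem := by
    have := (E.transfer (.all (.const A.P) (.ex (.const A.M) (.ex (.const A.M) (.ex (.const A.M)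
      (.eq (.var 3) (.pair (.pair (.var 2) (.var 1)) (.var 0)))))))).1 (by
        simp only [SFormula.Holds, SFormula.holds_ex]; exact A.isAbelian.exists_of_mem)
    simp only [SFormula.map, SFormula.map_ex, SFormula.Holds, SFormula.holds_ex] at this
    exact this
  abelian := (E.starCat_abelianAxioms (SmallCat.AbelianAxioms.of_abelian A.add_iff)).exists_abelian

/-! ### Injectives, projectives, functors and satellites in relational form -/

namespace SmallCat

variable {S : Type u} {C D : SmallCat S} (P Q : Superstructure S)

/-- `I` is injective. -/
abbrev IsInj (I : C.Ob) : Prop :=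
  ∀ (X Y : C.Ob) (f : X ⟶ Y) (g : X ⟶ I), IsMono f → ∃ h : Y ⟶ I, f ≫ h = g

/-- `I` is projective. -/
abbrev IsProj (I : C.Ob) : Prop :=
  ∀ (X Y : C.Ob) (f : X ⟶ Y) (g : I ⟶ Y), IsEpi f → ∃ h : I ⟶ X, h ≫ f = g

variable (C) in
/-- Every object has a monomorphism to an injective object. -/
abbrev HasEnoughInj : Prop := ∀ X : C.Ob, ∃ (I : C.Ob) (m : X ⟶ I), IsInj I ∧ IsMono m

variable (C) in
/-- Every object has an epimorphism from a projective object. -/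
abbrev HasEnoughProj : Prop := ∀ X : C.Ob, ∃ (I : C.Ob) (p : I ⟶ X), IsProj I ∧ IsEpi p

/-- `F` is compatible with the additions with graphs `P` and `Q`. -/
abbrev MapsAdd (F : SmallFunctor C D) : Prop :=
  ∀ (X Y : C.Ob) (f g h : X ⟶ Y), triple f.1 g.1 h.1 ∈ P →
    triple (F.toFunctor.map f).1 (F.toFunctor.map g).1 (F.toFunctor.map h).1 ∈ Q

/-- `F` maps kernels to kernels. -/
abbrev MapsKernels (F : SmallFunctor C D) : Prop :=
  ∀ (K X Y : C.Ob) (k : K ⟶ X) (f : X ⟶ Y), IsKernel P k f →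
    IsKernel Q (F.toFunctor.map k) (F.toFunctor.map f)

/-- `F` maps cokernels to cokernels. -/
abbrev MapsCokernels (F : SmallFunctor C D) : Prop :=
  ∀ (X Y K : C.Ob) (f : X ⟶ Y) (c : Y ⟶ K), IsCokernel P f c →
    IsCokernel Q (F.toFunctor.map f) (F.toFunctor.map c)

/-- The relation `η`, between objects `X` and morphisms `F X ⟶ G X`, is a natural isomorphism. -/
structure IsNatIso (F G : SmallFunctor C D) (η : Superstructure S) : Prop where
  exists_iso : ∀ X : C.Ob, ∃ (a : F.toFunctor.obj X ⟶ G.toFunctor.obj X)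
    (b : G.toFunctor.obj X ⟶ F.toFunctor.obj X), opair X.1 a.1 ∈ η ∧ a ≫ b = 𝟙 _ ∧ b ≫ a = 𝟙 _
  natural : ∀ (X Y : C.Ob) (f : X ⟶ Y) (a : F.toFunctor.obj X ⟶ G.toFunctor.obj X)
    (a' : F.toFunctor.obj Y ⟶ G.toFunctor.obj Y), opair X.1 a.1 ∈ η → opair Y.1 a'.1 ∈ η →
    F.toFunctor.map f ≫ a' = a ≫ G.toFunctor.map f

/-- `H` is the right satellite of `G`, with connecting morphisms given by the relation `Δ`. -/
structure RightSatelliteAxioms (G H : SmallFunctor C D) (Δ : Superstructure S) : Prop where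
  exists_connecting : ∀ (X I Z : C.Ob) (m : X ⟶ I) (p : I ⟶ Z), IsKernel P m p →
    IsCokernel P m p → IsInj I →
    ∃ d : G.toFunctor.obj Z ⟶ H.toFunctor.obj X, triple m.1 p.1 d.1 ∈ Δ
  isCokernel : ∀ (X I Z : C.Ob) (m : X ⟶ I) (p : I ⟶ Z)
    (d : G.toFunctor.obj Z ⟶ H.toFunctor.obj X), triple m.1 p.1 d.1 ∈ Δ →
    IsCokernel Q (G.toFunctor.map p) d
  natural : ∀ (X I Z X' I' Z' : C.Ob) (m : X ⟶ I) (p : I ⟶ Z) (m' : X' ⟶ I') (p' : I' ⟶ Z')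
    (a : X ⟶ X') (b : I ⟶ I') (c : Z ⟶ Z') (d : G.toFunctor.obj Z ⟶ H.toFunctor.obj X)
    (d' : G.toFunctor.obj Z' ⟶ H.toFunctor.obj X'),
    triple m.1 p.1 d.1 ∈ Δ → triple m'.1 p'.1 d'.1 ∈ Δ → m ≫ b = a ≫ m' → p ≫ c = b ≫ p' →
    G.toFunctor.map c ≫ d' = d ≫ H.toFunctor.map a

/-- `H` is the left satellite of `G`, with connecting morphisms given by the relation `Δ`. -/
structure LeftSatelliteAxioms (G H : SmallFunctor C D) (Δ : Superstructure S) : Prop where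
  exists_connecting : ∀ (Z I X : C.Ob) (m : Z ⟶ I) (p : I ⟶ X), IsKernel P m p →
    IsCokernel P m p → IsProj I →
    ∃ d : H.toFunctor.obj X ⟶ G.toFunctor.obj Z, triple m.1 p.1 d.1 ∈ Δ
  isKernel : ∀ (Z I X : C.Ob) (m : Z ⟶ I) (p : I ⟶ X)
    (d : H.toFunctor.obj X ⟶ G.toFunctor.obj Z), triple m.1 p.1 d.1 ∈ Δ →
    IsKernel Q d (G.toFunctor.map m)
  natural : ∀ (Z I X Z' I' X' : C.Ob) (m : Z ⟶ I) (p : I ⟶ X) (m' : Z' ⟶ I') (p' : I' ⟶ X')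
    (a : Z ⟶ Z') (b : I ⟶ I') (c : X ⟶ X') (d : H.toFunctor.obj X ⟶ G.toFunctor.obj Z)
    (d' : H.toFunctor.obj X' ⟶ G.toFunctor.obj Z'),
    triple m.1 p.1 d.1 ∈ Δ → triple m'.1 p'.1 d'.1 ∈ Δ → m ≫ b = a ≫ m' → p ≫ c = b ≫ p' →
    d ≫ G.toFunctor.map a = H.toFunctor.map c ≫ d'

end SmallCat

namespace Enlargement

variable {S : Type u} {W : Type v} (E : Enlargement S W) {C D : SmallCat S}
  {P Q : Superstructure S}

open SmallCat

variable (C) in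
theorem starCat_hasEnough_iff :
    (HasEnoughInj C ↔ HasEnoughInj (E.starCat C)) ∧
      (HasEnoughProj C ↔ HasEnoughProj (E.starCat C)) := by
  refine ⟨Transfers.iff (E := E) ?_, Transfers.iff (E := E) ?_⟩ <;>
    repeat' first
      | with_reducible first
        | apply Transfers.mem | apply Transfers.eqHom | apply Transfers.allOb
        | apply Transfers.exOb | apply Transfers.allHom | apply Transfers.exHom
        | apply Transfers.imp | apply Transfers.and | apply TransferTerm.triple
        | apply TransferTerm.opair | apply TransferTerm.comp | apply TransferTerm.id
        | apply TransferTerm.map | apply TransferTerm.obj | exact TransferTerm.const _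
      | exact TransferTerm.var 0 | exact TransferTerm.var 1 | exact TransferTerm.var 2
      | exact TransferTerm.var 3 | exact TransferTerm.var 4 | exact TransferTerm.var 5

variable (P Q) in
theorem starFunctor_exactness_iff (F : SmallFunctor C D) :
    (MapsAdd P Q F ↔ MapsAdd (E.star P) (E.star Q) (E.starFunctor F)) ∧
      (MapsKernels P Q F ↔ MapsKernels (E.star P) (E.star Q) (E.starFunctor F)) ∧
      (MapsCokernels P Q F ↔ MapsCokernels (E.star P) (E.star Q) (E.starFunctor F)) := by
  refine ⟨Transfers.iff (E := E) ?_, Transfers.iff (E := E) ?_, Transfers.iff (E := E) ?_⟩ <;>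
    repeat' first
      | with_reducible first
        | apply Transfers.mem | apply Transfers.eqHom | apply Transfers.allOb
        | apply Transfers.exOb | apply Transfers.allHom | apply Transfers.exHom
        | apply Transfers.imp | apply Transfers.and | apply TransferTerm.triple
        | apply TransferTerm.opair | apply TransferTerm.comp | apply TransferTerm.id
        | apply TransferTerm.map | apply TransferTerm.obj | exact TransferTerm.const _
      | exact TransferTerm.var 0 | exact TransferTerm.var 1 | exact TransferTerm.var 2
      | exact TransferTerm.var 3 | exact TransferTerm.var 4 | exact TransferTerm.var 5
      | exact TransferTerm.var 6 | exact TransferTerm.var 7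

theorem starFunctor_isNatIso {F G : SmallFunctor C D} {η : Superstructure S}
    (h : IsNatIso F G η) : IsNatIso (E.starFunctor F) (E.starFunctor G) (E.star η) := by
  obtain ⟨h1, h2⟩ := h
  refine ⟨(Transfers.iff (E := E) ?_).1 h1, (Transfers.iff (E := E) ?_).1 h2⟩ <;>
    repeat' first
      | with_reducible first
        | apply Transfers.mem | apply Transfers.eqHom | apply Transfers.allOb
        | apply Transfers.exOb | apply Transfers.allHom | apply Transfers.exHom
        | apply Transfers.imp | apply Transfers.and | apply TransferTerm.triple
        | apply TransferTerm.opair | apply TransferTerm.comp | apply TransferTerm.id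
        | apply TransferTerm.map | apply TransferTerm.obj | exact TransferTerm.const _
      | exact TransferTerm.var 0 | exact TransferTerm.var 1 | exact TransferTerm.var 2
      | exact TransferTerm.var 3 | exact TransferTerm.var 4

theorem starFunctor_rightSatelliteAxioms {G H : SmallFunctor C D} {Δ : Superstructure S}
    (h : RightSatelliteAxioms P Q G H Δ) :
    RightSatelliteAxioms (E.star P) (E.star Q) (E.starFunctor G) (E.starFunctor H)
      (E.star Δ) := by
  obtain ⟨h1, h2, h3⟩ := h
  refine ⟨(Transfers.iff (E := E) ?_).1 h1, (Transfers.iff (E := E) ?_).1 h2,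
    (Transfers.iff (E := E) ?_).1 h3⟩ <;>
    repeat' first
      | with_reducible first
        | apply Transfers.mem | apply Transfers.eqHom | apply Transfers.allOb
        | apply Transfers.exOb | apply Transfers.allHom | apply Transfers.exHom
        | apply Transfers.imp | apply Transfers.and | apply TransferTerm.triple
        | apply TransferTerm.opair | apply TransferTerm.comp | apply TransferTerm.id
        | apply TransferTerm.map | apply TransferTerm.obj | exact TransferTerm.const _
      | exact TransferTerm.var 0 | exact TransferTerm.var 1 | exact TransferTerm.var 2
      | exact TransferTerm.var 3 | exact TransferTerm.var 4 | exact TransferTerm.var 5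
      | exact TransferTerm.var 6 | exact TransferTerm.var 7 | exact TransferTerm.var 8
      | exact TransferTerm.var 9 | exact TransferTerm.var 10 | exact TransferTerm.var 11
      | exact TransferTerm.var 12

theorem starFunctor_leftSatelliteAxioms {G H : SmallFunctor C D} {Δ : Superstructure S}
    (h : LeftSatelliteAxioms P Q G H Δ) :
    LeftSatelliteAxioms (E.star P) (E.star Q) (E.starFunctor G) (E.starFunctor H)
      (E.star Δ) := by
  obtain ⟨h1, h2, h3⟩ := h
  refine ⟨(Transfers.iff (E := E) ?_).1 h1, (Transfers.iff (E := E) ?_).1 h2,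
    (Transfers.iff (E := E) ?_).1 h3⟩ <;>
    repeat' first
      | with_reducible first
        | apply Transfers.mem | apply Transfers.eqHom | apply Transfers.allOb
        | apply Transfers.exOb | apply Transfers.allHom | apply Transfers.exHom
        | apply Transfers.imp | apply Transfers.and | apply TransferTerm.triple
        | apply TransferTerm.opair | apply TransferTerm.comp | apply TransferTerm.id
        | apply TransferTerm.map | apply TransferTerm.obj | exact TransferTerm.const _
      | exact TransferTerm.var 0 | exact TransferTerm.var 1 | exact TransferTerm.var 2
      | exact TransferTerm.var 3 | exact TransferTerm.var 4 | exact TransferTerm.var 5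
      | exact TransferTerm.var 6 | exact TransferTerm.var 7 | exact TransferTerm.var 8
      | exact TransferTerm.var 9 | exact TransferTerm.var 10 | exact TransferTerm.var 11
      | exact TransferTerm.var 12

end Enlargement

/-! ### Comparison of the relational form with the categorical notions -/

namespace SmallCat

variable {S : Type u} {C D : SmallCat S} {P Q : Superstructure S}

theorem isInj_iff (I : C.Ob) : IsInj I ↔ Injective I :=
  ⟨fun h => ⟨fun g f _ => h _ _ f g ((isMono_iff f).2 inferInstance)⟩, fun _ _ _ f g hf => by
    have := (isMono_iff f).1 hf
    exact ⟨Injective.factorThru g f, Injective.comp_factorThru g f⟩⟩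

theorem isProj_iff (I : C.Ob) : IsProj I ↔ Projective I :=
  ⟨fun h => ⟨fun g f _ => h _ _ f g ((isEpi_iff f).2 inferInstance)⟩, fun _ _ _ f g hf => by
    have := (isEpi_iff f).1 hf
    exact ⟨Projective.factorThru g f, Projective.factorThru_comp g f⟩⟩

theorem hasEnoughInj_iff : HasEnoughInj C ↔ EnoughInjectives C.Ob := by
  constructor
  · refine fun h => ⟨fun X => ?_⟩
    obtain ⟨I, m, hI, hm⟩ := h X
    exact ⟨⟨I, (isInj_iff I).1 hI, m, (isMono_iff m).1 hm⟩⟩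
  · exact fun h X => ⟨Injective.under X, Injective.ι X, (isInj_iff _).2 inferInstance,
      (isMono_iff _).2 inferInstance⟩

theorem hasEnoughProj_iff : HasEnoughProj C ↔ EnoughProjectives C.Ob := by
  constructor
  · refine fun h => ⟨fun X => ?_⟩
    obtain ⟨I, p, hI, hp⟩ := h X
    exact ⟨{ p := I, projective := (isProj_iff I).1 hI, f := p, epi := (isEpi_iff p).1 hp }⟩
  · exact fun h X => ⟨Projective.over X, Projective.π X, (isProj_iff _).2 inferInstance,
      (isEpi_iff _).2 inferInstance⟩

/-- A natural isomorphism between functors whose graphs are elements of `Ŝ` is itself given by an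
element of `Ŝ`. -/
theorem exists_isNatIso {F G : SmallFunctor C D} (e : F.toFunctor ≅ G.toFunctor) :
    ∃ η, IsNatIso F G η := by
  obtain ⟨η, -, hη⟩ := exists_relation C.M D.M
    fun x a => ∃ X : C.Ob, x = X.1 ∧ a = (e.hom.app X).1
  have key : ∀ (X : C.Ob) (a : F.toFunctor.obj X ⟶ G.toFunctor.obj X),
      opair X.1 a.1 ∈ η ↔ a = e.hom.app X := by
    intro X a
    rw [hη]
    constructor
    · rintro ⟨x, -, b, -, e₁, X', rfl, rfl⟩
      obtain ⟨h1, h2⟩ := opair_injective e₁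
      obtain rfl := obj_ext h1
      exact hom_ext h2
    · rintro rfl
      exact ⟨_, X.mem, _, (e.hom.app X).2.1, rfl, X, rfl, rfl⟩
  refine ⟨η, fun X => ⟨e.hom.app X, e.inv.app X, (key X _).2 rfl, e.hom_inv_id_app X,
    e.inv_hom_id_app X⟩, fun X Y f a a' ha ha' => ?_⟩
  rw [(key X a).1 ha, (key Y a').1 ha']
  exact e.hom.naturality f

theorem IsNatIso.nonempty_iso {F G : SmallFunctor C D} {η : Superstructure S}
    (h : IsNatIso F G η) : Nonempty (F.toFunctor ≅ G.toFunctor) := by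
  choose a b ha h1 h2 using h.exists_iso
  exact ⟨NatIso.ofComponents (fun X => ⟨a X, b X, h1 X, h2 X⟩)
    fun f => h.natural _ _ f _ _ (ha _) (ha _)⟩

/-- A relation between pairs of composable morphisms of `C` and morphisms of `D` is given by an
element of `Ŝ`. -/
theorem exists_ternary {O : C.Ob → C.Ob → C.Ob → D.Ob} {O' : C.Ob → C.Ob → C.Ob → D.Ob}
    (Δ : ∀ ⦃X Y Z : C.Ob⦄, (X ⟶ Y) → (Y ⟶ Z) → (O X Y Z ⟶ O' X Y Z) → Prop) :
    ∃ R : Superstructure S, ∀ (X Y Z : C.Ob) (m : X ⟶ Y) (p : Y ⟶ Z) (d : O X Y Z ⟶ O' X Y Z),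
      triple m.1 p.1 d.1 ∈ R ↔ Δ m p d := by
  obtain ⟨R, hR⟩ := exists_relation₃ C.M C.M D.M fun a b c =>
    ∃ (X Y Z : C.Ob) (m : X ⟶ Y) (p : Y ⟶ Z) (d : O X Y Z ⟶ O' X Y Z),
      a = m.1 ∧ b = p.1 ∧ c = d.1 ∧ Δ m p d
  refine ⟨R, fun X Y Z m p d => ?_⟩
  rw [hR _ m.2.1 _ p.2.1 _ d.2.1]
  constructor
  · rintro ⟨X', Y', Z', m', p', d', hm, hp, hd, h⟩
    obtain rfl : X = X' := obj_ext (by rw [← m.2.2.1, ← m'.2.2.1, hm])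
    obtain rfl : Y = Y' := obj_ext (by rw [← m.2.2.2, ← m'.2.2.2, hm])
    obtain rfl : Z = Z' := obj_ext (by rw [← p.2.2.2, ← p'.2.2.2, hp])
    obtain rfl := hom_ext hm
    obtain rfl := hom_ext hp
    obtain rfl := hom_ext hd
    exact h
  · exact fun h => ⟨X, Y, Z, m, p, d, rfl, rfl, rfl, h⟩

section

variable [Preadditive C.Ob] [Preadditive D.Ob]
  (hP : ∀ (X Y : C.Ob) (f g h : X ⟶ Y), triple f.1 g.1 h.1 ∈ P ↔ f + g = h)
  (hQ : ∀ (X Y : D.Ob) (f g h : X ⟶ Y), triple f.1 g.1 h.1 ∈ Q ↔ f + g = h)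

include hP hQ

theorem mapsAdd_iff (F : SmallFunctor C D) : MapsAdd P Q F ↔ F.toFunctor.Additive := by
  simp only [MapsAdd, hP, hQ]
  exact ⟨fun h => ⟨fun {X Y f g} => (h X Y f g _ rfl).symm⟩,
    fun _ X Y f g h e => by rw [← e, F.toFunctor.map_add]⟩

theorem exists_rightSatelliteAxioms {G H : SmallFunctor C D} {Δ}
    (h : IsRightSatellite G.toFunctor H.toFunctor Δ) : ∃ R, RightSatelliteAxioms P Q G H R := by
  obtain ⟨R, hR⟩ := exists_ternary Δ
  refine ⟨R, ?_, ?_, ?_⟩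
  · simp only [hR, isKernel_iff hP, isCokernel_iff hP, isInj_iff]
    exact h.exists_connecting
  · simp only [hR, isCokernel_iff hQ]
    exact h.isCoker
  · simp only [hR]
    exact h.natural

theorem RightSatelliteAxioms.isRightSatellite {G H : SmallFunctor C D} {R : Superstructure S}
    (h : RightSatelliteAxioms P Q G H R) :
    IsRightSatellite G.toFunctor H.toFunctor fun _ _ _ m p d => triple m.1 p.1 d.1 ∈ R := by
  obtain ⟨h1, h2, h3⟩ := h
  simp only [isKernel_iff hP, isCokernel_iff hP, isCokernel_iff hQ, isInj_iff] at h1 h2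
  exact ⟨h1, h2, h3⟩

theorem exists_leftSatelliteAxioms {G H : SmallFunctor C D} {Δ}
    (h : IsLeftSatellite G.toFunctor H.toFunctor Δ) : ∃ R, LeftSatelliteAxioms P Q G H R := by
  obtain ⟨R, hR⟩ := exists_ternary Δ
  refine ⟨R, ?_, ?_, ?_⟩
  · simp only [hR, isKernel_iff hP, isCokernel_iff hP, isProj_iff]
    exact h.exists_connecting
  · simp only [hR, isKernel_iff hQ]
    exact h.isKer
  · simp only [hR]
    exact h.natural

theorem LeftSatelliteAxioms.isLeftSatellite {G H : SmallFunctor C D} {R : Superstructure S}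
    (h : LeftSatelliteAxioms P Q G H R) :
    IsLeftSatellite G.toFunctor H.toFunctor fun _ _ _ m p d => triple m.1 p.1 d.1 ∈ R := by
  obtain ⟨h1, h2, h3⟩ := h
  simp only [isKernel_iff hP, isCokernel_iff hP, isKernel_iff hQ, isProj_iff] at h1 h2
  exact ⟨h1, h2, h3⟩

end

section

variable [Abelian C.Ob] [Abelian D.Ob]
  (hP : ∀ (X Y : C.Ob) (f g h : X ⟶ Y), triple f.1 g.1 h.1 ∈ P ↔ f + g = h)
  (hQ : ∀ (X Y : D.Ob) (f g h : X ⟶ Y), triple f.1 g.1 h.1 ∈ Q ↔ f + g = h)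

include hP hQ

theorem mapsKernels_iff (F : SmallFunctor C D) [F.toFunctor.Additive] :
    MapsKernels P Q F ↔ PreservesFiniteLimits F.toFunctor := by
  simp only [MapsKernels, isKernel_iff hP, isKernel_iff hQ]
  constructor
  · intro h
    have : ∀ {X Y : C.Ob} (f : X ⟶ Y), PreservesLimit (parallelPair f 0) F.toFunctor :=
      fun {X Y} f => preservesLimit_of_preserves_limit_cone (kernelIsKernel f)
        ((KernelFork.isLimitMapConeEquiv _ F.toFunctor).2
          (h _ _ _ (kernel.ι f) f ⟨kernel.condition f, ⟨kernelIsKernel f⟩⟩).2.some)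
    exact Functor.preservesFiniteLimits_of_preservesKernels F.toFunctor
  · exact fun _ _ _ _ _ _ h => IsKer.map h F.toFunctor

theorem mapsCokernels_iff (F : SmallFunctor C D) [F.toFunctor.Additive] :
    MapsCokernels P Q F ↔ PreservesFiniteColimits F.toFunctor := by
  simp only [MapsCokernels, isCokernel_iff hP, isCokernel_iff hQ]
  constructor
  · intro h
    have : ∀ {X Y : C.Ob} (f : X ⟶ Y), PreservesColimit (parallelPair f 0) F.toFunctor :=
      fun {X Y} f => preservesColimit_of_preserves_colimit_cocone (cokernelIsCokernel f)
        ((CokernelCofork.isColimitMapCoconeEquiv _ F.toFunctor).2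
          (h _ _ _ f (cokernel.π f) ⟨cokernel.condition f, ⟨cokernelIsCokernel f⟩⟩).2.some)
    exact Functor.preservesFiniteColimits_of_preservesCokernels F.toFunctor
  · exact fun _ _ _ _ _ _ h => IsCoker.map h F.toFunctor

end

end SmallCat

/-! ### Derived functors and enlargements -/

namespace Enlargement

open SmallCat

variable {S : Type u} {W : Type v} (E : Enlargement S W)

/-- The square formed by `* : C ⥤ *C`, `* : D ⥤ *D`, `R` and `*R` commutes. -/
theorem toStar_comp_starFunctor {C D : SmallCat S} (R : SmallFunctor C D) :
    E.toStar C ⋙ (E.starFunctor R).toFunctor = R.toFunctor ⋙ E.toStar D := by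
  have hobj : ∀ X, (E.toStar C ⋙ (E.starFunctor R).toFunctor).obj X =
      (R.toFunctor ⋙ E.toStar D).obj X := fun X => obj_ext (E.star_app R.graph X.1).symm
  refine CategoryTheory.Functor.ext hobj fun X Y f => hom_ext ?_
  rw [eqToHom_comp_comp_eqToHom_val]
  exact (E.star_app R.graph f.1).symm

theorem starFunctor_nonempty_iso {C D : SmallCat S} {F G : SmallFunctor C D}
    (e : F.toFunctor ≅ G.toFunctor) :
    Nonempty ((E.starFunctor F).toFunctor ≅ (E.starFunctor G).toFunctor) := by
  obtain ⟨η, hη⟩ := exists_isNatIso e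
  exact (E.starFunctor_isNatIso hη).nonempty_iso

variable {A B : SmallAbelianCat S} (hA : (E.starCat A.toSmallCat).IsAbelian (E.star A.P))
  (hB : (E.starCat B.toSmallCat).IsAbelian (E.star B.P))

/-- The enlargement of a functor, as a functor between the enlargements of abelian categories. -/
def starAbelianFunctor (F : SmallFunctor A.toSmallCat B.toSmallCat) :
    SmallFunctor (E.starAbelian A hA).toSmallCat (E.starAbelian B hB).toSmallCat :=
  E.starFunctor F

theorem starAbelian_enoughInjectives [EnoughInjectives A.toSmallCat.Ob] :
    EnoughInjectives (E.starAbelian A hA).toSmallCat.Ob :=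
  hasEnoughInj_iff.1 ((E.starCat_hasEnough_iff A.toSmallCat).1.1 (hasEnoughInj_iff.2 inferInstance))

theorem starAbelian_enoughProjectives [EnoughProjectives A.toSmallCat.Ob] :
    EnoughProjectives (E.starAbelian A hA).toSmallCat.Ob :=
  hasEnoughProj_iff.1
    ((E.starCat_hasEnough_iff A.toSmallCat).2.1 (hasEnoughProj_iff.2 inferInstance))

variable (F : SmallFunctor A.toSmallCat B.toSmallCat)

theorem starAbelianFunctor_additive [F.toFunctor.Additive] :
    (E.starAbelianFunctor hA hB F).toFunctor.Additive :=
  (mapsAdd_iff (E.starAbelian A hA).add_iff (E.starAbelian B hB).add_iff _).1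
    ((E.starFunctor_exactness_iff A.P B.P F).1.1
      ((mapsAdd_iff A.add_iff B.add_iff F).2 inferInstance))

theorem starAbelianFunctor_preservesFiniteLimits [F.toFunctor.Additive]
    [PreservesFiniteLimits F.toFunctor] :
    PreservesFiniteLimits (E.starAbelianFunctor hA hB F).toFunctor :=
  have := E.starAbelianFunctor_additive hA hB F
  (mapsKernels_iff (E.starAbelian A hA).add_iff (E.starAbelian B hB).add_iff _).1
    ((E.starFunctor_exactness_iff A.P B.P F).2.1.1
      ((mapsKernels_iff A.add_iff B.add_iff F).2 inferInstance))

theorem starAbelianFunctor_preservesFiniteColimits [F.toFunctor.Additive]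
    [PreservesFiniteColimits F.toFunctor] :
    PreservesFiniteColimits (E.starAbelianFunctor hA hB F).toFunctor :=
  have := E.starAbelianFunctor_additive hA hB F
  (mapsCokernels_iff (E.starAbelian A hA).add_iff (E.starAbelian B hB).add_iff _).1
    ((E.starFunctor_exactness_iff A.P B.P F).2.2.1
      ((mapsCokernels_iff A.add_iff B.add_iff F).2 inferInstance))

/-- The enlargement of the right satellite is the right satellite of the enlargement. -/
theorem starAbelianFunctor_isRightSatellite {G H : SmallFunctor A.toSmallCat B.toSmallCat} {Δ}
    (h : IsRightSatellite G.toFunctor H.toFunctor Δ) :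
    ∃ Δ', IsRightSatellite (E.starAbelianFunctor hA hB G).toFunctor
      (E.starAbelianFunctor hA hB H).toFunctor Δ' := by
  obtain ⟨R, hR⟩ := exists_rightSatelliteAxioms A.add_iff B.add_iff h
  exact ⟨_, RightSatelliteAxioms.isRightSatellite (E.starAbelian A hA).add_iff
    (E.starAbelian B hB).add_iff (E.starFunctor_rightSatelliteAxioms hR)⟩

/-- The enlargement of the left satellite is the left satellite of the enlargement. -/
theorem starAbelianFunctor_isLeftSatellite {G H : SmallFunctor A.toSmallCat B.toSmallCat} {Δ}
    (h : IsLeftSatellite G.toFunctor H.toFunctor Δ) :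
    ∃ Δ', IsLeftSatellite (E.starAbelianFunctor hA hB G).toFunctor
      (E.starAbelianFunctor hA hB H).toFunctor Δ' := by
  obtain ⟨R, hR⟩ := exists_leftSatelliteAxioms A.add_iff B.add_iff h
  exact ⟨_, LeftSatelliteAxioms.isLeftSatellite (E.starAbelian A hA).add_iff
    (E.starAbelian B hB).add_iff (E.starFunctor_leftSatelliteAxioms hR)⟩

/-- If `R ≅ RⁱF`, then `*R ≅ Rⁱ(*F)`. Both families start, up to isomorphism, with `*F`, and in
both each member is the right satellite of its predecessor. -/
theorem nonempty_iso_rightDerived [EnoughInjectives A.toSmallCat.Ob] [F.toFunctor.Additive]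
    [PreservesFiniteLimits F.toFunctor] [EnoughInjectives (E.starAbelian A hA).toSmallCat.Ob]
    [(E.starAbelianFunctor hA hB F).toFunctor.Additive]
    [PreservesFiniteLimits (E.starAbelianFunctor hA hB F).toFunctor] (i : ℕ)
    (R : SmallFunctor A.toSmallCat B.toSmallCat)
    (e : R.toFunctor ≅ F.toFunctor.rightDerived i) :
    Nonempty ((E.starAbelianFunctor hA hB R).toFunctor ≅
      (E.starAbelianFunctor hA hB F).toFunctor.rightDerived i) := by
  induction i generalizing R with
  | zero =>
    obtain ⟨e'⟩ := E.starFunctor_nonempty_iso (e ≪≫ F.toFunctor.rightDerivedZeroIsoSelf)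
    exact ⟨(show (E.starAbelianFunctor hA hB R).toFunctor ≅
      (E.starAbelianFunctor hA hB F).toFunctor from e') ≪≫
      (E.starAbelianFunctor hA hB F).toFunctor.rightDerivedZeroIsoSelf.symm⟩
  | succ i ih =>
    cases i with
    | zero =>
      obtain ⟨Δ, hΔ⟩ := exists_isRightSatellite_zero F.toFunctor
      obtain ⟨Δ', hΔ'⟩ := E.starAbelianFunctor_isRightSatellite hA hB (hΔ.of_iso (Iso.refl _) e)
      obtain ⟨Δ'', hΔ''⟩ := exists_isRightSatellite_zero (E.starAbelianFunctor hA hB F).toFunctor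
      exact hΔ'.nonempty_iso hΔ'' (Iso.refl _)
    | succ n =>
      obtain ⟨R', ⟨e'⟩⟩ := exists_smallFunctor (F.toFunctor.rightDerived (n + 1))
      obtain ⟨e''⟩ := ih R' e'
      obtain ⟨Δ, hΔ⟩ := exists_isRightSatellite_succ F.toFunctor n
      obtain ⟨Δ', hΔ'⟩ := E.starAbelianFunctor_isRightSatellite hA hB (hΔ.of_iso e' e)
      obtain ⟨Δ'', hΔ''⟩ := exists_isRightSatellite_succ (E.starAbelianFunctor hA hB F).toFunctor n
      exact hΔ'.nonempty_iso hΔ'' e''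

/-- If `L ≅ LᵢF`, then `*L ≅ Lᵢ(*F)`. Both families start, up to isomorphism, with `*F`, and in
both each member is the left satellite of its predecessor. -/
theorem nonempty_iso_leftDerived [EnoughProjectives A.toSmallCat.Ob] [F.toFunctor.Additive]
    [PreservesFiniteColimits F.toFunctor] [EnoughProjectives (E.starAbelian A hA).toSmallCat.Ob]
    [(E.starAbelianFunctor hA hB F).toFunctor.Additive]
    [PreservesFiniteColimits (E.starAbelianFunctor hA hB F).toFunctor] (i : ℕ)
    (L : SmallFunctor A.toSmallCat B.toSmallCat)
    (e : L.toFunctor ≅ F.toFunctor.leftDerived i) :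
    Nonempty ((E.starAbelianFunctor hA hB L).toFunctor ≅
      (E.starAbelianFunctor hA hB F).toFunctor.leftDerived i) := by
  induction i generalizing L with
  | zero =>
    obtain ⟨e'⟩ := E.starFunctor_nonempty_iso (e ≪≫ F.toFunctor.leftDerivedZeroIsoSelf)
    exact ⟨(show (E.starAbelianFunctor hA hB L).toFunctor ≅
      (E.starAbelianFunctor hA hB F).toFunctor from e') ≪≫
      (E.starAbelianFunctor hA hB F).toFunctor.leftDerivedZeroIsoSelf.symm⟩
  | succ i ih =>
    cases i with
    | zero =>
      obtain ⟨Δ, hΔ⟩ := exists_isLeftSatellite_zero F.toFunctor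
      obtain ⟨Δ', hΔ'⟩ := E.starAbelianFunctor_isLeftSatellite hA hB (hΔ.of_iso (Iso.refl _) e)
      obtain ⟨Δ'', hΔ''⟩ := exists_isLeftSatellite_zero (E.starAbelianFunctor hA hB F).toFunctor
      exact hΔ'.nonempty_iso hΔ'' (Iso.refl _)
    | succ n =>
      obtain ⟨L', ⟨e'⟩⟩ := exists_smallFunctor (F.toFunctor.leftDerived (n + 1))
      obtain ⟨e''⟩ := ih L' e'
      obtain ⟨Δ, hΔ⟩ := exists_isLeftSatellite_succ F.toFunctor n
      obtain ⟨Δ', hΔ'⟩ := E.starAbelianFunctor_isLeftSatellite hA hB (hΔ.of_iso e' e)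
      obtain ⟨Δ'', hΔ''⟩ := exists_isLeftSatellite_succ (E.starAbelianFunctor hA hB F).toFunctor n
      exact hΔ'.nonempty_iso hΔ'' e''

end Enlargement

theorem mainTheorem10 {S : Type u} {W : Type v} [Infinite S] [Infinite W] (E : Enlargement S W)
    (A B : SmallAbelianCat S) (F : SmallFunctor A.toSmallCat B.toSmallCat)
    (hF : F.toFunctor.Additive) :
    ∃ (hA : (E.starCat A.toSmallCat).IsAbelian (E.star A.P))
      (hB : (E.starCat B.toSmallCat).IsAbelian (E.star B.P)),
      (EnoughInjectives A.toSmallCat.Ob → PreservesFiniteLimits F.toFunctor →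
        EnoughInjectives (E.starCat A.toSmallCat).Ob ∧
        ∀ i : ℕ,
          (∃ R, IsRightDerived A B F i R) ∧
          (∃ R', IsRightDerived (E.starAbelian A hA) (E.starAbelian B hB) (E.starFunctor F) i R') ∧
          ∀ R R', IsRightDerived A B F i R →
            IsRightDerived (E.starAbelian A hA) (E.starAbelian B hB) (E.starFunctor F) i R' →
            E.toStar A.toSmallCat ⋙ (E.starFunctor R).toFunctor =
                R.toFunctor ⋙ E.toStar B.toSmallCat ∧
              Nonempty ((E.starFunctor R).toFunctor ≅ R'.toFunctor)) ∧
      (EnoughProjectives A.toSmallCat.Ob → PreservesFiniteColimits F.toFunctor →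
        EnoughProjectives (E.starCat A.toSmallCat).Ob ∧
        ∀ i : ℕ,
          (∃ L, IsLeftDerived A B F i L) ∧
          (∃ L', IsLeftDerived (E.starAbelian A hA) (E.starAbelian B hB) (E.starFunctor F) i L') ∧
          ∀ L L', IsLeftDerived A B F i L →
            IsLeftDerived (E.starAbelian A hA) (E.starAbelian B hB) (E.starFunctor F) i L' →
            E.toStar A.toSmallCat ⋙ (E.starFunctor L).toFunctor =
                L.toFunctor ⋙ E.toStar B.toSmallCat ∧
              Nonempty ((E.starFunctor L).toFunctor ≅ L'.toFunctor)) := by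
  refine ⟨E.starCat_isAbelian A, E.starCat_isAbelian B, fun _ _ => ?_, fun _ _ => ?_⟩
  · have hI := E.starAbelian_enoughInjectives (E.starCat_isAbelian A)
    have hF' := E.starAbelianFunctor_additive (E.starCat_isAbelian A) (E.starCat_isAbelian B) F
    have hL := E.starAbelianFunctor_preservesFiniteLimits (E.starCat_isAbelian A)
      (E.starCat_isAbelian B) F
    refine ⟨hI, fun i => ⟨?_, ?_, ?_⟩⟩
    · obtain ⟨R, hR⟩ := SmallCat.exists_smallFunctor (F.toFunctor.rightDerived i)
      exact ⟨R, hF, inferInstance, inferInstance, hR⟩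
    · obtain ⟨R, hR⟩ := SmallCat.exists_smallFunctor
        ((E.starAbelianFunctor (E.starCat_isAbelian A)
          (E.starCat_isAbelian B) F).toFunctor.rightDerived i)
      exact ⟨R, hF', hL, inferInstance, hR⟩
    · rintro R R' ⟨_, _, _, ⟨e⟩⟩ ⟨_, _, _, ⟨e'⟩⟩
      obtain ⟨e''⟩ := E.nonempty_iso_rightDerived (E.starCat_isAbelian A) (E.starCat_isAbelian B)
        F i R e
      exact ⟨E.toStar_comp_starFunctor R, ⟨e'' ≪≫ e'.symm⟩⟩
  · have hI := E.starAbelian_enoughProjectives (E.starCat_isAbelian A)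
    have hF' := E.starAbelianFunctor_additive (E.starCat_isAbelian A) (E.starCat_isAbelian B) F
    have hL := E.starAbelianFunctor_preservesFiniteColimits (E.starCat_isAbelian A)
      (E.starCat_isAbelian B) F
    refine ⟨hI, fun i => ⟨?_, ?_, ?_⟩⟩
    · obtain ⟨L, hL⟩ := SmallCat.exists_smallFunctor (F.toFunctor.leftDerived i)
      exact ⟨L, hF, inferInstance, inferInstance, hL⟩
    · obtain ⟨L, hL'⟩ := SmallCat.exists_smallFunctor
        ((E.starAbelianFunctor (E.starCat_isAbelian A)
          (E.starCat_isAbelian B) F).toFunctor.leftDerived i)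
      exact ⟨L, hF', hL, inferInstance, hL'⟩
    · rintro L L' ⟨_, _, _, ⟨e⟩⟩ ⟨_, _, _, ⟨e'⟩⟩
      obtain ⟨e''⟩ := E.nonempty_iso_leftDerived (E.starCat_isAbelian A) (E.starCat_isAbelian B)
        F i L e
      exact ⟨E.toStar_comp_starFunctor L, ⟨e'' ≪≫ e'.symm⟩⟩
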